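/- Notation. On $\mathbb C^{m+1}$ let $J$ be multiplication by $i$. Let $\mathbb S^{2m+1}\subset\mathbb C^{m+1}$ be the unit sphere for the Euclidean metric, and let $\mathbb H^{2m+1}_1=\{z\in\mathbb C^{m+1} : (z,z)=-1\}$ be the anti-de Sitter space, where $(z,w)=\sum_{i=1}^{m}z_i\bar w_i-z_{m+1}\bar w_{m+1}$ and the metric is $\langle\,,\rangle=\Re(\,,)$. An immersion $\phi$ of an $m$-dimensional manifold $M$ into $\mathbb S^{2m+1}$ or $\mathbb H^{2m+1}_1$ is called Legendrian if $\langle \phi_*v,J\phi\rangle=0$ for every tangent vector $v$ of $M$; $M$ then carries the induced Riemannian metric. Let $H$ be the mean curvature vector of $\phi$ in $\mathbb S^{2m+1}$, respectively $\mathbb H^{2m+1}_1$. The Legendrian immersion $\phi$ is minimal if $H=0$, and C-minimal (contact minimal) if $\operatorname{div}JH=0$. Statement. Let $n_1,n_2\ge 0$, $n=n_1+n_2+1$. Let $\psi_1:N_1\to\mathbb S^{2n_1+1}\subset\mathbb C^{n_1+1}$ and $\psi_2:N_2\to\mathbb H^{2n_2+1}_1\subset\mathbb C^{n_2+1}$ be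 C-minimal Legendrian immersions of non-empty $n_i$-dimensional manifolds $N_i$ (with the induced metrics), and let $\alpha=(\alpha_1,\alpha_2):I\to\mathbb H^3_1\subset\mathbb C^2$ be a smooth regular Legendre curve on a non-empty open interval $I$, with $\alpha_1$ nowhere zero if $n_1\neq 0$. Then $$\phi:I\times N_1\times N_2\to\mathbb H^{2n+1}_1\subset\mathbb C^{n_1+1}\times\mathbb C^{n_2+1},\qquad \phi(s,p,q)=(\alpha_1(s)\psi_1(p),\alpha_2(s)\psi_2(q)),$$ is a Legendrian immersion. It is C-minimal if and only if, up to an orientation preserving reparametrization of the curve and up to congruence (that is, after replacing $\alpha$ by $t\mapsto e^{i\theta}\alpha(\tau(t))$, where $\theta\in\mathbb R$ and $\tau$ is an increasing diffeomorphism of an open interval onto $I$), $\alpha$ is a solution of $$\alpha_1'\,\overline{\alpha_1}=\alpha_2'\,\overline{\alpha_2}=i\,e^{i\mu t}\,\overline{\alpha_1}^{\,n_1+1}\,\overline{\alpha_2}^{\,n_2+1}$$ for some $\mu\in\mathbb R$. Moreover, $\phi$ is minimal if and only if $\psi_1$ and $\psi_2$ are minimal and, again up to reparametrization and congruence in this sense,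 $\alpha$ is a solution of this equation with $\mu=0$. -/

import Mathlib

open scoped Manifold ContDiff ComplexConjugate

namespace Legendrian

noncomputable section

/-! Flat ambient spaces: `ℂ^ι` with the Hermitian product of signature `ε`, and its quadrics. -/

/-- The Hermitian product `(z, w) = ∑ ε i * z i * conj (w i)` on `ℂ^ι`. -/
def herm {ι : Type*} [Fintype ι] (ε : ι → ℝ) (z w : ι → ℂ) : ℂ :=
  ∑ i, (ε i : ℂ) * z i * conj (w i)

/-- The (possibly indefinite) metric `⟨z, w⟩ = Re (z, w)`. -/
def metric {ι : Type*} [Fintype ι] (ε : ι → ℝ) (z w : ι → ℂ) : ℝ :=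
  (herm ε z w).re

/-- The quadric `{z | (z, z) = c}` in `ℂ^ι`. -/
def quadric {ι : Type*} [Fintype ι] (ε : ι → ℝ) (c : ℝ) : Set (ι → ℂ) :=
  {z | herm ε z z = (c : ℂ)}

/-- Definite signature on `ℂ^{n+1}`; `quadric (sphereSign n) 1` is the unit sphere `S^{2n+1}`. -/
def sphereSign (n : ℕ) : Fin (n + 1) → ℝ := fun _ => 1

/-- Signature `(+, …, +, -)` on `ℂ^{n+1}`; `quadric (adsSign n) (-1)` is the anti-de Sitter
space `H_1^{2n+1}`. -/
def adsSign (n : ℕ) : Fin (n + 1) → ℝ := fun i => if i = Fin.last n then -1 else 1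

/-- Signature `(+, …, +, -)` on `ℂ^{n₁+1} × ℂ^{n₂+1} = ℂ^{n+1}`, `n = n₁ + n₂ + 1`;
`quadric (prodSign n₁ n₂) (-1)` is the anti-de Sitter space `H_1^{2n+1}`. -/
def prodSign (n₁ n₂ : ℕ) : Fin (n₁ + 1) ⊕ Fin (n₂ + 1) → ℝ :=
  Sum.elim (sphereSign n₁) (adsSign n₂)

/-- The trace `∑ g^{ij} b(e_i, e_j)` of a bilinear `b` with respect to an inner product `g`
(the choice of the basis does not matter). -/
def gTrace {E : Type*} [NormedAddCommGroup E] [NormedSpace ℝ E] [FiniteDimensional ℝ E]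
    {W : Type*} [AddCommGroup W] [Module ℝ W] (g : E → E → ℝ) (b : E → E → W) : W :=
  let e := Module.finBasis ℝ E
  ∑ i, ∑ j, (Matrix.of fun k l => g (e k) (e l))⁻¹ i j • b (e i) (e j)

section Immersions

variable {E : Type*} [NormedAddCommGroup E] [NormedSpace ℝ E]
  {H : Type*} [TopologicalSpace H] (I : ModelWithCorners ℝ E H)
  {M : Type*} [TopologicalSpace M] [ChartedSpace H M]
  {ι : Type*} [Fintype ι]

/-- The differential of a map into `ℂ^ι`; as in Mathlib, `T_x M` is identified with the model
space `E` through the preferred chart at `x`. -/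
def diff (φ : M → ι → ℂ) (x : M) : E →L[ℝ] (ι → ℂ) :=
  mfderiv I 𝓘(ℝ, ι → ℂ) φ x

/-- The second differential of `φ` at `x` in the preferred chart at `x`. -/
def diff₂ (φ : M → ι → ℂ) (x : M) : E →L[ℝ] E →L[ℝ] (ι → ℂ) :=
  fderivWithin ℝ (fderivWithin ℝ (φ ∘ (extChartAt I x).symm) (Set.range I)) (Set.range I)
    (extChartAt I x x)

/-- `φ : M → quadric ε c` is a (smooth) Legendrian immersion: `dim M = n` where the ambient
space is `ℂ^{n+1}`, `φ` is an immersion and the pull-back of the Liouville form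
`Λ_z(v) = ⟨v, J z⟩` vanishes. -/
structure IsLegendrianImmersion (ε : ι → ℝ) (c : ℝ) (φ : M → ι → ℂ) : Prop where
  dim : Module.finrank ℝ E + 1 = Fintype.card ι
  smooth : ContMDiff I 𝓘(ℝ, ι → ℂ) ∞ φ
  mem : ∀ x, φ x ∈ quadric ε c
  immersion : ∀ x, Function.Injective (diff I φ x)
  legendrian : ∀ x v, metric ε (diff I φ x v) (Complex.I • φ x) = 0

/-- The metric induced on `M` by `φ`. -/
def inducedMetric (ε : ι → ℝ) (φ : M → ι → ℂ) (x : M) (u v : E) : ℝ :=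
  metric ε (diff I φ x u) (diff I φ x v)

variable [FiniteDimensional ℝ E]

/-- Orthogonal projection of `w : ℂ^ι` on the tangent space `dφ (T_x M)`. -/
def tangentPart (ε : ι → ℝ) (φ : M → ι → ℂ) (x : M) (w : ι → ℂ) : ι → ℂ :=
  gTrace (inducedMetric I ε φ x) fun u v => metric ε w (diff I φ x u) • diff I φ x v

/-- The second fundamental form of `φ : M → quadric ε c`: the component of the second
differential which is orthogonal to `dφ (T_x M)` and to the position vector `φ x` (the latter
spans the normal line of the quadric). -/
def secondFundamentalForm (ε : ι → ℝ) (c : ℝ) (φ : M → ι → ℂ) (x : M) (u v : E) : ι → ℂ :=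
  diff₂ I φ x u v - tangentPart I ε φ x (diff₂ I φ x u v)
    - (metric ε (diff₂ I φ x u v) (φ x) / c) • φ x

/-- The mean curvature vector `H = (1/n) trace σ` of `φ : M → quadric ε c`, `n = dim M`. -/
def meanCurvature (ε : ι → ℝ) (c : ℝ) (φ : M → ι → ℂ) (x : M) : ι → ℂ :=
  (Module.finrank ℝ E : ℝ)⁻¹ •
    gTrace (inducedMetric I ε φ x) (secondFundamentalForm I ε c φ x)

/-- The divergence on `M` (with the induced metric) of a field `X : M → ℂ^ι` tangent along `φ`:
the trace of `∇ X`, where the Levi-Civita derivative `∇ X` is the tangential part of the flat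
derivative, so that `⟨∇_u X, dφ v⟩ = ⟨D_u X, dφ v⟩`. -/
def divergence (ε : ι → ℝ) (φ : M → ι → ℂ) (X : M → ι → ℂ) (x : M) : ℝ :=
  gTrace (inducedMetric I ε φ x) fun u v => metric ε (diff I X x u) (diff I φ x v)

/-- A minimal Legendrian immersion: `H = 0`. -/
def IsMinimalLegendrian (ε : ι → ℝ) (c : ℝ) (φ : M → ι → ℂ) : Prop :=
  IsLegendrianImmersion I ε c φ ∧ ∀ x, meanCurvature I ε c φ x = 0

/-- A contact minimal (C-minimal) Legendrian immersion: `div J H = 0`. -/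
def IsCMinimalLegendrian (ε : ι → ℝ) (c : ℝ) (φ : M → ι → ℂ) : Prop :=
  IsLegendrianImmersion I ε c φ ∧
    ∀ x, divergence I ε φ (fun y => Complex.I • meanCurvature I ε c φ y) x = 0

end Immersions

/-- A (smooth, regular) Legendre curve `α = (α 0, α 1) : S → H_1^3 ⊆ ℂ²`. -/
structure IsLegendreCurve (S : Set ℝ) (α : ℝ → Fin 2 → ℂ) : Prop where
  smooth : ContDiffOn ℝ ∞ α S
  mem : ∀ s ∈ S, α s ∈ quadric (adsSign 1) (-1)
  regular : ∀ s ∈ S, deriv α s ≠ 0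
  legendrian : ∀ s ∈ S, metric (adsSign 1) (deriv α s) (Complex.I • α s) = 0

/-- The map `φ(s, p, q) = (α₁(s) ψ₁(p), α₂(s) ψ₂(q))`. -/
def join {n₁ n₂ : ℕ} {N₁ N₂ : Type*} (S : TopologicalSpace.Opens ℝ) (α : ℝ → Fin 2 → ℂ)
    (ψ₁ : N₁ → Fin (n₁ + 1) → ℂ) (ψ₂ : N₂ → Fin (n₂ + 1) → ℂ) :
    S × N₁ × N₂ → Fin (n₁ + 1) ⊕ Fin (n₂ + 1) → ℂ :=
  fun x => Sum.elim (α x.1 0 • ψ₁ x.2.1) (α x.1 1 • ψ₂ x.2.2)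

/-- `α` solves `α₁' ᾱ₁ = α₂' ᾱ₂ = i e^{iμt} ᾱ₁^{n₁+1} ᾱ₂^{n₂+1}` on `T`. -/
def SolvesODE (n₁ n₂ : ℕ) (μ : ℝ) (T : Set ℝ) (α : ℝ → Fin 2 → ℂ) : Prop :=
  ∀ t ∈ T, ∀ j : Fin 2, deriv α t j * conj (α t j) =
    Complex.I * Complex.exp (Complex.I * μ * t) *
      conj (α t 0) ^ (n₁ + 1) * conj (α t 1) ^ (n₂ + 1)

/-- `τ` is an (orientation preserving) diffeomorphism of the open interval `T` onto `S`. -/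
structure IsReparametrization (T S : Set ℝ) (τ : ℝ → ℝ) : Prop where
  isOpen : IsOpen T
  ordConnected : T.OrdConnected
  smooth : ContDiffOn ℝ ∞ τ T
  bijOn : Set.BijOn τ T S
  deriv_pos : ∀ t ∈ T, 0 < deriv τ t

/-- Up to reparametrization and up to congruence (a rotation `e^{iθ}` of the ambient space),
the curve `α` on `S` solves the equation with parameter `μ`. -/
def SolvesODEUpToCongruence (n₁ n₂ : ℕ) (μ : ℝ) (S : Set ℝ) (α : ℝ → Fin 2 → ℂ) : Prop :=
  ∃ (T : Set ℝ) (τ : ℝ → ℝ) (θ : ℝ), IsReparametrization T S τ ∧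
    SolvesODE n₁ n₂ μ T fun t => Complex.exp (θ * Complex.I) • α (τ t)

end

end Legendrian

open scoped Topology

set_option linter.unusedSectionVars false

namespace Legendrian

/-! ### Hermitian products and positivity on tangent spaces -/

section Herm

variable {ι κ : Type*} [Fintype ι] [Fintype κ] (ε : ι → ℝ)

/-! Constancy of |α₁|² − |α₂|² together with the Legendre condition gives α₁' ᾱ₁ = α₂' ᾱ₂. As α₂
never vanishes, α₁' = h ᾱ₂ and α₂' = h ᾱ₁ with h the nowhere zero `slope`. The metric induced by φ
is |h|² ds² + |α₁|² g₁ + |α₂|² g₂, so orthonormal bases of the factors rescale to one of the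
product. Let w = α₁^n₁ α₂^n₂ be the `weight`, and κ, the `phaseRate`, the derivative of the argument
of h w.

Mean curvature. Tracing the second differential over the adapted basis and discarding its tangential
and radial parts (`curvatureTrace_join`) gives n H = (κ/|h|²) J φ_s + (n₁ H₁/ᾱ₁, n₂ H₂/ᾱ₂). The
summands are independent, so H = 0 exactly when κ, H₁ and H₂ vanish.

Contact minimality. J turns the first summand into −(κ/|h|²) φ_s. The volume density in s is |h||w|,
so the divergence of this field is −(κ|w|/|h|)'/(|h||w|). The remaining summand contributes nᵢ div(J
Hᵢ)/|αᵢ|² = 0. Hence φ is C-minimal exactly when κ|w|/|h| is constant (`divergence_join`,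
`exists_phaseRate_eq_iff`).

The equation. For e^{iθ} α∘τ, after cancelling ᾱ₁ ᾱ₂, it reads τ' h = i e^{iμt} e^{−i(n₁+n₂+2)θ} w̄
(`solvesODE_iff`). Its modulus says τ' = |w|/|h|; its argument says that the phase of h w turns at
rate μ in t, that is τ' κ = μ. Eliminating τ' leaves κ|w|/|h| = μ. Conversely, integrating |h|/|w|
and inverting produces τ, and θ absorbs the remaining constant phase
(`solvesODEUpToCongruence_iff`). -/

lemma herm_add_left (z z' w : ι → ℂ) : herm ε (z + z') w = herm ε z w + herm ε z' w := by
  simp only [herm, Pi.add_apply, ← Finset.sum_add_distrib]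
  exact Finset.sum_congr rfl fun i _ => by ring

lemma herm_add_right (z w w' : ι → ℂ) : herm ε z (w + w') = herm ε z w + herm ε z w' := by
  simp only [herm, Pi.add_apply, ← Finset.sum_add_distrib, map_add]
  exact Finset.sum_congr rfl fun i _ => by ring

lemma herm_smul_left (a : ℂ) (z w : ι → ℂ) : herm ε (a • z) w = a * herm ε z w := by
  simp only [herm, Pi.smul_apply, smul_eq_mul, Finset.mul_sum]
  exact Finset.sum_congr rfl fun i _ => by ring

lemma herm_smul_right (a : ℂ) (z w : ι → ℂ) : herm ε z (a • w) = conj a * herm ε z w := by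
  simp only [herm, Pi.smul_apply, smul_eq_mul, Finset.mul_sum, map_mul]
  exact Finset.sum_congr rfl fun i _ => by ring

lemma herm_real_smul_left (a : ℝ) (z w : ι → ℂ) : herm ε (a • z) w = a * herm ε z w := by
  rw [← herm_smul_left, Complex.coe_smul]

lemma herm_real_smul_right (a : ℝ) (z w : ι → ℂ) : herm ε z (a • w) = a * herm ε z w := by
  rw [← Complex.coe_smul, herm_smul_right, Complex.conj_ofReal]

lemma conj_herm (z w : ι → ℂ) : conj (herm ε z w) = herm ε w z := by
  simp only [herm, map_sum, map_mul, Complex.conj_ofReal, Complex.conj_conj]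
  exact Finset.sum_congr rfl fun i _ => by ring

@[simp] lemma herm_zero_left (w : ι → ℂ) : herm ε 0 w = 0 := by simp [herm]

@[simp] lemma herm_zero_right (w : ι → ℂ) : herm ε w 0 = 0 := by simp [herm]

/-- The Hermitian product as a continuous real bilinear map. -/
noncomputable def hermL : (ι → ℂ) →L[ℝ] (ι → ℂ) →L[ℝ] ℂ :=
  LinearMap.toContinuousBilinearMap
    (LinearMap.mk₂ ℝ (herm ε) (herm_add_left ε)
      (fun a z w => by rw [herm_real_smul_left, Complex.real_smul]) (herm_add_right ε)
      (fun a z w => by rw [herm_real_smul_right, Complex.real_smul]))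

@[simp] lemma hermL_apply (z w : ι → ℂ) : hermL ε z w = herm ε z w := rfl

/-- The metric as a continuous bilinear form. -/
noncomputable def metricL : (ι → ℂ) →L[ℝ] (ι → ℂ) →L[ℝ] ℝ :=
  (ContinuousLinearMap.compL ℝ (ι → ℂ) ℂ ℝ Complex.reCLM).comp (hermL ε)

lemma metricL_apply (z w : ι → ℂ) : metricL ε z w = metric ε z w := rfl

lemma metric_comm (z w : ι → ℂ) : metric ε z w = metric ε w z := by
  rw [metric, metric, ← conj_herm, Complex.conj_re]

lemma metric_add_left (z z' w : ι → ℂ) : metric ε (z + z') w = metric ε z w + metric ε z' w := by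
  simp [metric, herm_add_left]

lemma metric_add_right (z w w' : ι → ℂ) : metric ε z (w + w') = metric ε z w + metric ε z w' := by
  simp [metric, herm_add_right]

lemma metric_smul_left (a : ℝ) (z w : ι → ℂ) : metric ε (a • z) w = a * metric ε z w := by
  simp [metric, herm_real_smul_left]

lemma metric_smul_right (a : ℝ) (z w : ι → ℂ) : metric ε z (a • w) = a * metric ε z w := by
  simp [metric, herm_real_smul_right]

lemma metric_sum_left {T : Type*} (s : Finset T) (f : T → ι → ℂ) (w : ι → ℂ) :
    metric ε (∑ i ∈ s, f i) w = ∑ i ∈ s, metric ε (f i) w := by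
  simp only [← metricL_apply, map_sum, sum_apply]

lemma metric_sum_right {T : Type*} (s : Finset T) (f : T → ι → ℂ) (w : ι → ℂ) :
    metric ε w (∑ i ∈ s, f i) = ∑ i ∈ s, metric ε w (f i) := by
  simp only [← metricL_apply, map_sum]

lemma herm_sum_left {T : Type*} (s : Finset T) (f : T → ι → ℂ) (w : ι → ℂ) :
    herm ε (∑ i ∈ s, f i) w = ∑ i ∈ s, herm ε (f i) w := by
  simp only [← hermL_apply, map_sum, sum_apply]

lemma metric_I_smul_right (z w : ι → ℂ) : metric ε z (Complex.I • w) = (herm ε z w).im := by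
  simp [metric, herm_smul_right]

lemma herm_sumElim (δ : κ → ℝ) (z w : ι → ℂ) (z' w' : κ → ℂ) :
    herm (Sum.elim ε δ) (Sum.elim z z') (Sum.elim w w') = herm ε z w + herm δ z' w' := by
  simp [herm, Fintype.sum_sum_type]

lemma herm_sphereSign_pos {n : ℕ} {z : Fin (n + 1) → ℂ} (hz : z ≠ 0) :
    0 < metric (sphereSign n) z z := by
  have h : metric (sphereSign n) z z = ∑ i, Complex.normSq (z i) := by
    simp [metric, herm, sphereSign, Complex.mul_conj]
  obtain ⟨i, hi⟩ := Function.ne_iff.1 hz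
  rw [h]
  exact Finset.sum_pos' (fun i _ => Complex.normSq_nonneg _)
    ⟨i, Finset.mem_univ _, Complex.normSq_pos.2 hi⟩

lemma herm_adsSign {n : ℕ} (z w : Fin (n + 1) → ℂ) :
    herm (adsSign n) z w = ∑ i : Fin n, z i.castSucc * conj (w i.castSucc) -
      z (Fin.last n) * conj (w (Fin.last n)) := by
  simp [herm, adsSign, Fin.sum_univ_castSucc, Fin.castSucc_ne_last, sub_eq_add_neg]

/-- Reverse Cauchy–Schwarz: the Hermitian complement of a timelike vector is spacelike.
Orthogonality bounds |z_last|²|w_last|² by A (|w_last|² − 1), where A is the squared norm of the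
other coordinates of z; this forces A > |z_last|² unless z = 0. -/
lemma metric_adsSign_pos {n : ℕ} {z w : Fin (n + 1) → ℂ} (hw : herm (adsSign n) w w = -1)
    (hzw : herm (adsSign n) z w = 0) (hz : z ≠ 0) : 0 < metric (adsSign n) z z := by
  have key : ∀ v : Fin (n + 1) → ℂ, metric (adsSign n) v v =
      ∑ i : Fin n, ‖v i.castSucc‖ ^ 2 - ‖v (Fin.last n)‖ ^ 2 := fun v => by
    simp [metric, herm_adsSign, Complex.mul_conj, Complex.normSq_eq_norm_sq]
    simp only [← Complex.ofReal_pow, Complex.ofReal_re]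
  have hw' : ∑ i : Fin n, ‖w i.castSucc‖ ^ 2 = ‖w (Fin.last n)‖ ^ 2 - 1 := by
    have := key w
    rw [metric, hw] at this
    simp at this
    linarith
  have hcs : ‖z (Fin.last n)‖ ^ 2 * ‖w (Fin.last n)‖ ^ 2 ≤
      (∑ i : Fin n, ‖z i.castSucc‖ ^ 2) * ∑ i : Fin n, ‖w i.castSucc‖ ^ 2 := by
    rw [herm_adsSign, sub_eq_zero] at hzw
    have h1 : ‖z (Fin.last n)‖ * ‖w (Fin.last n)‖ ≤
        ∑ i : Fin n, ‖z i.castSucc‖ * ‖w i.castSucc‖ := by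
      calc ‖z (Fin.last n)‖ * ‖w (Fin.last n)‖ = ‖z (Fin.last n) * conj (w (Fin.last n))‖ := by simp
        _ = ‖∑ i : Fin n, z i.castSucc * conj (w i.castSucc)‖ := by rw [hzw]
        _ ≤ ∑ i : Fin n, ‖z i.castSucc * conj (w i.castSucc)‖ := norm_sum_le _ _
        _ = _ := by simp
    calc ‖z (Fin.last n)‖ ^ 2 * ‖w (Fin.last n)‖ ^ 2
        = (‖z (Fin.last n)‖ * ‖w (Fin.last n)‖) ^ 2 := by ring
      _ ≤ (∑ i : Fin n, ‖z i.castSucc‖ * ‖w i.castSucc‖) ^ 2 := by gcongr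
      _ ≤ _ := Finset.sum_mul_sq_le_sq_mul_sq _ _ _
  rw [key]
  set A := ∑ i : Fin n, ‖z i.castSucc‖ ^ 2 with hA
  have hA0 : 0 ≤ A := Finset.sum_nonneg fun i _ => by positivity
  have hAle : 0 ≤ ∑ i : Fin n, ‖w i.castSucc‖ ^ 2 := Finset.sum_nonneg fun i _ => by positivity
  rw [hw'] at hcs hAle
  rcases hA0.eq_or_lt with h0 | h0
  · exfalso
    apply hz
    rw [← h0, zero_mul] at hcs
    have hl : ‖z (Fin.last n)‖ ^ 2 = 0 := by nlinarith [sq_nonneg ‖z (Fin.last n)‖]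
    have hi := (Finset.sum_eq_zero_iff_of_nonneg (fun i _ => by positivity)).1 (hA ▸ h0.symm)
    funext i
    refine Fin.lastCases (by simpa using hl) (fun i => ?_) i
    simpa using hi i (Finset.mem_univ _)
  · nlinarith [sq_nonneg ‖z (Fin.last n)‖]

end Herm

/-! ### Metric traces through orthonormal bases -/

section Trace

/-- The form g is made a local inner product structure and its standard orthonormal basis is taken.
Only the module structure of E enters, so a norm already present on the model space does not
interfere. -/
lemma exists_orthonormal_basis {E : Type*} [AddCommGroup E] [Module ℝ E] [FiniteDimensional ℝ E]
    (g : E →ₗ[ℝ] E →ₗ[ℝ] ℝ) (hsymm : ∀ u v, g u v = g v u) (hpos : ∀ u, u ≠ 0 → 0 < g u u) :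
    ∃ e : Module.Basis (Fin (Module.finrank ℝ E)) ℝ E,
      ∀ i j, g (e i) (e j) = if i = j then 1 else 0 := by
  let core : InnerProductSpace.Core ℝ E :=
    { inner := fun u v => g u v
      conj_inner_symm := fun u v => by simpa using hsymm v u
      re_inner_nonneg := fun u => by
        rcases eq_or_ne u 0 with rfl | h
        · simp
        · simpa using (hpos u h).le
      add_left := fun u v w => by simp
      smul_left := fun u v r => by simp
      definite := fun u h => by
        by_contra h'
        exact (hpos u h').ne' h }
  let _ : NormedAddCommGroup E := core.toNormedAddCommGroup
  let _ : InnerProductSpace ℝ E := InnerProductSpace.ofCore core.toCore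
  refine ⟨(stdOrthonormalBasis ℝ E).toBasis, fun i j => ?_⟩
  rw [OrthonormalBasis.coe_toBasis]
  exact orthonormal_iff_ite.1 (stdOrthonormalBasis ℝ E).orthonormal i j

variable {E E' : Type*} [NormedAddCommGroup E] [NormedSpace ℝ E] [FiniteDimensional ℝ E]
  [NormedAddCommGroup E'] [NormedSpace ℝ E'] [FiniteDimensional ℝ E']
  {W : Type*} [AddCommGroup W] [Module ℝ W]

omit [FiniteDimensional ℝ E] in
-- If Q expresses f in the orthonormal basis e, the Gram matrix of f is QᵀQ, and P = `f.toMatrix e`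
-- inverts Q; so PPᵀ inverts the Gram matrix.
lemma gram_mul_eq_one {κ : Type*} [Fintype κ] [DecidableEq κ] (e : Module.Basis κ ℝ E)
    {g : E → E → ℝ} (g' : E →ₗ[ℝ] E →ₗ[ℝ] ℝ) (hg : ∀ u v, g u v = g' u v)
    (he : ∀ i j, g (e i) (e j) = if i = j then 1 else 0) {κ' : Type*} [Fintype κ'] [DecidableEq κ']
    (f : Module.Basis κ' ℝ E) :
    (Matrix.of fun k l => g (f k) (f l)) * (f.toMatrix e * (f.toMatrix e).transpose) = 1 := by
  have hQ : ∀ k, f k = ∑ i, e.toMatrix f i k • e i := fun k => (e.sum_toMatrix_smul_self f k).symm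
  have hG : (Matrix.of fun k l => g (f k) (f l)) = (e.toMatrix f).transpose * e.toMatrix f := by
    ext k l
    rw [Matrix.mul_apply, Matrix.of_apply, hg, hQ k, hQ l]
    simp only [map_sum, map_smul, LinearMap.sum_apply, LinearMap.smul_apply, smul_eq_mul, ← hg, he,
      Matrix.transpose_apply, mul_ite, mul_one, mul_zero, Finset.sum_ite_eq',
      Finset.mem_univ, if_true]
    exact Finset.sum_congr rfl fun _ _ => mul_comm _ _
  rw [hG, Matrix.mul_assoc, ← Matrix.mul_assoc (e.toMatrix f), Module.Basis.toMatrix_mul_toMatrix_flip,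
    Matrix.one_mul, ← Matrix.transpose_mul, Module.Basis.toMatrix_mul_toMatrix_flip,
    Matrix.transpose_one]

/-- The trace is the sum over an orthonormal basis. -/
lemma gTrace_eq_sum {κ : Type*} [Fintype κ] [DecidableEq κ] (e : Module.Basis κ ℝ E)
    {g : E → E → ℝ} {b : E → E → W} (g' : E →ₗ[ℝ] E →ₗ[ℝ] ℝ) (hg : ∀ u v, g u v = g' u v)
    (b' : E →ₗ[ℝ] E →ₗ[ℝ] W) (hb : ∀ u v, b u v = b' u v)
    (he : ∀ i j, g (e i) (e j) = if i = j then 1 else 0) :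
    gTrace g b = ∑ i, b (e i) (e i) := by
  set f := Module.finBasis ℝ E with hf
  have hP : ∀ i, e i = ∑ k, f.toMatrix e k i • f k := fun i => (f.sum_toMatrix_smul_self e i).symm
  have hinv := Matrix.inv_eq_right_inv (gram_mul_eq_one e g' hg he f)
  have hR : ∀ i, b (e i) (e i) =
      ∑ k, ∑ l, (f.toMatrix e k i * f.toMatrix e l i) • b (f k) (f l) := fun i => by
    rw [hb, hP i]
    simp only [map_sum, map_smul, LinearMap.sum_apply, LinearMap.smul_apply, Finset.smul_sum,
      smul_smul, ← hb]
    rw [Finset.sum_comm]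
    exact Finset.sum_congr rfl fun k _ => Finset.sum_congr rfl fun l _ => by rw [mul_comm]
  simp only [hR]
  rw [Finset.sum_comm]
  simp only [gTrace]
  refine Finset.sum_congr rfl fun k _ => ?_
  rw [Finset.sum_comm]
  refine Finset.sum_congr rfl fun l _ => ?_
  rw [hinv, Matrix.mul_apply, Finset.sum_smul]
  rfl

end Trace

/-! ### Tangential and normal projections, and the trace of the second fundamental form -/

section Projection

variable {E : Type*} [NormedAddCommGroup E] [NormedSpace ℝ E] [FiniteDimensional ℝ E]
  {ι : Type*} [Fintype ι] {κ : Type*} [Fintype κ] [DecidableEq κ]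

/-- The first fundamental form of `A` as a bilinear form. -/
noncomputable def firstForm (ε : ι → ℝ) (A : E →L[ℝ] ι → ℂ) : E →ₗ[ℝ] E →ₗ[ℝ] ℝ :=
  LinearMap.mk₂ ℝ (fun u v => metric ε (A u) (A v))
    (by intros; rw [map_add, metric_add_left]) (by intros; rw [map_smul, metric_smul_left]; rfl)
    (by intros; rw [map_add, metric_add_right])
    (by intros; rw [map_smul, metric_smul_right]; rfl)

/-- An orthonormal basis for the metric induced by `A`. -/
def IsOrtho (ε : ι → ℝ) (A : E →L[ℝ] ι → ℂ) (e : Module.Basis κ ℝ E) : Prop :=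
  ∀ i j, metric ε (A (e i)) (A (e j)) = if i = j then 1 else 0

lemma exists_isOrtho {ε : ι → ℝ} {A : E →L[ℝ] ι → ℂ}
    (hpos : ∀ u, u ≠ 0 → 0 < metric ε (A u) (A u)) :
    ∃ e : Module.Basis (Fin (Module.finrank ℝ E)) ℝ E, IsOrtho ε A e :=
  exists_orthonormal_basis (firstForm ε A) (fun _ _ => metric_comm ε _ _) hpos

lemma IsOrtho.gTrace {ε : ι → ℝ} {A : E →L[ℝ] ι → ℂ} {e : Module.Basis κ ℝ E}
    (he : IsOrtho ε A e) {W : Type*} [AddCommGroup W] [Module ℝ W]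
    {b : E → E → W} (b' : E →ₗ[ℝ] E →ₗ[ℝ] W) (hb : ∀ u v, b u v = b' u v) :
    gTrace (fun u v => metric ε (A u) (A v)) b = ∑ i, b (e i) (e i) :=
  gTrace_eq_sum e (firstForm ε A) (fun _ _ => rfl) b' hb he

/-- The orthogonal projection on the range of `A`. -/
noncomputable def projTan (ε : ι → ℝ) (A : E →L[ℝ] ι → ℂ) (w : ι → ℂ) : ι → ℂ :=
  gTrace (fun u v => metric ε (A u) (A v)) fun u v => metric ε w (A u) • A v

/-- The component orthogonal to the range of `A` and to the position vector `z`. -/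
noncomputable def projNormal (ε : ι → ℝ) (c : ℝ) (A : E →L[ℝ] ι → ℂ) (z w : ι → ℂ) : ι → ℂ :=
  w - projTan ε A w - (metric ε w z / c) • z

/-- The mean curvature vector times the dimension, from the differentials of first and second
order. -/
noncomputable def curvatureTrace (ε : ι → ℝ) (c : ℝ) (A : E →L[ℝ] ι → ℂ)
    (B : E →L[ℝ] E →L[ℝ] ι → ℂ) (z : ι → ℂ) : ι → ℂ :=
  gTrace (fun u v => metric ε (A u) (A v)) fun u v => projNormal ε c A z (B u v)

lemma IsOrtho.projTan_eq {ε : ι → ℝ} {A : E →L[ℝ] ι → ℂ} {e : Module.Basis κ ℝ E}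
    (he : IsOrtho ε A e) (w : ι → ℂ) :
    projTan ε A w = ∑ i, metric ε w (A (e i)) • A (e i) :=
  he.gTrace (LinearMap.mk₂ ℝ (fun u v => metric ε w (A u) • A v)
    (by intros; rw [map_add, metric_add_right, add_smul])
    (by intros; rw [map_smul, metric_smul_right, mul_smul])
    (by intros; rw [map_add, smul_add]) (by intros; rw [map_smul, smul_comm])) fun _ _ => rfl

omit [FiniteDimensional ℝ E] in
lemma IsOrtho.metric_map {ε : ι → ℝ} {A : E →L[ℝ] ι → ℂ} {e : Module.Basis κ ℝ E}
    (he : IsOrtho ε A e) (ξ : E) (i : κ) : metric ε (A ξ) (A (e i)) = e.repr ξ i := by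
  conv_lhs => rw [← e.sum_repr ξ]
  simp only [map_sum, map_smul, metric_sum_left, metric_smul_left]
  simp [he _ i]

omit [FiniteDimensional ℝ E] in
lemma IsOrtho.injective {ε : ι → ℝ} {A : E →L[ℝ] ι → ℂ} {e : Module.Basis κ ℝ E}
    (he : IsOrtho ε A e) : Function.Injective A := fun ξ ξ' h =>
  e.ext_elem fun i => by rw [← he.metric_map, ← he.metric_map, h]

lemma IsOrtho.projTan_map {ε : ι → ℝ} {A : E →L[ℝ] ι → ℂ} {e : Module.Basis κ ℝ E}
    (he : IsOrtho ε A e) (ξ : E) : projTan ε A (A ξ) = A ξ := by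
  rw [he.projTan_eq]
  simp only [he.metric_map]
  conv_rhs => rw [← e.sum_repr ξ, map_sum]
  simp only [map_smul]

/-- `projNormal` as a linear map. -/
noncomputable def IsOrtho.projNormalL {ε : ι → ℝ} {A : E →L[ℝ] ι → ℂ} {e : Module.Basis κ ℝ E}
    (he : IsOrtho ε A e) (c : ℝ) (z : ι → ℂ) : (ι → ℂ) →ₗ[ℝ] ι → ℂ where
  toFun := projNormal ε c A z
  map_add' v w := by
    simp only [projNormal, he.projTan_eq, metric_add_left, add_smul, Finset.sum_add_distrib, add_div]
    abel
  map_smul' a w := by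
    simp only [projNormal, he.projTan_eq, metric_smul_left, mul_smul, ← Finset.smul_sum, smul_sub,
      RingHom.id_apply, mul_div_assoc]

lemma IsOrtho.projNormal_map {ε : ι → ℝ} {A : E →L[ℝ] ι → ℂ} {e : Module.Basis κ ℝ E}
    (he : IsOrtho ε A e) {c : ℝ} {z : ι → ℂ} (hz : ∀ u, metric ε (A u) z = 0) (ξ : E) :
    projNormal ε c A z (A ξ) = 0 := by
  simp [projNormal, he.projTan_map, hz]

lemma IsOrtho.projNormal_position {ε : ι → ℝ} {A : E →L[ℝ] ι → ℂ} {e : Module.Basis κ ℝ E}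
    (he : IsOrtho ε A e) {c : ℝ} (hc : c ≠ 0) {z : ι → ℂ} (hz : ∀ u, metric ε (A u) z = 0)
    (hzz : metric ε z z = c) : projNormal ε c A z z = 0 := by
  simp [projNormal, he.projTan_eq, metric_comm ε z, hz, hzz, hc]

lemma IsOrtho.projNormal_eq_self {ε : ι → ℝ} {A : E →L[ℝ] ι → ℂ} {e : Module.Basis κ ℝ E}
    (he : IsOrtho ε A e) {c : ℝ} {z w : ι → ℂ} (hw : ∀ u, metric ε w (A u) = 0)
    (hwz : metric ε w z = 0) : projNormal ε c A z w = w := by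
  simp [projNormal, he.projTan_eq, hw, hwz]

lemma IsOrtho.metric_projNormal_map {ε : ι → ℝ} {A : E →L[ℝ] ι → ℂ} {e : Module.Basis κ ℝ E}
    (he : IsOrtho ε A e) {c : ℝ} {z : ι → ℂ} (hz : ∀ u, metric ε (A u) z = 0) (w : ι → ℂ) (u : E) :
    metric ε (projNormal ε c A z w) (A u) = 0 := by
  have h : metric ε (projTan ε A w) (A u) = metric ε w (A u) := by
    conv_rhs => rw [← he.projTan_map u]
    rw [he.projTan_eq, he.projTan_eq, metric_sum_left, metric_sum_right]
    refine Finset.sum_congr rfl fun i _ => ?_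
    rw [metric_smul_left, metric_smul_right, metric_comm ε (A u), mul_comm]
  rw [projNormal, sub_sub, sub_eq_add_neg, ← neg_one_smul ℝ, metric_add_left, metric_smul_left,
    metric_add_left, h, metric_smul_left, metric_comm ε z, hz]
  ring

lemma IsOrtho.curvatureTrace_eq {ε : ι → ℝ} {A : E →L[ℝ] ι → ℂ} {e : Module.Basis κ ℝ E}
    (he : IsOrtho ε A e) (c : ℝ) (B : E →L[ℝ] E →L[ℝ] ι → ℂ) (z : ι → ℂ) :
    curvatureTrace ε c A B z = projNormal ε c A z (∑ i, B (e i) (e i)) := by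
  refine (he.gTrace (LinearMap.mk₂ ℝ (fun u v => he.projNormalL c z (B u v))
    (by intros; simp) (by intros; simp) (by intros; simp) (by intros; simp)) fun _ _ => rfl).trans ?_
  exact (map_sum (he.projNormalL c z) _ _).symm

/-- Characterization of the trace of the second fundamental form. -/
lemma IsOrtho.curvatureTrace_eq_of_decomposition {ε : ι → ℝ} {A : E →L[ℝ] ι → ℂ}
    {e : Module.Basis κ ℝ E} (he : IsOrtho ε A e) {c : ℝ} (hc : c ≠ 0)
    {B : E →L[ℝ] E →L[ℝ] ι → ℂ} {z : ι → ℂ} (hz : ∀ u, metric ε (A u) z = 0)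
    (hzz : metric ε z z = c) {R : ι → ℂ} {ξ : E} {r : ℝ} (hR : ∀ u, metric ε R (A u) = 0)
    (hRz : metric ε R z = 0) (h : ∑ i, B (e i) (e i) = R + A ξ + r • z) :
    curvatureTrace ε c A B z = R := by
  rw [he.curvatureTrace_eq, h]
  change he.projNormalL c z _ = R
  rw [map_add, map_add, map_smul]
  change projNormal ε c A z R + projNormal ε c A z (A ξ) + r • projNormal ε c A z z = R
  rw [he.projNormal_eq_self hR hRz, he.projNormal_map hz, he.projNormal_position hc hz hzz]
  simp

lemma IsOrtho.exists_decomposition {ε : ι → ℝ} {A : E →L[ℝ] ι → ℂ}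
    {e : Module.Basis κ ℝ E} (he : IsOrtho ε A e) (c : ℝ)
    (B : E →L[ℝ] E →L[ℝ] ι → ℂ) (z : ι → ℂ) :
    ∃ ξ, ∑ i, B (e i) (e i) =
      curvatureTrace ε c A B z + A ξ + (metric ε (∑ i, B (e i) (e i)) z / c) • z := by
  refine ⟨∑ i, metric ε (∑ i, B (e i) (e i)) (A (e i)) • e i, ?_⟩
  rw [he.curvatureTrace_eq, projNormal, he.projTan_eq]
  simp only [map_sum, map_smul]
  abel

omit [FiniteDimensional ℝ E] in
lemma IsOrtho.isUnit_det {ε : ι → ℝ} {A : E →L[ℝ] ι → ℂ} {e : Module.Basis κ ℝ E}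
    (he : IsOrtho ε A e) {κ' : Type*} [Fintype κ'] [DecidableEq κ'] (f : Module.Basis κ' ℝ E) :
    IsUnit (Matrix.of fun k l => metric ε (A (f k)) (A (f l))).det :=
  Matrix.isUnit_det_of_right_inverse
    (gram_mul_eq_one (g := fun u v => metric ε (A u) (A v)) e (firstForm ε A) (fun _ _ => rfl) he f)

/-- The trace of the second fundamental form does not depend on the chart. -/
lemma IsOrtho.curvatureTrace_comp {ε : ι → ℝ} {A A' : E →L[ℝ] ι → ℂ} {L : E ≃ₗ[ℝ] E}
    {e : Module.Basis κ ℝ E} (he : IsOrtho ε A' e) (hA : ∀ u, A' u = A (L u))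
    {B B' : E →L[ℝ] E →L[ℝ] ι → ℂ} {Q : E → E → E}
    (hB : ∀ u v, B' u v = B (L u) (L v) + A (Q u v)) (c : ℝ) {z : ι → ℂ}
    (hz : ∀ u, metric ε (A u) z = 0) :
    curvatureTrace ε c A' B' z = curvatureTrace ε c A B z := by
  have he' : IsOrtho ε A (e.map L) := fun i j => by
    simpa [hA] using he i j
  have hP : projNormal ε c A' z = projNormal ε c A z := by
    funext w
    simp [projNormal, he.projTan_eq, he'.projTan_eq, hA]
  rw [he.curvatureTrace_eq, he'.curvatureTrace_eq, hP]
  simp only [hB, Module.Basis.map_apply, Finset.sum_add_distrib, ← map_sum]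
  change he'.projNormalL c z _ = he'.projNormalL c z _
  rw [map_add]
  change _ + projNormal ε c A z (A _) = _
  -- The change of chart adds only a vector in the range of A, which the normal projection kills.
  rw [he'.projNormal_map hz, add_zero]

end Projection

/-! ### Differentiable dependence of metric traces on the point -/

section Differentiability

variable {X : Type*} [NormedAddCommGroup X] [NormedSpace ℝ X] {x₀ : X}

lemma differentiableAt_det {n : Type*} [Fintype n] [DecidableEq n] {G : X → Matrix n n ℝ}
    (hG : ∀ i j, DifferentiableAt ℝ (fun x => G x i j) x₀) :
    DifferentiableAt ℝ (fun x => (G x).det) x₀ := by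
  simp only [Matrix.det_apply]
  refine DifferentiableAt.fun_sum fun σ _ => DifferentiableAt.const_smul ?_ _
  exact (HasFDerivAt.finsetProd fun i _ => (hG (σ i) i).hasFDerivAt).differentiableAt

/-- Cramer's rule: the entries of the adjugate are determinants of matrices whose rows are rows of G
or constant. -/
lemma differentiableAt_inv_apply {n : Type*} [Fintype n] [DecidableEq n] {G : X → Matrix n n ℝ}
    (hG : ∀ i j, DifferentiableAt ℝ (fun x => G x i j) x₀) (h0 : IsUnit (G x₀).det) (i j : n) :
    DifferentiableAt ℝ (fun x => (G x)⁻¹ i j) x₀ := by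
  simp only [Matrix.inv_def, Ring.inverse_eq_inv', Matrix.smul_apply, smul_eq_mul,
    Matrix.adjugate_apply]
  refine ((differentiableAt_det hG).inv h0.ne_zero).mul (differentiableAt_det fun k l => ?_)
  rcases eq_or_ne k j with rfl | hk
  · simp
  · simpa [Matrix.updateRow_ne hk] using hG k l

variable {E : Type*} [NormedAddCommGroup E] [NormedSpace ℝ E] [FiniteDimensional ℝ E]
  {ι : Type*} [Fintype ι]

lemma differentiableAt_gTrace {W : Type*} [NormedAddCommGroup W] [NormedSpace ℝ W]
    {g : X → E → E → ℝ} {b : X → E → E → W}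
    (hg : ∀ u v, DifferentiableAt ℝ (fun x => g x u v) x₀)
    (hb : ∀ u v, DifferentiableAt ℝ (fun x => b x u v) x₀)
    (h0 : IsUnit (Matrix.of fun k l =>
      g x₀ (Module.finBasis ℝ E k) (Module.finBasis ℝ E l)).det) :
    DifferentiableAt ℝ (fun x => gTrace (g x) (b x)) x₀ := by
  simp only [gTrace]
  exact DifferentiableAt.fun_sum fun i _ => DifferentiableAt.fun_sum fun j _ =>
    (differentiableAt_inv_apply (G := fun x => Matrix.of fun k l =>
      g x (Module.finBasis ℝ E k) (Module.finBasis ℝ E l)) (fun k l => hg _ _) h0 i j).smul (hb _ _)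

lemma _root_.DifferentiableAt.metric {ε : ι → ℝ} {z w : X → ι → ℂ} (hz : DifferentiableAt ℝ z x₀)
    (hw : DifferentiableAt ℝ w x₀) : DifferentiableAt ℝ (fun x => metric ε (z x) (w x)) x₀ := by
  change DifferentiableAt ℝ (fun x => metricL ε (z x) (w x)) x₀
  fun_prop

/-- The inverse Gram matrix of a fixed basis is used here, since orthonormal bases vary with the
point. Positivity at x₀ alone suffices: it makes the Gram determinant nonzero there. -/
lemma differentiableAt_curvatureTrace {ε : ι → ℝ} (c : ℝ) {A : X → E →L[ℝ] ι → ℂ}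
    {B : X → E →L[ℝ] E →L[ℝ] ι → ℂ} {z : X → ι → ℂ} (hA : DifferentiableAt ℝ A x₀)
    (hB : DifferentiableAt ℝ B x₀) (hz : DifferentiableAt ℝ z x₀)
    (hpos : ∀ u, u ≠ 0 → 0 < metric ε (A x₀ u) (A x₀ u)) :
    DifferentiableAt ℝ (fun x => curvatureTrace ε c (A x) (B x) (z x)) x₀ := by
  obtain ⟨e, he⟩ := exists_isOrtho hpos
  have hAu : ∀ u, DifferentiableAt ℝ (fun x => A x u) x₀ := fun u => by fun_prop
  have hBu : ∀ u v, DifferentiableAt ℝ (fun x => B x u v) x₀ := fun u v => by fun_prop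
  refine differentiableAt_gTrace (fun u v => (hAu u).metric (hAu v)) (fun u v => ?_)
    (he.isUnit_det _)
  refine ((hBu u v).sub ?_).sub ((((hBu u v).metric hz).mul_const c⁻¹).fun_smul hz)
  exact differentiableAt_gTrace (fun u v => (hAu u).metric (hAu v))
    (fun u' v' => ((hBu u v).metric (hAu u')).smul (hAu v')) (he.isUnit_det _)

end Differentiability

/-! ### Logarithmic derivative split into modulus and phase -/

section LogDeriv

lemma hasDerivAt_norm {f : ℝ → ℂ} {f' : ℂ} {s : ℝ} (hf : HasDerivAt f f' s) (h0 : f s ≠ 0) :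
    HasDerivAt (fun s => ‖f s‖) (‖f s‖ * (f' / f s).re) s := by
  have h1 : HasDerivAt (fun s => Real.sqrt (‖f s‖ ^ 2)) _ s :=
    hf.norm_sq.sqrt (by positivity)
  simp only [Real.sqrt_sq (norm_nonneg _)] at h1
  refine h1.congr_deriv ?_
  have hn : ‖f s‖ ≠ 0 := norm_ne_zero_iff.2 h0
  have h2 : (f' / f s).re = (conj (f s) * f').re / ‖f s‖ ^ 2 := by
    have : f' / f s = (conj (f s) * f') / ((‖f s‖ ^ 2 : ℝ) : ℂ) := by
      rw [Complex.ofReal_pow, ← Complex.conj_mul']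
      field_simp [(map_ne_zero (starRingEnd ℂ)).2 h0]
    rw [this, Complex.div_ofReal_re]
  rw [h2, Complex.inner, mul_comm f']
  field_simp

/-- The imaginary part of f'/f is the angular speed; the real part, the growth rate of the modulus,
cancels in the quotient. -/
lemma hasDerivAt_phase {f : ℝ → ℂ} {f' : ℂ} {s : ℝ} (hf : HasDerivAt f f' s) (h0 : f s ≠ 0) :
    HasDerivAt (fun s => f s / ‖f s‖) (Complex.I * (f' / f s).im * (f s / ‖f s‖)) s := by
  have hn : (‖f s‖ : ℂ) ≠ 0 := by simpa using h0
  refine (hf.div (hasDerivAt_norm hf h0).ofReal_comp hn).congr_deriv ?_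
  have h2 : (f' / f s) = (f' / f s).re + (f' / f s).im * Complex.I := (Complex.re_add_im _).symm
  have h3 : f' = f s * ((f' / f s).re + (f' / f s).im * Complex.I) := by
    rw [← h2]; field_simp
  set x := (f' / f s).re
  set y := (f' / f s).im
  rw [h3]
  push_cast
  field_simp
  ring

end LogDeriv

/-! ### Slope, weight and phase of a Legendre curve -/

section Curve

/-- The factor `h` in `α' = h (ᾱ₂, ᾱ₁)` for a Legendre curve. -/
noncomputable def slope (α : ℝ → Fin 2 → ℂ) (s : ℝ) : ℂ :=
  deriv (fun t => α t 0) s / conj (α s 1)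

/-- The weight `α₁^{n₁} α₂^{n₂}`. -/
def weight (n₁ n₂ : ℕ) (α : ℝ → Fin 2 → ℂ) (s : ℝ) : ℂ := α s 0 ^ n₁ * α s 1 ^ n₂

/-- The derivative of the phase of `h α₁^{n₁} α₂^{n₂}`. -/
noncomputable def phaseRate (n₁ n₂ : ℕ) (α : ℝ → Fin 2 → ℂ) (s : ℝ) : ℝ :=
  (deriv (slope α) s / slope α s + deriv (weight n₁ n₂ α) s / weight n₁ n₂ α s).im

variable {S : TopologicalSpace.Opens ℝ} {α : ℝ → Fin 2 → ℂ} {s : ℝ} {n₁ n₂ : ℕ}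

namespace IsLegendreCurve

lemma contDiffOn_apply (hα : IsLegendreCurve S α) (j : Fin 2) :
    ContDiffOn ℝ ∞ (fun t => α t j) S := contDiffOn_pi.1 hα.smooth j

lemma differentiableAt_apply (hα : IsLegendreCurve S α) (hs : s ∈ S) (j : Fin 2) :
    DifferentiableAt ℝ (fun t => α t j) s :=
  ((hα.contDiffOn_apply j).contDiffAt (S.isOpen.mem_nhds hs)).differentiableAt (by simp)

lemma deriv_apply (hα : IsLegendreCurve S α) (hs : s ∈ S) (j : Fin 2) :
    deriv α s j = deriv (fun t => α t j) s := by
  rw [deriv_pi fun j => hα.differentiableAt_apply hs j]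

lemma herm_two (z w : Fin 2 → ℂ) :
    herm (adsSign 1) z w = z 0 * conj (w 0) - z 1 * conj (w 1) := by
  rw [herm_adsSign]; simp

lemma mul_conj_sub (hα : IsLegendreCurve S α) (hs : s ∈ S) :
    α s 0 * conj (α s 0) - α s 1 * conj (α s 1) = -1 := by
  have := hα.mem s hs
  rw [quadric, Set.mem_ofPred_eq, herm_two] at this
  simpa using this

lemma snd_ne_zero (hα : IsLegendreCurve S α) (hs : s ∈ S) : α s 1 ≠ 0 := fun h => by
  have := congrArg Complex.re (hα.mul_conj_sub hs)
  rw [h, Complex.mul_conj] at this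
  simp at this
  linarith [Complex.normSq_nonneg (α s 0)]

/-- The real parts agree by differentiating |α₁|² − |α₂|² = −1, the imaginary parts by the Legendre
condition. -/
lemma deriv_mul_conj (hα : IsLegendreCurve S α) (hs : s ∈ S) :
    deriv (fun t => α t 0) s * conj (α s 0) = deriv (fun t => α t 1) s * conj (α s 1) := by
  have h0 := (hα.differentiableAt_apply hs 0).hasDerivAt
  have h1 := (hα.differentiableAt_apply hs 1).hasDerivAt
  have hc : ∀ {f : ℝ → ℂ} {f' : ℂ}, HasDerivAt f f' s →
      HasDerivAt (fun t => conj (f t)) (conj f') s := fun hf => hf.star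
  have h := ((h0.mul (hc h0)).sub (h1.mul (hc h1)))
  have h' : HasDerivAt (fun _ : ℝ => (-1 : ℂ)) _ s := h.congr_of_eventuallyEq <| by
    filter_upwards [S.isOpen.mem_nhds hs] with t ht
    exact (hα.mul_conj_sub ht).symm
  have hre := congrArg Complex.re (h'.unique (hasDerivAt_const s (-1 : ℂ)))
  have him := hα.legendrian s hs
  rw [metric_I_smul_right, herm_two, hα.deriv_apply hs, hα.deriv_apply hs] at him
  apply Complex.ext
  · simp at hre ⊢
    linarith
  · rw [Complex.sub_im] at him
    linarith

lemma deriv_fst (hα : IsLegendreCurve S α) (hs : s ∈ S) :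
    deriv (fun t => α t 0) s = slope α s * conj (α s 1) := by
  rw [slope, div_mul_cancel₀ _ ((map_ne_zero _).2 (hα.snd_ne_zero hs))]

lemma deriv_snd (hα : IsLegendreCurve S α) (hs : s ∈ S) :
    deriv (fun t => α t 1) s = slope α s * conj (α s 0) := by
  have h := hα.deriv_mul_conj hs
  have h1 := (map_ne_zero (starRingEnd ℂ)).2 (hα.snd_ne_zero hs)
  rw [slope, div_mul_eq_mul_div, h, mul_div_cancel_right₀ _ h1]

lemma slope_ne_zero (hα : IsLegendreCurve S α) (hs : s ∈ S) : slope α s ≠ 0 := fun h => by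
  apply hα.regular s hs
  funext j
  rw [hα.deriv_apply hs]
  fin_cases j
  · simpa [h] using hα.deriv_fst hs
  · simpa [h] using hα.deriv_snd hs

lemma hasDerivAt_fst (hα : IsLegendreCurve S α) (hs : s ∈ S) :
    HasDerivAt (fun t => α t 0) (slope α s * conj (α s 1)) s :=
  hα.deriv_fst hs ▸ (hα.differentiableAt_apply hs 0).hasDerivAt

lemma hasDerivAt_snd (hα : IsLegendreCurve S α) (hs : s ∈ S) :
    HasDerivAt (fun t => α t 1) (slope α s * conj (α s 0)) s :=
  hα.deriv_snd hs ▸ (hα.differentiableAt_apply hs 1).hasDerivAt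

lemma contDiffOn_slope (hα : IsLegendreCurve S α) : ContDiffOn ℝ ∞ (slope α) S := by
  have h1 : ContDiffOn ℝ ∞ (deriv fun t => α t 0) S :=
    (hα.contDiffOn_apply 0).deriv_of_isOpen S.isOpen (by simp)
  have h2 : ContDiffOn ℝ ∞ (fun t => conj (α t 1)) S :=
    Complex.conjCLE.contDiff.comp_contDiffOn (hα.contDiffOn_apply 1)
  exact (h1.mul (h2.inv fun s hs => (map_ne_zero (starRingEnd ℂ)).2 (hα.snd_ne_zero hs))).congr
    fun s _ => div_eq_mul_inv _ _

lemma contDiffOn_weight (hα : IsLegendreCurve S α) (n₁ n₂ : ℕ) :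
    ContDiffOn ℝ ∞ (weight n₁ n₂ α) S :=
  ((hα.contDiffOn_apply 0).pow n₁).mul ((hα.contDiffOn_apply 1).pow n₂)

lemma hasDerivAt_slope (hα : IsLegendreCurve S α) (hs : s ∈ S) :
    HasDerivAt (slope α) (deriv (slope α) s) s :=
  ((hα.contDiffOn_slope.contDiffAt (S.isOpen.mem_nhds hs)).differentiableAt (by simp)).hasDerivAt

lemma hasDerivAt_weight (hα : IsLegendreCurve S α) (hs : s ∈ S) :
    HasDerivAt (weight n₁ n₂ α) (deriv (weight n₁ n₂ α) s) s :=
  (((hα.contDiffOn_weight n₁ n₂).contDiffAt (S.isOpen.mem_nhds hs)).differentiableAt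
    (by simp)).hasDerivAt

lemma weight_ne_zero (hα : IsLegendreCurve S α) (hreg : n₁ ≠ 0 → ∀ s ∈ S, α s 0 ≠ 0)
    (hs : s ∈ S) : weight n₁ n₂ α s ≠ 0 := by
  refine mul_ne_zero ?_ (pow_ne_zero _ (hα.snd_ne_zero hs))
  rcases eq_or_ne n₁ 0 with rfl | h
  · simp
  · exact pow_ne_zero _ (hreg h s hs)

/-- This is what `phaseRate` is for: the unit complex number attached to h w rotates with that
angular speed. -/
lemma hasDerivAt_speedPhase (hα : IsLegendreCurve S α) (hreg : n₁ ≠ 0 → ∀ s ∈ S, α s 0 ≠ 0)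
    (hs : s ∈ S) :
    HasDerivAt (fun s => slope α s * weight n₁ n₂ α s / ‖slope α s * weight n₁ n₂ α s‖)
      (Complex.I * phaseRate n₁ n₂ α s *
        (slope α s * weight n₁ n₂ α s / ‖slope α s * weight n₁ n₂ α s‖)) s := by
  have h1 := hα.slope_ne_zero hs
  have h2 := hα.weight_ne_zero (n₂ := n₂) hreg hs
  have := hasDerivAt_phase ((hα.hasDerivAt_slope hs).mul (hα.hasDerivAt_weight (n₁ := n₁) (n₂ := n₂) hs))
    (mul_ne_zero h1 h2)
  refine this.congr_deriv ?_
  congr 4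
  simp only [Pi.mul_apply]
  field_simp

lemma weight_deriv_div (hα : IsLegendreCurve S α) (hreg : n₁ ≠ 0 → ∀ s ∈ S, α s 0 ≠ 0)
    (hs : s ∈ S) : deriv (weight n₁ n₂ α) s / weight n₁ n₂ α s =
      n₁ * (slope α s * conj (α s 1) / α s 0) + n₂ * (slope α s * conj (α s 0) / α s 1) := by
  have h2 := hα.snd_ne_zero hs
  have h := ((hα.hasDerivAt_fst hs).pow n₁).mul ((hα.hasDerivAt_snd hs).pow n₂)
  have h' : deriv (weight n₁ n₂ α) s = _ := h.deriv
  rw [h', weight]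
  simp only [Pi.pow_apply]
  -- For n = 0 both sides are 0 even at z = 0, so zeros of α₁ are harmless when n₁ = 0.
  have key : ∀ (n : ℕ) (z : ℂ), (n = 0 ∨ z ≠ 0) → (n : ℂ) * z ^ (n - 1) = n / z * z ^ n := by
    rintro n z (rfl | hz)
    · simp
    · rcases n with _ | n
      · simp
      · simp [pow_succ]; field_simp
  rcases eq_or_ne n₁ 0 with rfl | h1
  · rw [key n₂ _ (Or.inr h2)]
    simp
    field_simp
  · have h1 := hreg h1 s hs
    rw [key n₂ _ (Or.inr h2), key n₁ _ (Or.inr h1)]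
    field_simp

end IsLegendreCurve

end Curve

/-! ### Reparametrizations and the equation as constancy of the normalized phase rate -/

section Reparametrization

/-- A positive smooth density on an interval is the derivative of the inverse of a
reparametrization. -/
lemma exists_isReparametrization (S : TopologicalSpace.Opens ℝ) (hS : (S : Set ℝ).OrdConnected)
    (hS' : (S : Set ℝ).Nonempty) {f : ℝ → ℝ} (hf : ContDiffOn ℝ ∞ f S) (hpos : ∀ s ∈ S, 0 < f s) :
    ∃ (T : Set ℝ) (σ τ : ℝ → ℝ), IsReparametrization T S τ ∧ (∀ s ∈ S, HasDerivAt σ (f s) s) ∧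
      (∀ t ∈ T, σ (τ t) = t) ∧ ∀ t ∈ T, HasDerivAt τ (f (τ t))⁻¹ t := by
  obtain ⟨s₀, hs₀⟩ := hS'
  -- σ is the new parameter as a function of the old one; τ will be its inverse on the image T.
  set σ : ℝ → ℝ := fun s => ∫ x in s₀..s, f x with hσ
  have hder : ∀ s ∈ S, HasDerivAt σ (f s) s := fun s hs => by
    apply intervalIntegral.integral_hasDerivAt_right
    · apply ContinuousOn.intervalIntegrable
      exact hf.continuousOn.mono (hS.uIcc_subset hs₀ hs)
    · exact hf.continuousOn.stronglyMeasurableAtFilter S.isOpen s hs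
    · exact hf.continuousOn.continuousAt (S.isOpen.mem_nhds hs)
  have hcd : ContDiffOn ℝ ∞ σ S := by
    rw [contDiffOn_infty_iff_deriv_of_isOpen S.isOpen]
    exact ⟨fun s hs => (hder s hs).differentiableAt.differentiableWithinAt,
      hf.congr fun s hs => (hder s hs).deriv⟩
  have hconv : Convex ℝ (S : Set ℝ) := hS.convex
  have hmono : StrictMonoOn σ S := by
    apply strictMonoOn_of_deriv_pos hconv hcd.continuousOn
    rw [S.isOpen.interior_eq]
    intro s hs
    rw [(hder s hs).deriv]
    exact hpos s hs
  set τ := Function.invFunOn σ S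
  set T := σ '' S
  have hinj := hmono.injOn
  have hleft : ∀ s ∈ S, τ (σ s) = s := fun s hs => hinj.leftInvOn_invFunOn hs
  have hright : ∀ t ∈ T, σ (τ t) = t := fun t ht => Function.invFunOn_eq ht
  have hmem : ∀ t ∈ T, τ t ∈ S := fun t ht => Function.invFunOn_mem ht
  -- The inverse function theorem shows that T is open, and injectivity of σ identifies τ near σ s
  -- with the smooth local inverse.
  have hloc : ∀ s ∈ S, (∀ᶠ t in nhds (σ s), t ∈ T) ∧ ContDiffAt ℝ ∞ τ (σ s) := fun s hs => by
    have hc : ContDiffAt ℝ ∞ σ s := hcd.contDiffAt (S.isOpen.mem_nhds hs)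
    have hd : HasFDerivAt σ
        ((ContinuousLinearEquiv.unitsEquivAut ℝ (Units.mk0 (f s) (hpos s hs).ne') : ℝ ≃L[ℝ] ℝ) :
          ℝ →L[ℝ] ℝ) s := by
      refine (hder s hs).hasFDerivAt.congr_fderiv ?_
      ext; simp
    have hn : (∞ : WithTop ℕ∞) ≠ 0 := by simp
    have hg : ContDiffAt ℝ ∞ (hc.localInverse hd hn) (σ s) := hc.to_localInverse hd hn
    have h1 : hc.localInverse hd hn (σ s) = s := hc.localInverse_apply_image hd hn
    have h2 : ∀ᶠ t in nhds (σ s), hc.localInverse hd hn t ∈ S :=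
      hg.continuousAt (by rw [h1]; exact S.isOpen.mem_nhds hs)
    have h3 : ∀ᶠ t in nhds (σ s), σ (hc.localInverse hd hn t) = t :=
      (hc.hasStrictFDerivAt' hd hn).eventually_right_inverse
    refine ⟨?_, hg.congr_of_eventuallyEq ?_⟩
    · filter_upwards [h2, h3] with t ht ht'
      exact ⟨_, ht, ht'⟩
    · filter_upwards [h2, h3] with t ht ht'
      conv_lhs => rw [← ht']
      exact hleft _ ht
  have hτd : ∀ t ∈ T, HasDerivAt τ (f (τ t))⁻¹ t := fun t ht => by
    have h1 := (hloc (τ t) (hmem t ht))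
    rw [hright t ht] at h1
    exact HasDerivAt.of_local_left_inverse h1.2.continuousAt (hder _ (hmem t ht))
      (hpos _ (hmem t ht)).ne' (h1.1.mono hright)
  refine ⟨T, σ, τ, ⟨?_, ?_, ?_, ⟨hmem, ?_, ?_⟩, ?_⟩, hder, hright, hτd⟩
  · rw [isOpen_iff_mem_nhds]
    rintro _ ⟨s, hs, rfl⟩
    exact (hloc s hs).1
  · exact (hconv.isPreconnected.image _ hcd.continuousOn).ordConnected
  · rintro _ ⟨s, hs, rfl⟩
    exact (hloc s hs).2.contDiffWithinAt
  · exact fun t ht t' ht' h => by rw [← hright t ht, ← hright t' ht', h]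
  · exact fun s hs => ⟨σ s, ⟨s, hs, rfl⟩, hleft s hs⟩
  · intro t ht
    rw [(hτd t ht).deriv]
    exact inv_pos.2 (hpos _ (hmem t ht))

variable {S : TopologicalSpace.Opens ℝ} {α : ℝ → Fin 2 → ℂ} {n₁ n₂ : ℕ} {T : Set ℝ} {τ : ℝ → ℝ}

/-- The equation in terms of the slope and the weight of the curve. -/
lemma solvesODE_iff (hα : IsLegendreCurve S α) (hτ : IsReparametrization T S τ) (θ μ : ℝ) :
    SolvesODE n₁ n₂ μ T (fun t => Complex.exp (θ * Complex.I) • α (τ t)) ↔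
      ∀ t ∈ T, deriv τ t * slope α (τ t) = Complex.I * Complex.exp (Complex.I * μ * t) *
        conj (Complex.exp (θ * Complex.I)) ^ (n₁ + n₂ + 2) * conj (weight n₁ n₂ α (τ t)) := by
  set E := Complex.exp (θ * Complex.I)
  have hE : E * conj E = 1 := by
    rw [Complex.mul_conj, Complex.normSq_eq_norm_sq, Complex.norm_exp_ofReal_mul_I]
    simp
  have hτd : ∀ t ∈ T, HasDerivAt τ (deriv τ t) t := fun t ht =>
    ((hτ.smooth.contDiffAt (hτ.isOpen.mem_nhds ht)).differentiableAt (by simp)).hasDerivAt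
  have hβ : ∀ t ∈ T, ∀ j, HasDerivAt (fun t => α (τ t) j)
      (deriv τ t • deriv (fun s => α s j) (τ t)) t := fun t ht j =>
    (hα.differentiableAt_apply (hτ.bijOn.mapsTo ht) j).hasDerivAt.scomp t (hτd t ht)
  -- The rotation E cancels on this side because |E| = 1; on the other side it leaves one factor Ē
  -- for each of the n₁ + n₂ + 2 conjugates.
  have hd : ∀ t ∈ T, ∀ j, deriv (fun t => E • α (τ t)) t j * conj ((E • α (τ t)) j) =
      deriv τ t * slope α (τ t) * (conj (α (τ t) 0) * conj (α (τ t) 1)) := fun t ht j => by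
    have h1 : HasDerivAt (fun t => E • α (τ t))
        (fun j => E * (deriv τ t • deriv (fun s => α s j) (τ t))) t :=
      hasDerivAt_pi.2 fun j => (hβ t ht j).const_mul E
    rw [h1.deriv]
    have hm := hτ.bijOn.mapsTo ht
    simp only [Pi.smul_apply, smul_eq_mul, Complex.real_smul, map_mul]
    have h2 : ∀ a b c : ℂ, E * (a * b) * (conj E * c) = a * (b * c) := fun a b c => by
      linear_combination (a * b * c) * hE
    rw [h2]
    fin_cases j
    · simp only [Fin.zero_eta]
      rw [hα.deriv_fst hm]; ring
    · simp only [Fin.mk_one]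
      rw [hα.deriv_snd hm]; ring
  have hr : ∀ t : ℝ, Complex.I * Complex.exp (Complex.I * μ * t) *
      conj ((E • α (τ t)) 0) ^ (n₁ + 1) * conj ((E • α (τ t)) 1) ^ (n₂ + 1) =
      Complex.I * Complex.exp (Complex.I * μ * t) * conj E ^ (n₁ + n₂ + 2) *
        conj (weight n₁ n₂ α (τ t)) * (conj (α (τ t) 0) * conj (α (τ t) 1)) := fun t => by
    simp only [Pi.smul_apply, smul_eq_mul, map_mul, weight, map_pow]
    ring
  constructor
  · intro H t ht
    have H' : ∀ t ∈ T, α (τ t) 0 ≠ 0 → deriv τ t * slope α (τ t) =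
        Complex.I * Complex.exp (Complex.I * μ * t) * conj E ^ (n₁ + n₂ + 2) *
          conj (weight n₁ n₂ α (τ t)) := fun t ht h0 => by
      have h := H t ht 0
      simp only [] at h
      rw [hd t ht, hr] at h
      exact mul_right_cancel₀ (mul_ne_zero ((map_ne_zero _).2 h0)
        ((map_ne_zero _).2 (hα.snd_ne_zero (hτ.bijOn.mapsTo ht)))) h
    -- The factor ᾱ₁ ᾱ₂ cannot be cancelled at a zero of α₁. Such a zero is isolated because α₁' = h
    -- ᾱ₂ ≠ 0, so the identity passes to it as a limit of neighbouring ones.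
    by_cases h0 : α (τ t) 0 = 0
    · have hm := hτ.bijOn.mapsTo ht
      have hne : deriv τ t • deriv (fun s => α s 0) (τ t) ≠ 0 := by
        rw [hα.deriv_fst hm]
        exact smul_ne_zero (hτ.deriv_pos t ht).ne' (mul_ne_zero (hα.slope_ne_zero hm)
          ((map_ne_zero _).2 (hα.snd_ne_zero hm)))
      have hev : ∀ᶠ t' in nhdsWithin t {t}ᶜ, α (τ t') 0 ≠ 0 := (hβ t ht 0).eventually_ne hne
      have hev' : ∀ᶠ t' in nhdsWithin t {t}ᶜ, t' ∈ T :=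
        nhdsWithin_le_nhds (hτ.isOpen.mem_nhds ht)
      have hτc : ContinuousAt τ t := (hτd t ht).continuousAt
      have hc1 : ContinuousAt (fun t => ((deriv τ t : ℝ) : ℂ) * slope α (τ t)) t := by
        have : ContinuousAt (deriv τ) t :=
          ((hτ.smooth.deriv_of_isOpen (m := ∞) hτ.isOpen (by simp)).continuousOn).continuousAt
            (hτ.isOpen.mem_nhds ht)
        exact (Complex.continuous_ofReal.continuousAt.comp this).mul
          (ContinuousAt.comp (f := τ) (hα.hasDerivAt_slope hm).continuousAt hτc)
      have hc2 : ContinuousAt (fun t : ℝ => Complex.I * Complex.exp (Complex.I * μ * t) *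
          conj E ^ (n₁ + n₂ + 2) * conj (weight n₁ n₂ α (τ t))) t := by
        have hw : ContinuousAt (fun t => weight n₁ n₂ α (τ t)) t :=
          ContinuousAt.comp (f := τ) (hα.hasDerivAt_weight hm).continuousAt hτc
        refine ContinuousAt.mul (by fun_prop) (Complex.continuous_conj.continuousAt.comp hw)
      refine tendsto_nhds_unique (l := nhdsWithin t {t}ᶜ) (hc1.tendsto.mono_left nhdsWithin_le_nhds)
        ((hc2.tendsto.mono_left nhdsWithin_le_nhds).congr' ?_)
      filter_upwards [hev, hev'] with t' h1 h2
      exact (H' t' h2 h1).symm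
    · exact H' t ht h0
  · intro H t ht j
    simp only []
    rw [hd t ht, hr, H t ht]

/-- Up to reparametrization and congruence, the equation with parameter `μ` says that the
normalized phase rate is `μ`. -/
lemma solvesODEUpToCongruence_iff (hS : (S : Set ℝ).OrdConnected)
    (hS' : (S : Set ℝ).Nonempty) (hα : IsLegendreCurve S α)
    (hreg : n₁ ≠ 0 → ∀ s ∈ S, α s 0 ≠ 0) (μ : ℝ) :
    SolvesODEUpToCongruence n₁ n₂ μ S α ↔
      ∀ s ∈ S, phaseRate n₁ n₂ α s * (‖weight n₁ n₂ α s‖ / ‖slope α s‖) = μ := by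
  have hh := fun s (hs : s ∈ S) => hα.slope_ne_zero hs
  have hw := fun s (hs : s ∈ S) => hα.weight_ne_zero (n₂ := n₂) hreg hs
  have hU := fun s (hs : s ∈ S) => hα.hasDerivAt_speedPhase (n₂ := n₂) hreg hs
  have hexp : ∀ t : ℝ, HasDerivAt (fun t : ℝ => Complex.exp (Complex.I * μ * t))
      (Complex.I * μ * Complex.exp (Complex.I * μ * t)) t := fun t => by
    have h1 : HasDerivAt (fun t : ℝ => Complex.I * μ * (t : ℂ)) (Complex.I * μ * 1) t :=
      (Complex.ofRealCLM.hasDerivAt (x := t)).const_mul _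
    refine h1.cexp.congr_deriv ?_
    ring
  have hnexp : ∀ t : ℝ, ‖Complex.exp (Complex.I * μ * t)‖ = 1 := fun t => by
    rw [show Complex.I * μ * t = ((μ * t : ℝ) : ℂ) * Complex.I by push_cast; ring]
    exact Complex.norm_exp_ofReal_mul_I _
  constructor
  · rintro ⟨T, τ, θ, hτ, H⟩ s hs
    rw [solvesODE_iff hα hτ] at H
    set E := Complex.exp (θ * Complex.I)
    have hE : ‖conj E ^ (n₁ + n₂ + 2)‖ = 1 := by
      rw [norm_pow, RCLike.norm_conj, Complex.norm_exp_ofReal_mul_I, one_pow]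
    obtain ⟨t, ht, rfl⟩ := hτ.bijOn.surjOn hs
    have hτd : HasDerivAt τ (deriv τ t) t :=
      ((hτ.smooth.contDiffAt (hτ.isOpen.mem_nhds ht)).differentiableAt (by simp)).hasDerivAt
    -- Moduli in the equation fix the speed of the reparametrization.
    have hnorm : deriv τ t * ‖slope α (τ t)‖ = ‖weight n₁ n₂ α (τ t)‖ := by
      have := congrArg norm (H t ht)
      simpa [hE, hnexp, abs_of_pos (hτ.deriv_pos t ht)] using this
    -- Multiplying by w replaces w̄ by the positive number |w|², so only the phase survives.
    have hphase : ∀ t ∈ T, slope α (τ t) * weight n₁ n₂ α (τ t) /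
        ‖slope α (τ t) * weight n₁ n₂ α (τ t)‖ =
        Complex.I * conj E ^ (n₁ + n₂ + 2) * Complex.exp (Complex.I * μ * t) := fun t ht => by
      have hm := hτ.bijOn.mapsTo ht
      have h1 : ((deriv τ t : ℝ) : ℂ) * (slope α (τ t) * weight n₁ n₂ α (τ t)) =
          Complex.I * conj E ^ (n₁ + n₂ + 2) * Complex.exp (Complex.I * μ * t) *
            (‖weight n₁ n₂ α (τ t)‖ ^ 2 : ℝ) := by
        rw [← mul_assoc, H t ht, Complex.ofReal_pow, ← Complex.conj_mul']
        ring
      have h2 : deriv τ t * ‖slope α (τ t) * weight n₁ n₂ α (τ t)‖ =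
          ‖weight n₁ n₂ α (τ t)‖ ^ 2 := by
        have := congrArg norm h1
        simpa [hE, hnexp, abs_of_pos (hτ.deriv_pos t ht)] using this
      rw [← h2] at h1
      have h3 : ((deriv τ t : ℝ) : ℂ) ≠ 0 := by exact_mod_cast (hτ.deriv_pos t ht).ne'
      have h4 : ((‖slope α (τ t) * weight n₁ n₂ α (τ t)‖ : ℝ) : ℂ) ≠ 0 := by
        simpa using ⟨hh _ hm, hw _ hm⟩
      rw [div_eq_iff h4]
      apply mul_left_cancel₀ h3
      rw [h1]
      push_cast
      ring
    -- The derivative of the phase along τ, computed in two ways, yields τ' κ = μ.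
    have hd1 := (hU _ hs).scomp t hτd
    have hd2 : HasDerivAt (fun t : ℝ => Complex.I * conj E ^ (n₁ + n₂ + 2) *
        Complex.exp (Complex.I * μ * t)) _ t := (hexp t).const_mul _
    have hd3 := hd2.congr_of_eventuallyEq (f₁ := (fun s => slope α s * weight n₁ n₂ α s /
      ‖slope α s * weight n₁ n₂ α s‖) ∘ τ)
      (by filter_upwards [hτ.isOpen.mem_nhds ht] with t ht using hphase t ht)
    have h := hd1.unique hd3
    rw [hphase t ht] at h
    have hne : Complex.I * (Complex.I * conj E ^ (n₁ + n₂ + 2) *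
        Complex.exp (Complex.I * μ * t)) ≠ 0 := by
      refine mul_ne_zero Complex.I_ne_zero (norm_ne_zero_iff.1 ?_)
      rw [norm_mul, norm_mul, hE, hnexp]; simp
    have h' : ((deriv τ t * phaseRate n₁ n₂ α (τ t) : ℝ) : ℂ) = (μ : ℝ) := by
      apply mul_right_cancel₀ hne
      rw [Complex.real_smul] at h
      push_cast
      linear_combination h
    have h'' := Complex.ofReal_injective h'
    have : ‖slope α (τ t)‖ ≠ 0 := norm_ne_zero_iff.2 (hh _ hs)
    rw [← hnorm, mul_div_cancel_right₀ _ this, mul_comm, h'']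
  · intro H
    -- The modulus of the equation forces τ' = |w|/|h|, so the inverse parameter σ must have
    -- derivative |h|/|w|.
    have hf : ContDiffOn ℝ ∞ (fun s => ‖slope α s‖ / ‖weight n₁ n₂ α s‖) S :=
      (hα.contDiffOn_slope.norm ℝ hh).div ((hα.contDiffOn_weight n₁ n₂).norm ℝ hw)
        fun s hs => norm_ne_zero_iff.2 (hw s hs)
    obtain ⟨T, σ, τ, hτ, hσd, hστ, hτd⟩ := exists_isReparametrization S hS hS' hf
      fun s hs => div_pos (norm_pos_iff.2 (hh s hs)) (norm_pos_iff.2 (hw s hs))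
    set U : ℝ → ℂ := fun s => slope α s * weight n₁ n₂ α s / ‖slope α s * weight n₁ n₂ α s‖
    obtain ⟨s₀, hs₀⟩ := hS'
    have hUnorm : ∀ s ∈ S, ‖U s‖ = 1 := fun s hs => by
      have : ‖slope α s * weight n₁ n₂ α s‖ ≠ 0 :=
        norm_ne_zero_iff.2 (mul_ne_zero (hh s hs) (hw s hs))
      simp only [U, norm_div, Complex.norm_real, norm_norm, div_self this]
    -- The phase with the expected rotation e^{iμσ} removed; the hypothesis says precisely that V' =
    -- 0.
    set V : ℝ → ℂ := fun s => U s * Complex.exp (Complex.I * μ * (-σ s : ℝ))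
    have hV : ∀ s ∈ S, HasDerivAt V 0 s := fun s hs => by
      have h1 : HasDerivAt (fun s => Complex.exp (Complex.I * μ * (-σ s : ℝ))) _ s :=
        HasDerivAt.scomp (g₁ := fun t : ℝ => Complex.exp (Complex.I * μ * t)) s (hexp (-σ s))
          (hσd s hs).neg
      refine ((hU s hs).mul h1).congr_deriv ?_
      have h2 : phaseRate n₁ n₂ α s = μ * (‖slope α s‖ / ‖weight n₁ n₂ α s‖) := by
        rw [← H s hs]
        have := norm_ne_zero_iff.2 (hh s hs)
        have := norm_ne_zero_iff.2 (hw s hs)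
        field_simp
      rw [h2, Complex.real_smul]
      push_cast
      ring
    have hVc : ∀ s ∈ S, V s = V s₀ := fun s hs =>
      S.isOpen.is_const_of_deriv_eq_zero hS.convex.isPreconnected
        (fun x hx => (hV x hx).differentiableAt.differentiableWithinAt)
        (fun x hx => (hV x hx).deriv) hs hs₀
    have hUV : ∀ s ∈ S, U s = V s₀ * Complex.exp (Complex.I * μ * σ s) := fun s hs => by
      rw [← hVc s hs]
      simp only [V]
      rw [mul_assoc, ← Complex.exp_add]
      push_cast
      rw [mul_neg, neg_add_cancel, Complex.exp_zero, mul_one]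
    have hV1 : ‖V s₀‖ = 1 := by
      simp only [V]
      rw [norm_mul, hUnorm s₀ hs₀, hnexp, one_mul]
    obtain ⟨θ, hθ⟩ : ∃ θ : ℝ, Complex.I * conj (Complex.exp (θ * Complex.I)) ^ (n₁ + n₂ + 2) =
        V s₀ := by
      -- With N = n₁ + n₂ + 2 the left side is e^{i(π/2 − Nθ)}, and its argument is matched with
      -- that of V s₀.
      refine ⟨(Real.pi / 2 - Complex.arg (V s₀)) / (n₁ + n₂ + 2), ?_⟩
      have h1 : V s₀ = Complex.exp (Complex.arg (V s₀) * Complex.I) := by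
        conv_lhs => rw [← Complex.norm_mul_exp_arg_mul_I (V s₀), hV1]
        simp
      conv_rhs => rw [h1]
      rw [← Complex.exp_conj, ← Complex.exp_nat_mul]
      refine (congrArg (· * _) Complex.exp_pi_div_two_mul_I.symm).trans ?_
      rw [← Complex.exp_add]
      congr 1
      have : (n₁ + n₂ + 2 : ℂ) ≠ 0 := by norm_cast
      simp only [map_mul, Complex.conj_ofReal, Complex.conj_I]
      push_cast
      field_simp
      ring
    refine ⟨T, τ, θ, hτ, (solvesODE_iff hα hτ θ μ).2 fun t ht => ?_⟩
    have hm := hτ.bijOn.mapsTo ht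
    have hUt := hUV _ hm
    rw [hστ t ht, ← hθ] at hUt
    rw [(hτd t ht).deriv]
    have hw0 := hw _ hm
    have hwn : ((‖weight n₁ n₂ α (τ t)‖ : ℝ) : ℂ) ≠ 0 := by simpa using hw0
    have hhn : ((‖slope α (τ t)‖ : ℝ) : ℂ) ≠ 0 := by simpa using hh _ hm
    have h5 : Complex.I * Complex.exp (Complex.I * μ * t) *
        conj (Complex.exp (θ * Complex.I)) ^ (n₁ + n₂ + 2) = U (τ t) := by rw [hUt]; ring
    rw [h5]
    simp only [U, norm_mul]
    apply mul_right_cancel₀ hw0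
    rw [mul_assoc _ (conj _), Complex.conj_mul']
    push_cast
    field_simp

end Reparametrization

/-! ### The chain rule of second order -/

section SecondDerivative

variable {E F G : Type*} [NormedAddCommGroup E] [NormedSpace ℝ E] [NormedAddCommGroup F]
  [NormedSpace ℝ F] [NormedAddCommGroup G] [NormedSpace ℝ G]

lemma contDiffAt_fderiv {f : E → F} {x : E} (hf : ContDiffAt ℝ ∞ f x) :
    ContDiffAt ℝ ∞ (fderiv ℝ f) x := hf.fderiv_right (by simp)

lemma eventually_contDiffAt {f : E → F} {x : E} (hf : ContDiffAt ℝ ∞ f x) :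
    ∀ᶠ y in 𝓝 x, ContDiffAt ℝ 1 f y :=
  (hf.of_le (by simp)).eventually (by simp)

lemma hasFDerivAt_fderiv_apply {f : E → F} {x : E} (hf : ContDiffAt ℝ ∞ f x) (u : E) :
    HasFDerivAt (fun y => fderiv ℝ f y u)
      ((ContinuousLinearMap.apply ℝ F u).comp (fderiv ℝ (fderiv ℝ f) x)) x :=
  (ContinuousLinearMap.apply ℝ F u).hasFDerivAt.comp x
    ((contDiffAt_fderiv hf).differentiableAt (by simp)).hasFDerivAt

/-- The last term lies in the range of the differential of f. It is the reason why only the normal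
part of the second differential is independent of the chart. -/
lemma fderiv_fderiv_comp {f : F → G} {c : E → F} {x : E} (hf : ContDiffAt ℝ ∞ f (c x))
    (hc : ContDiffAt ℝ ∞ c x) (u v : E) :
    fderiv ℝ (fderiv ℝ (f ∘ c)) x u v =
      fderiv ℝ (fderiv ℝ f) (c x) (fderiv ℝ c x u) (fderiv ℝ c x v) +
        fderiv ℝ f (c x) (fderiv ℝ (fderiv ℝ c) x u v) := by
  have h1 : fderiv ℝ (f ∘ c) =ᶠ[𝓝 x] fun y => (fderiv ℝ f (c y)).comp (fderiv ℝ c y) := by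
    filter_upwards [eventually_contDiffAt hc,
      hc.continuousAt.eventually (eventually_contDiffAt hf)] with y hy hy'
    exact fderiv_comp y (hy'.differentiableAt (by simp)) (hy.differentiableAt (by simp))
  rw [h1.fderiv_eq]
  have h2 : HasFDerivAt (fun y => fderiv ℝ f (c y))
      ((fderiv ℝ (fderiv ℝ f) (c x)).comp (fderiv ℝ c x)) x :=
    (contDiffAt_fderiv hf).differentiableAt (by simp) |>.hasFDerivAt.comp x
      (hc.differentiableAt (by simp)).hasFDerivAt
  have h3 := ((contDiffAt_fderiv hc).differentiableAt (by simp)).hasFDerivAt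
  rw [(h2.clm_comp h3).fderiv]
  simp [add_comm]

end SecondDerivative

/-! ### Second differential against the position vector -/

section Local

variable {E : Type*} [NormedAddCommGroup E] [NormedSpace ℝ E] {ι : Type*} [Fintype ι]

lemma hasFDerivAt_herm {ε : ι → ℝ} {z w : E → ι → ℂ} {z' w' : E →L[ℝ] ι → ℂ} {x : E}
    (hz : HasFDerivAt z z' x) (hw : HasFDerivAt w w' x) :
    ∃ D : E →L[ℝ] ℂ, HasFDerivAt (fun x => herm ε (z x) (w x)) D x ∧
      ∀ u, D u = herm ε (z x) (w' u) + herm ε (z' u) (w x) :=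
  ⟨_, (hermL ε).hasFDerivAt_of_bilinear hz hw, fun u => by simp⟩

/-- The Hermitian product of the second differential and the position vector. -/
lemma herm_fderiv_fderiv {ε : ι → ℝ} {F : E → ι → ℂ} {x : E} (hF : ContDiffAt ℝ ∞ F x)
    (h : ∀ᶠ y in 𝓝 x, ∀ u, herm ε (fderiv ℝ F y u) (F y) = 0) (u v : E) :
    herm ε (fderiv ℝ (fderiv ℝ F) x u v) (F x) = -metric ε (fderiv ℝ F x u) (fderiv ℝ F x v) := by
  have key : ∀ u v, herm ε (fderiv ℝ F x v) (fderiv ℝ F x u) +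
      herm ε (fderiv ℝ (fderiv ℝ F) x u v) (F x) = 0 := fun u v => by
    obtain ⟨D, hD, hDu⟩ := hasFDerivAt_herm (ε := ε) (hasFDerivAt_fderiv_apply hF v)
      (hF.differentiableAt (by simp)).hasFDerivAt
    have h2 : HasFDerivAt (fun _ : E => (0 : ℂ)) D x :=
      hD.congr_of_eventuallyEq (by filter_upwards [h] with y hy using (hy v).symm)
    rw [h2.unique (hasFDerivAt_const _ _)] at hDu
    simpa using (hDu u).symm
  -- Symmetry of the second differential makes (dF u, dF v) equal to its conjugate, hence real: the
  -- tangent spaces are totally real.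
  have hsymm : fderiv ℝ (fderiv ℝ F) x u v = fderiv ℝ (fderiv ℝ F) x v u :=
    (hF.isSymmSndFDerivAt (by
      rw [minSmoothness_of_isRCLikeNormedField]
      exact WithTop.coe_le_coe.2 le_top)) u v
  have h1 := key u v
  have h2 := key v u
  rw [← hsymm] at h2
  have h3 : herm ε (fderiv ℝ F x u) (fderiv ℝ F x v) = metric ε (fderiv ℝ F x u) (fderiv ℝ F x v) := by
    rw [metric, eq_comm, Complex.ext_iff]
    refine ⟨rfl, ?_⟩
    have := congrArg Complex.im (add_right_cancel (h1.trans h2.symm))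
    rw [← conj_herm, Complex.conj_im] at this
    simp
    linarith
  rw [← h3]
  linear_combination h2

end Local

/-! ### Legendrian immersions in charts -/

section Manifold

variable {E : Type*} [NormedAddCommGroup E] [NormedSpace ℝ E]
  {H : Type*} [TopologicalSpace H] {I : ModelWithCorners ℝ E H} [I.Boundaryless]
  {M : Type*} [TopologicalSpace M] [ChartedSpace H M] {ι : Type*} [Fintype ι]

/-- The expression of a map in the preferred chart at `x`. -/
noncomputable def localRep (I : ModelWithCorners ℝ E H) (φ : M → ι → ℂ) (x : M) : E → ι → ℂ :=
  φ ∘ (extChartAt I x).symm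

lemma localRep_apply_self (φ : M → ι → ℂ) (x : M) :
    localRep I φ x (extChartAt I x x) = φ x := by
  simp [localRep]

lemma diff_eq_fderiv {φ : M → ι → ℂ} {x : M} (hφ : MDifferentiableAt I 𝓘(ℝ, ι → ℂ) φ x) :
    diff I φ x = fderiv ℝ (localRep I φ x) (extChartAt I x x) := by
  have h := hφ.mfderiv
  rw [I.range_eq_univ, fderivWithin_univ] at h
  exact h

lemma diff₂_eq_fderiv (φ : M → ι → ℂ) (x : M) :
    diff₂ I φ x = fderiv ℝ (fderiv ℝ (localRep I φ x)) (extChartAt I x x) := by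
  rw [diff₂, I.range_eq_univ]
  simp only [fderivWithin_univ]
  rfl

lemma mdifferentiableAt_iff_localRep {φ : M → ι → ℂ} {x : M} (hφ : ContinuousAt φ x) :
    MDifferentiableAt I 𝓘(ℝ, ι → ℂ) φ x ↔
      DifferentiableAt ℝ (localRep I φ x) (extChartAt I x x) := by
  rw [mdifferentiableAt_iff, I.range_eq_univ, differentiableWithinAt_univ]
  exact and_iff_right hφ

variable [IsManifold I ∞ M]

lemma contDiffAt_localRep {φ : M → ι → ℂ} (hφ : ContMDiff I 𝓘(ℝ, ι → ℂ) ∞ φ) (x : M) {z : E}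
    (hz : z ∈ (extChartAt I x).target) : ContDiffAt ℝ ∞ (localRep I φ x) z := by
  have h : ContMDiffOn 𝓘(ℝ, E) 𝓘(ℝ, ι → ℂ) ∞ (localRep I φ x) (extChartAt I x).target :=
    hφ.comp_contMDiffOn (contMDiffOn_extChartAt_symm x)
  exact (contMDiffOn_iff_contDiffOn.1 h).contDiffAt ((isOpen_extChartAt_target x).mem_nhds hz)

lemma contDiffAt_extCoordChange (x y : M) (hy : y ∈ (extChartAt I x).source) :
    ContDiffAt ℝ ∞ (extChartAt I x ∘ (extChartAt I y).symm) (extChartAt I y y) := by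
  have h := contDiffWithinAt_ext_coord_change (I := I) (n := ∞) x y (y := extChartAt I y y)
    (by simpa using hy)
  rwa [I.range_eq_univ, contDiffWithinAt_univ] at h

lemma localRep_eventuallyEq (φ : M → ι → ℂ) (x y : M) (hy : y ∈ (extChartAt I x).source) :
    localRep I φ y =ᶠ[𝓝 (extChartAt I y y)]
      localRep I φ x ∘ (extChartAt I x ∘ (extChartAt I y).symm) := by
  have h : ContinuousAt (extChartAt I y).symm (extChartAt I y y) :=
    continuousAt_extChartAt_symm y
  have h' : (extChartAt I x).source ∈ 𝓝 ((extChartAt I y).symm (extChartAt I y y)) := by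
    rw [extChartAt_to_inv]
    exact (isOpen_extChartAt_source x).mem_nhds hy
  filter_upwards [h.eventually h'] with z hz
  exact congrArg φ ((extChartAt I x).left_inv hz).symm

namespace IsLegendrianImmersion

variable {ε : ι → ℝ} {c : ℝ} {φ : M → ι → ℂ}

lemma mdifferentiableAt (hφ : IsLegendrianImmersion I ε c φ) (x : M) :
    MDifferentiableAt I 𝓘(ℝ, ι → ℂ) φ x := hφ.smooth.mdifferentiableAt (by simp)

/-- The differential is Hermitian orthogonal to the position vector, in a chart. -/
lemma herm_fderiv_localRep (hφ : IsLegendrianImmersion I ε c φ) (x : M) {z : E}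
    (hz : z ∈ (extChartAt I x).target) (u : E) :
    herm ε (fderiv ℝ (localRep I φ x) z u) (localRep I φ x z) = 0 := by
  have hd := ((contDiffAt_localRep hφ.smooth x hz).differentiableAt (by simp)).hasFDerivAt
  obtain ⟨D, hD, hDu⟩ := hasFDerivAt_herm (ε := ε) hd hd
  have h2 : HasFDerivAt (fun _ : E => (c : ℂ)) D z :=
    hD.congr_of_eventuallyEq (Filter.Eventually.of_forall fun y => (hφ.mem _).symm)
  rw [h2.unique (hasFDerivAt_const _ _)] at hDu
  have hre := congrArg Complex.re (hDu u)
  rw [← conj_herm] at hre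
  apply Complex.ext
  · simp at hre ⊢
    linarith
  -- The Legendrian condition holds at each point in the preferred chart of that point. The chain
  -- rule through the inverse chart carries it to the chart at x; the real part needed only
  -- constancy of (φ, φ).
  · have hs : MDifferentiableAt 𝓘(ℝ, E) I (extChartAt I x).symm z :=
      ((contMDiffOn_extChartAt_symm (n := ∞) x).contMDiffAt
        ((isOpen_extChartAt_target x).mem_nhds hz)).mdifferentiableAt (by simp)
    have hcomp := mfderiv_comp z (hφ.mdifferentiableAt _) hs
    have h3 : fderiv ℝ (localRep I φ x) z u = diff I φ ((extChartAt I x).symm z)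
        (mfderiv 𝓘(ℝ, E) I (extChartAt I x).symm z u) := by
      rw [← mfderiv_eq_fderiv]
      exact DFunLike.congr_fun hcomp u
    rw [h3, ← metric_I_smul_right]
    exact hφ.legendrian _ _

lemma herm_diff (hφ : IsLegendrianImmersion I ε c φ) (x : M) (u : E) :
    herm ε (diff I φ x u) (φ x) = 0 := by
  have := hφ.herm_fderiv_localRep x (mem_extChartAt_target x) u
  rwa [← diff_eq_fderiv (hφ.mdifferentiableAt x), localRep_apply_self] at this

lemma metric_diff (hφ : IsLegendrianImmersion I ε c φ) (x : M) (u : E) :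
    metric ε (diff I φ x u) (φ x) = 0 := by
  rw [metric, hφ.herm_diff, Complex.zero_re]

lemma herm_diff₂ (hφ : IsLegendrianImmersion I ε c φ) (x : M) (u v : E) :
    herm ε (diff₂ I φ x u v) (φ x) = -metric ε (diff I φ x u) (diff I φ x v) := by
  rw [diff₂_eq_fderiv, diff_eq_fderiv (hφ.mdifferentiableAt x), ← localRep_apply_self (I := I) φ x]
  refine herm_fderiv_fderiv (contDiffAt_localRep hφ.smooth x (mem_extChartAt_target x)) ?_ u v
  filter_upwards [extChartAt_target_mem_nhds x] with z hz u
  exact hφ.herm_fderiv_localRep x hz u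

lemma metric_self (hφ : IsLegendrianImmersion I ε c φ) (x : M) : metric ε (φ x) (φ x) = c := by
  have := hφ.mem x
  rw [quadric, Set.mem_ofPred_eq] at this
  rw [metric, this, Complex.ofReal_re]

variable [FiniteDimensional ℝ E]

/-- `diff₂` at y uses the chart at y, which may jump as y moves. Differentiating the mean curvature
requires one fixed chart, and the transition map k supplies the comparison. -/
lemma curvatureTrace_localRep (hφ : IsLegendrianImmersion I ε c φ)
    (hpos : ∀ x u, u ≠ 0 → 0 < metric ε (diff I φ x u) (diff I φ x u)) (x : M) {y : M}
    (hy : y ∈ (extChartAt I x).source) :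
    curvatureTrace ε c (diff I φ y) (diff₂ I φ y) (φ y) =
      curvatureTrace ε c (fderiv ℝ (localRep I φ x) (extChartAt I x y))
        (fderiv ℝ (fderiv ℝ (localRep I φ x)) (extChartAt I x y)) (φ y) := by
  obtain ⟨e, he⟩ := exists_isOrtho (hpos y)
  set k := extChartAt I x ∘ (extChartAt I y).symm
  have hk : ContDiffAt ℝ ∞ k (extChartAt I y y) := contDiffAt_extCoordChange x y hy
  have hky : k (extChartAt I y y) = extChartAt I x y := by simp [k]
  have htarget : extChartAt I x y ∈ (extChartAt I x).target := (extChartAt I x).map_source hy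
  have hF := contDiffAt_localRep hφ.smooth x htarget
  have hev := localRep_eventuallyEq (I := I) φ x y hy
  have hA : ∀ u, diff I φ y u =
      fderiv ℝ (localRep I φ x) (extChartAt I x y) (fderiv ℝ k (extChartAt I y y) u) := fun u => by
    rw [diff_eq_fderiv (hφ.mdifferentiableAt y), hev.fderiv_eq, fderiv_comp]
    · change fderiv ℝ _ (k _) _ = _
      rw [hky]
      rfl
    · change DifferentiableAt ℝ _ (k _)
      rw [hky]
      exact hF.differentiableAt (by simp)
    · exact hk.differentiableAt (by simp)
  -- The transition map has injective derivative because the differential of φ factors through it.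
  have hinj : Function.Injective (fderiv ℝ k (extChartAt I y y)) := fun u v huv =>
    hφ.immersion y (by rw [hA, hA, huv])
  refine he.curvatureTrace_comp
    (L := LinearEquiv.ofInjectiveEndo (fderiv ℝ k (extChartAt I y y) : E →ₗ[ℝ] E) hinj)
    (Q := fun u v => fderiv ℝ (fderiv ℝ k) (extChartAt I y y) u v) hA (fun u v => ?_) c fun u => ?_
  · rw [diff₂_eq_fderiv, hev.fderiv.fderiv_eq, fderiv_fderiv_comp (by rwa [hky]) hk, hky]
    rfl
  · have h := hφ.herm_fderiv_localRep x htarget u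
    rw [localRep, Function.comp, (extChartAt I x).left_inv hy] at h
    rw [metric]
    exact congrArg Complex.re h

lemma differentiableAt_localRep_curvatureTrace (hφ : IsLegendrianImmersion I ε c φ)
    (hpos : ∀ x u, u ≠ 0 → 0 < metric ε (diff I φ x u) (diff I φ x u)) (x : M) :
    DifferentiableAt ℝ
      (localRep I (fun y => curvatureTrace ε c (diff I φ y) (diff₂ I φ y) (φ y)) x)
      (extChartAt I x x) := by
  have hF := contDiffAt_localRep hφ.smooth x (mem_extChartAt_target x)
  have h : DifferentiableAt ℝ (fun z => curvatureTrace ε c (fderiv ℝ (localRep I φ x) z)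
      (fderiv ℝ (fderiv ℝ (localRep I φ x)) z) (localRep I φ x z)) (extChartAt I x x) := by
    refine differentiableAt_curvatureTrace c ((contDiffAt_fderiv hF).differentiableAt (by simp))
      ((contDiffAt_fderiv (contDiffAt_fderiv hF)).differentiableAt (by simp))
      (hF.differentiableAt (by simp)) ?_
    rw [← diff_eq_fderiv (hφ.mdifferentiableAt x)]
    exact hpos x
  refine h.congr_of_eventuallyEq ?_
  filter_upwards [extChartAt_target_mem_nhds x] with z hz
  have := hφ.curvatureTrace_localRep hpos x ((extChartAt I x).map_target hz)
  rw [(extChartAt I x).right_inv hz] at this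
  exact this

lemma sum_herm_diff₂ (hφ : IsLegendrianImmersion I ε c φ) {x : M} {κ : Type*} [Fintype κ]
    [DecidableEq κ] {e : Module.Basis κ ℝ E} (he : IsOrtho ε (diff I φ x) e) :
    herm ε (∑ i, diff₂ I φ x (e i) (e i)) (φ x) = -(Module.finrank ℝ E : ℂ) := by
  rw [herm_sum_left]
  simp only [hφ.herm_diff₂, he _ _, if_true]
  simp [Module.finrank_eq_card_basis e]

/-- The trace of the second differential. -/
lemma exists_sum_diff₂_eq (hφ : IsLegendrianImmersion I ε c φ) {x : M} {κ : Type*} [Fintype κ]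
    [DecidableEq κ] {e : Module.Basis κ ℝ E} (he : IsOrtho ε (diff I φ x) e) :
    ∃ ξ, ∑ i, diff₂ I φ x (e i) (e i) =
      curvatureTrace ε c (diff I φ x) (diff₂ I φ x) (φ x) + diff I φ x ξ +
        (-(Module.finrank ℝ E : ℝ) / c) • φ x := by
  obtain ⟨ξ, h⟩ := he.exists_decomposition c (diff₂ I φ x) (φ x)
  refine ⟨ξ, ?_⟩
  rw [metric, hφ.sum_herm_diff₂ he] at h
  simpa using h

/-- By construction the trace is orthogonal to φ only for the real metric. Pairing the trace of the
second differential with φ gives −dim M, which the radial term already accounts for, so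
orthogonality to Jφ follows too. -/
lemma herm_curvatureTrace (hφ : IsLegendrianImmersion I ε c φ) (hc : c ≠ 0) {x : M}
    {κ : Type*} [Fintype κ] [DecidableEq κ] {e : Module.Basis κ ℝ E}
    (he : IsOrtho ε (diff I φ x) e) :
    herm ε (curvatureTrace ε c (diff I φ x) (diff₂ I φ x) (φ x)) (φ x) = 0 := by
  obtain ⟨ξ, h⟩ := hφ.exists_sum_diff₂_eq he
  have h' := congrArg (fun w => herm ε w (φ x)) h
  have hm := hφ.mem x
  rw [quadric, Set.mem_ofPred_eq] at hm
  simp only [herm_add_left, herm_real_smul_left, hφ.herm_diff, hφ.sum_herm_diff₂ he, hm] at h'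
  have hc' : (c : ℂ) ≠ 0 := by exact_mod_cast hc
  push_cast at h'
  field_simp at h'
  linear_combination -h'

lemma metric_curvatureTrace_diff (hφ : IsLegendrianImmersion I ε c φ) {x : M}
    {κ : Type*} [Fintype κ] [DecidableEq κ] {e : Module.Basis κ ℝ E}
    (he : IsOrtho ε (diff I φ x) e) (u : E) :
    metric ε (curvatureTrace ε c (diff I φ x) (diff₂ I φ x) (φ x)) (diff I φ x u) = 0 := by
  rw [he.curvatureTrace_eq]
  exact he.metric_projNormal_map (hφ.metric_diff x) _ _

end IsLegendrianImmersion

end Manifold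

/-! ### First and second differentials of the join map in coordinates -/

section Join

variable {E₁ E₂ : Type*} [NormedAddCommGroup E₁] [NormedSpace ℝ E₁]
  [NormedAddCommGroup E₂] [NormedSpace ℝ E₂] {ι₁ ι₂ : Type*} [Fintype ι₁] [Fintype ι₂]

/-- `Sum.elim` as a continuous linear map. -/
noncomputable def sumElimL (ι₁ ι₂ : Type*) [Fintype ι₁] [Fintype ι₂] :
    ((ι₁ → ℂ) × (ι₂ → ℂ)) →L[ℝ] (ι₁ ⊕ ι₂ → ℂ) :=
  LinearMap.toContinuousLinearMap
    { toFun := fun x => Sum.elim x.1 x.2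
      map_add' := fun x y => by ext i; cases i <;> rfl
      map_smul' := fun a x => by ext i; cases i <;> rfl }

lemma sumElimL_apply (x : (ι₁ → ℂ) × (ι₂ → ℂ)) : sumElimL ι₁ ι₂ x = Sum.elim x.1 x.2 := rfl

lemma sumElim_add (a a' : ι₁ → ℂ) (b b' : ι₂ → ℂ) :
    Sum.elim (a + a') (b + b') = Sum.elim a b + Sum.elim a' b' := by
  ext i; cases i <;> rfl

lemma sumElim_smul {R : Type*} [SMul R ℂ] (r : R) (a : ι₁ → ℂ) (b : ι₂ → ℂ) :
    Sum.elim (r • a) (r • b) = r • Sum.elim a b := by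
  ext i; cases i <;> rfl

/-- The map `(t, u, v) ↦ (p(t) P(u), q(t) Q(v))`. -/
def joinOf {A N₁ N₂ : Type*} (p q : A → ℂ) (P : N₁ → ι₁ → ℂ) (Q : N₂ → ι₂ → ℂ)
    (x : A × N₁ × N₂) : ι₁ ⊕ ι₂ → ℂ :=
  Sum.elim (p x.1 • P x.2.1) (q x.1 • Q x.2.2)

/-- The differential of `joinOf`. -/
noncomputable def joinDiff (p q p' q' : ℂ) (a : ι₁ → ℂ) (b : ι₂ → ℂ) (P' : E₁ →L[ℝ] ι₁ → ℂ)
    (Q' : E₂ →L[ℝ] ι₂ → ℂ) : ℝ × E₁ × E₂ →L[ℝ] (ι₁ ⊕ ι₂ → ℂ) :=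
  (sumElimL ι₁ ι₂).comp
    (((ContinuousLinearMap.fst ℝ ℝ (E₁ × E₂)).smulRight (p' • a) +
      p • P'.comp ((ContinuousLinearMap.fst ℝ E₁ E₂).comp (ContinuousLinearMap.snd ℝ ℝ (E₁ × E₂)))).prod
    ((ContinuousLinearMap.fst ℝ ℝ (E₁ × E₂)).smulRight (q' • b) +
      q • Q'.comp ((ContinuousLinearMap.snd ℝ E₁ E₂).comp (ContinuousLinearMap.snd ℝ ℝ (E₁ × E₂)))))

lemma joinDiff_apply (p q p' q' : ℂ) (a : ι₁ → ℂ) (b : ι₂ → ℂ) (P' : E₁ →L[ℝ] ι₁ → ℂ)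
    (Q' : E₂ →L[ℝ] ι₂ → ℂ) (w : ℝ × E₁ × E₂) :
    joinDiff p q p' q' a b P' Q' w =
      Sum.elim ((w.1 * p' : ℂ) • a + p • P' w.2.1) ((w.1 * q' : ℂ) • b + q • Q' w.2.2) := by
  rw [mul_smul, mul_smul, Complex.coe_smul, Complex.coe_smul]
  rfl

lemma hasFDerivAt_joinOf {p q : ℝ → ℂ} {P : E₁ → ι₁ → ℂ} {Q : E₂ → ι₂ → ℂ} {p' q' : ℂ}
    {P' : E₁ →L[ℝ] ι₁ → ℂ} {Q' : E₂ →L[ℝ] ι₂ → ℂ} {z : ℝ × E₁ × E₂} (hp : HasDerivAt p p' z.1)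
    (hq : HasDerivAt q q' z.1) (hP : HasFDerivAt P P' z.2.1) (hQ : HasFDerivAt Q Q' z.2.2) :
    HasFDerivAt (joinOf p q P Q)
      (joinDiff (p z.1) (q z.1) p' q' (P z.2.1) (Q z.2.2) P' Q') z := by
  have h0 : HasFDerivAt (fun z : ℝ × E₁ × E₂ => z.1) (ContinuousLinearMap.fst ℝ ℝ (E₁ × E₂)) z :=
    hasFDerivAt_fst
  have h1 : HasFDerivAt (fun z : ℝ × E₁ × E₂ => z.2.1)
      ((ContinuousLinearMap.fst ℝ E₁ E₂).comp (ContinuousLinearMap.snd ℝ ℝ (E₁ × E₂))) z :=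
    hasFDerivAt_fst.comp z hasFDerivAt_snd
  have h2 : HasFDerivAt (fun z : ℝ × E₁ × E₂ => z.2.2)
      ((ContinuousLinearMap.snd ℝ E₁ E₂).comp (ContinuousLinearMap.snd ℝ ℝ (E₁ × E₂))) z :=
    hasFDerivAt_snd.comp z hasFDerivAt_snd
  have h := (sumElimL ι₁ ι₂).hasFDerivAt.comp z
    (((hp.hasFDerivAt.comp z h0).smul (hP.comp z h1)).prodMk
      ((hq.hasFDerivAt.comp z h0).smul (hQ.comp z h2)))
  refine h.congr_fderiv ?_
  refine ContinuousLinearMap.ext fun w => ?_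
  rw [joinDiff_apply]
  simp only [ContinuousLinearMap.comp_apply, sumElimL_apply, ContinuousLinearMap.prod_apply]
  congr 1
  · simp [add_comm, ContinuousLinearMap.smulRight_apply]
  · simp [add_comm, ContinuousLinearMap.smulRight_apply]

/-- For fixed w, the map y ↦ D(y) w is a combination of two maps of the same shape, so the first
order formula applies again. The diagonal suffices because traces are taken over orthonormal bases.
-/
lemma fderiv_fderiv_joinOf {p q : ℝ → ℂ} {P : E₁ → ι₁ → ℂ} {Q : E₂ → ι₂ → ℂ} {z : ℝ × E₁ × E₂}
    (hp : ContDiffAt ℝ ∞ p z.1) (hq : ContDiffAt ℝ ∞ q z.1) (hP : ContDiffAt ℝ ∞ P z.2.1)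
    (hQ : ContDiffAt ℝ ∞ Q z.2.2) (hJ : ContDiffAt ℝ ∞ (joinOf p q P Q) z) (w : ℝ × E₁ × E₂) :
    fderiv ℝ (fderiv ℝ (joinOf p q P Q)) z w w =
      Sum.elim
        ((w.1 ^ 2 * deriv (deriv p) z.1 : ℂ) • P z.2.1 +
          (2 * w.1 * deriv p z.1 : ℂ) • fderiv ℝ P z.2.1 w.2.1 +
          p z.1 • fderiv ℝ (fderiv ℝ P) z.2.1 w.2.1 w.2.1)
        ((w.1 ^ 2 * deriv (deriv q) z.1 : ℂ) • Q z.2.2 +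
          (2 * w.1 * deriv q z.1 : ℂ) • fderiv ℝ Q z.2.2 w.2.2 +
          q z.1 • fderiv ℝ (fderiv ℝ Q) z.2.2 w.2.2 w.2.2) := by
  have hderiv : ∀ {f : ℝ → ℂ}, ContDiffAt ℝ ∞ f z.1 → DifferentiableAt ℝ (deriv f) z.1 :=
    fun {f} hf => by
      have h1 := (contDiffAt_fderiv hf).differentiableAt (by simp)
      have h2 : DifferentiableAt ℝ (fun t => fderiv ℝ f t 1) z.1 := by fun_prop
      exact h2
  have hev : (fun y => fderiv ℝ (joinOf p q P Q) y w) =ᶠ[𝓝 z] fun y =>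
      (w.1 : ℝ) • joinOf (deriv p) (deriv q) P Q y +
        joinOf p q (fun u => fderiv ℝ P u w.2.1) (fun v => fderiv ℝ Q v w.2.2) y := by
    have c0 : Filter.Tendsto (fun y : ℝ × E₁ × E₂ => y.1) (𝓝 z) (𝓝 z.1) := by
      exact (continuous_fst).continuousAt
    have c1 : Filter.Tendsto (fun y : ℝ × E₁ × E₂ => y.2.1) (𝓝 z) (𝓝 z.2.1) := by
      exact (continuous_fst.comp continuous_snd).continuousAt
    have c2 : Filter.Tendsto (fun y : ℝ × E₁ × E₂ => y.2.2) (𝓝 z) (𝓝 z.2.2) := by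
      exact (continuous_snd.comp continuous_snd).continuousAt
    filter_upwards [c0.eventually (eventually_contDiffAt hp), c0.eventually (eventually_contDiffAt hq),
      c1.eventually (eventually_contDiffAt hP), c2.eventually (eventually_contDiffAt hQ)]
      with y h1 h2 h3 h4
    rw [(hasFDerivAt_joinOf (h1.differentiableAt (by simp)).hasDerivAt
      (h2.differentiableAt (by simp)).hasDerivAt (h3.differentiableAt (by simp)).hasFDerivAt
      (h4.differentiableAt (by simp)).hasFDerivAt).fderiv, joinDiff_apply, joinOf, joinOf,
      mul_smul, mul_smul, Complex.coe_smul, Complex.coe_smul, sumElim_add, sumElim_smul]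
  have happ : fderiv ℝ (fun y => fderiv ℝ (joinOf p q P Q) y w) z w =
      fderiv ℝ (fderiv ℝ (joinOf p q P Q)) z w w := by
    rw [fderiv_clm_apply ((contDiffAt_fderiv hJ).differentiableAt (by simp))
      (differentiableAt_const _)]
    simp
  have hd1 := hasFDerivAt_joinOf (hderiv hp).hasDerivAt (hderiv hq).hasDerivAt
    (hP.differentiableAt (by simp)).hasFDerivAt (hQ.differentiableAt (by simp)).hasFDerivAt
  have hd2 := hasFDerivAt_joinOf (hp.differentiableAt (by simp)).hasDerivAt
    (hq.differentiableAt (by simp)).hasDerivAt (hasFDerivAt_fderiv_apply hP w.2.1)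
    (hasFDerivAt_fderiv_apply hQ w.2.2)
  rw [← happ, hev.fderiv_eq]
  refine (DFunLike.congr_fun ((hd1.const_smul w.1).add hd2).fderiv w).trans ?_
  simp only [add_apply, smul_apply, joinDiff_apply, ContinuousLinearMap.comp_apply,
    ContinuousLinearMap.apply_apply, ← sumElim_smul, ← sumElim_add, ← Complex.coe_smul]
  congr 1 <;> module

end Join

/-! ### The join on the product manifold -/

section JoinManifold

variable {E₁ E₂ : Type*} [NormedAddCommGroup E₁] [NormedSpace ℝ E₁]
  [NormedAddCommGroup E₂] [NormedSpace ℝ E₂] {ι₁ ι₂ : Type*} [Fintype ι₁] [Fintype ι₂]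
  {H₁ H₂ : Type*} [TopologicalSpace H₁] [TopologicalSpace H₂]
  {I₁ : ModelWithCorners ℝ E₁ H₁} [I₁.Boundaryless] {I₂ : ModelWithCorners ℝ E₂ H₂}
  [I₂.Boundaryless]
  {N₁ N₂ : Type*} [TopologicalSpace N₁] [ChartedSpace H₁ N₁] [TopologicalSpace N₂]
  [ChartedSpace H₂ N₂] {S : TopologicalSpace.Opens ℝ}

lemma extChartAt_join (x : S × N₁ × N₂) :
    extChartAt (𝓘(ℝ, ℝ).prod (I₁.prod I₂)) x x =
      ((x.1 : ℝ), extChartAt I₁ x.2.1 x.2.1, extChartAt I₂ x.2.2 x.2.2) := rfl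

/-- The chart of S is the inclusion, whose inverse returns the given number only on the chart
target; hence equality of germs. -/
lemma localRep_joinOf (p q : ℝ → ℂ) (P : N₁ → ι₁ → ℂ) (Q : N₂ → ι₂ → ℂ) (x : S × N₁ × N₂) :
    localRep (𝓘(ℝ, ℝ).prod (I₁.prod I₂)) (joinOf (fun s : S => p s) (fun s : S => q s) P Q) x
      =ᶠ[𝓝 (extChartAt (𝓘(ℝ, ℝ).prod (I₁.prod I₂)) x x)]
      joinOf p q (localRep I₁ P x.2.1) (localRep I₂ Q x.2.2) := by
  have h1 : ∀ᶠ z : ℝ × E₁ × E₂ in 𝓝 (extChartAt (𝓘(ℝ, ℝ).prod (I₁.prod I₂)) x x),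
      z.1 ∈ (extChartAt 𝓘(ℝ, ℝ) x.1).target := by
    rw [extChartAt_join]
    refine continuous_fst.continuousAt.eventually ?_
    exact extChartAt_target_mem_nhds (I := 𝓘(ℝ, ℝ)) x.1
  filter_upwards [h1] with z hz
  have h2 : (((extChartAt 𝓘(ℝ, ℝ) x.1).symm z.1 : S) : ℝ) = z.1 :=
    (extChartAt 𝓘(ℝ, ℝ) x.1).right_inv hz
  simp only [localRep, Function.comp, extChartAt_prod, joinOf, PartialEquiv.prod_symm,
    PartialEquiv.prod_coe]
  rw [h2]

lemma hasDiff_joinOf {p q : ℝ → ℂ} {P : N₁ → ι₁ → ℂ} {Q : N₂ → ι₂ → ℂ} {p' q' : ℂ}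
    {x : S × N₁ × N₂} (hp : HasDerivAt p p' x.1) (hq : HasDerivAt q q' x.1)
    (hP : MDifferentiableAt I₁ 𝓘(ℝ, ι₁ → ℂ) P x.2.1)
    (hQ : MDifferentiableAt I₂ 𝓘(ℝ, ι₂ → ℂ) Q x.2.2) :
    MDifferentiableAt (𝓘(ℝ, ℝ).prod (I₁.prod I₂)) 𝓘(ℝ, ι₁ ⊕ ι₂ → ℂ)
      (joinOf (fun s : S => p s) (fun s : S => q s) P Q) x ∧
    diff (𝓘(ℝ, ℝ).prod (I₁.prod I₂)) (joinOf (fun s : S => p s) (fun s : S => q s) P Q) x =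
      joinDiff (p x.1) (q x.1) p' q' (P x.2.1) (Q x.2.2) (diff I₁ P x.2.1) (diff I₂ Q x.2.2) := by
  have hP' := ((mdifferentiableAt_iff_localRep hP.continuousAt).1 hP).hasFDerivAt
  have hQ' := ((mdifferentiableAt_iff_localRep hQ.continuousAt).1 hQ).hasFDerivAt
  rw [← diff_eq_fderiv hP] at hP'
  rw [← diff_eq_fderiv hQ] at hQ'
  have h := (hasFDerivAt_joinOf (z := ((x.1 : ℝ), extChartAt I₁ x.2.1 x.2.1,
    extChartAt I₂ x.2.2 x.2.2)) hp hq hP' hQ')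
  simp only [localRep_apply_self] at h
  have h' := h.congr_of_eventuallyEq (localRep_joinOf (I₁ := I₁) (I₂ := I₂) p q P Q x)
  have hcont : ContinuousAt (joinOf (fun s : S => p s) (fun s : S => q s) P Q) x := by
    have c0 : ContinuousAt (fun y : S × N₁ × N₂ => (y.1 : ℝ)) x := by fun_prop
    have c1 : ContinuousAt (fun y : S × N₁ × N₂ => p y.1) x :=
      ContinuousAt.comp (f := fun y : S × N₁ × N₂ => (y.1 : ℝ)) hp.continuousAt c0
    have c2 : ContinuousAt (fun y : S × N₁ × N₂ => q y.1) x :=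
      ContinuousAt.comp (f := fun y : S × N₁ × N₂ => (y.1 : ℝ)) hq.continuousAt c0
    have c3 : ContinuousAt (fun y : S × N₁ × N₂ => P y.2.1) x :=
      ContinuousAt.comp (f := fun y : S × N₁ × N₂ => y.2.1) hP.continuousAt (by fun_prop)
    have c4 : ContinuousAt (fun y : S × N₁ × N₂ => Q y.2.2) x :=
      ContinuousAt.comp (f := fun y : S × N₁ × N₂ => y.2.2) hQ.continuousAt (by fun_prop)
    exact (sumElimL ι₁ ι₂).continuous.continuousAt.comp ((c1.smul c3).prodMk (c2.smul c4))
  have hm := (mdifferentiableAt_iff_localRep (I := 𝓘(ℝ, ℝ).prod (I₁.prod I₂)) hcont).2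
    h'.differentiableAt
  exact ⟨hm, (diff_eq_fderiv hm).trans h'.fderiv⟩

end JoinManifold

/-! ### Acceleration of the Legendre curve -/

section CurveIdentities

variable {S : TopologicalSpace.Opens ℝ} {α : ℝ → Fin 2 → ℂ} {s : ℝ} {n₁ n₂ : ℕ}

namespace IsLegendreCurve

lemma hasDerivAt_conj_apply (hα : IsLegendreCurve S α) (hs : s ∈ S) :
    HasDerivAt (fun t => conj (α t 0)) (conj (slope α s) * α s 1) s ∧
      HasDerivAt (fun t => conj (α t 1)) (conj (slope α s) * α s 0) s := by
  constructor
  · simpa using (hα.hasDerivAt_fst hs).star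
  · simpa using (hα.hasDerivAt_snd hs).star

lemma deriv_deriv_fst (hα : IsLegendreCurve S α) (hs : s ∈ S) :
    deriv (deriv fun t => α t 0) s =
      deriv (slope α) s * conj (α s 1) + slope α s * conj (slope α s) * α s 0 := by
  have h : deriv (fun t => α t 0) =ᶠ[𝓝 s] fun t => slope α t * conj (α t 1) := by
    filter_upwards [S.isOpen.mem_nhds hs] with t ht using hα.deriv_fst ht
  rw [h.deriv_eq, ((hα.hasDerivAt_slope hs).fun_mul (hα.hasDerivAt_conj_apply hs).2).deriv]
  ring

lemma deriv_deriv_snd (hα : IsLegendreCurve S α) (hs : s ∈ S) :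
    deriv (deriv fun t => α t 1) s =
      deriv (slope α) s * conj (α s 0) + slope α s * conj (slope α s) * α s 1 := by
  have h : deriv (fun t => α t 1) =ᶠ[𝓝 s] fun t => slope α t * conj (α t 0) := by
    filter_upwards [S.isOpen.mem_nhds hs] with t ht using hα.deriv_snd ht
  rw [h.deriv_eq, ((hα.hasDerivAt_slope hs).fun_mul (hα.hasDerivAt_conj_apply hs).1).deriv]
  ring

/-- The normal part of the acceleration of the curve. -/
lemma exists_acceleration_eq (hα : IsLegendreCurve S α) (hreg : n₁ ≠ 0 → ∀ s ∈ S, α s 0 ≠ 0)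
    (hs : s ∈ S) : ∃ ρ : ℝ,
      deriv (deriv fun t => α t 0) s / (slope α s * conj (slope α s)) - n₁ / conj (α s 0) =
        Complex.I * phaseRate n₁ n₂ α s / conj (slope α s) * conj (α s 1) +
          ρ * (slope α s * conj (α s 1)) + (n₁ + n₂ + 1) * α s 0 ∧
      deriv (deriv fun t => α t 1) s / (slope α s * conj (slope α s)) + n₂ / conj (α s 1) =
        Complex.I * phaseRate n₁ n₂ α s / conj (slope α s) * conj (α s 0) +
          ρ * (slope α s * conj (α s 0)) + (n₁ + n₂ + 1) * α s 1 := by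
  have hh := hα.slope_ne_zero hs
  have hh' : conj (slope α s) ≠ 0 := (map_ne_zero _).2 hh
  have hy := hα.snd_ne_zero hs
  have hy' : conj (α s 1) ≠ 0 := (map_ne_zero _).2 hy
  have hc := hα.mul_conj_sub hs
  set h' := deriv (slope α) s with hh1
  set W := deriv (weight n₁ n₂ α) s / weight n₁ n₂ α s with hW
  have hWe := hα.weight_deriv_div (n₂ := n₂) hreg hs
  rw [← hW] at hWe
  have hWc := congrArg conj hWe
  simp only [map_add, map_mul, map_div₀, Complex.conj_conj, map_natCast] at hWc
  set Q := h' / slope α s with hQ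
  have hk : phaseRate n₁ n₂ α s = Q.im + W.im := by rw [phaseRate, Complex.add_im]
  -- The total coefficient must be (Q − W̄)/h̄. The part Im(Q + W) of Q − W̄ is κ, and ρ|h|² has to
  -- supply the real part Re(Q − W).
  refine ⟨(Q.re - W.re) / Complex.normSq (slope α s), ?_⟩
  have hν : ∀ z : ℂ, Complex.I * phaseRate n₁ n₂ α s / conj (slope α s) * z +
      ((Q.re - W.re) / Complex.normSq (slope α s) : ℝ) * (slope α s * z) =
      (h' / slope α s - conj W) / conj (slope α s) * z := fun z => by
    have h1 : h' / slope α s - conj W = Q.re - W.re + Complex.I * (Q.im + W.im) := by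
      rw [← hQ]
      apply Complex.ext <;> simp
    rw [h1, hk]
    push_cast
    rw [← Complex.mul_conj]
    field_simp
    ring
  rw [hα.deriv_deriv_fst hs, hα.deriv_deriv_snd hs, hν, hν, hWc]
  rcases eq_or_ne n₁ 0 with rfl | h0
  · constructor
    · simp only [Nat.cast_zero, zero_div, zero_mul, zero_add]
      field_simp
      ring
    · simp only [Nat.cast_zero, zero_mul, zero_add]
      field_simp
      linear_combination ((n₂ : ℂ) * slope α s * conj (slope α s)) * hc
  · have hx := hreg h0 s hs
    have hx' : conj (α s 0) ≠ 0 := (map_ne_zero _).2 hx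
    constructor
    · field_simp
      linear_combination (-(n₁ : ℂ) * slope α s * conj (slope α s)) * hc
    · field_simp
      linear_combination ((n₂ : ℂ) * slope α s * conj (slope α s)) * hc

end IsLegendreCurve

end CurveIdentities

/-! ### Rescaled product bases -/

section JoinBasis

variable {E₁ E₂ : Type*} [NormedAddCommGroup E₁] [NormedSpace ℝ E₁]
  [NormedAddCommGroup E₂] [NormedSpace ℝ E₂] {κ₁ κ₂ : Type*}

/-- A rescaled product basis. -/
lemma exists_scaled_prod_basis (e₁ : Module.Basis κ₁ ℝ E₁) (e₂ : Module.Basis κ₂ ℝ E₂)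
    {r₀ r₁ r₂ : ℝ} (h₀ : r₀ ≠ 0) (h₁ : r₁ ≠ 0) (h₂ : r₂ ≠ 0) :
    ∃ e : Module.Basis (Unit ⊕ κ₁ ⊕ κ₂) ℝ (ℝ × E₁ × E₂),
      (∀ i, e (Sum.inl i) = (r₀, 0, 0)) ∧ (∀ i, e (Sum.inr (Sum.inl i)) = (0, r₁ • e₁ i, 0)) ∧
        ∀ i, e (Sum.inr (Sum.inr i)) = (0, 0, r₂ • e₂ i) := by
  refine ⟨((Module.Basis.singleton Unit ℝ).prod (e₁.prod e₂)).unitsSMul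
    (Sum.elim (fun _ => Units.mk0 r₀ h₀) (Sum.elim (fun _ => Units.mk0 r₁ h₁)
      fun _ => Units.mk0 r₂ h₂)), fun i => ?_, fun i => ?_, fun i => ?_⟩ <;>
  simp [Module.Basis.unitsSMul_apply, Units.smul_def, Prod.ext_iff]

end JoinBasis

/-! ### The Hermitian product on the product space -/

section JoinHerm

lemma metric_zero_left {ι : Type*} [Fintype ι] (ε : ι → ℝ) (w : ι → ℂ) : metric ε 0 w = 0 := by
  simp [metric]

lemma metric_zero_right {ι : Type*} [Fintype ι] (ε : ι → ℝ) (w : ι → ℂ) : metric ε w 0 = 0 := by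
  simp [metric]

variable {n₁ n₂ : ℕ}

lemma herm_prodSign (v v' : Fin (n₁ + 1) → ℂ) (w w' : Fin (n₂ + 1) → ℂ) :
    herm (prodSign n₁ n₂) (Sum.elim v w) (Sum.elim v' w') =
      herm (sphereSign n₁) v v' + herm (adsSign n₂) w w' :=
  herm_sumElim _ _ _ _ _ _

/-- The Hermitian product of vectors split along position vectors. -/
lemma herm_prodSign_split {z v v' : Fin (n₁ + 1) → ℂ} {y w w' : Fin (n₂ + 1) → ℂ}
    (hz : herm (sphereSign n₁) z z = 1) (hy : herm (adsSign n₂) y y = -1)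
    (hv : herm (sphereSign n₁) v z = 0) (hv' : herm (sphereSign n₁) v' z = 0)
    (hw : herm (adsSign n₂) w y = 0) (hw' : herm (adsSign n₂) w' y = 0) (a b a' b' : ℂ) :
    herm (prodSign n₁ n₂) (Sum.elim (a • z + v) (b • y + w)) (Sum.elim (a' • z + v') (b' • y + w')) =
      a * conj a' - b * conj b' + herm (sphereSign n₁) v v' + herm (adsSign n₂) w w' := by
  have h1 : herm (sphereSign n₁) z v' = 0 := by rw [← conj_herm, hv', map_zero]
  have h2 : herm (adsSign n₂) y w' = 0 := by rw [← conj_herm, hw', map_zero]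
  rw [herm_prodSign]
  simp only [herm_add_left, herm_add_right, herm_smul_left, herm_smul_right, hz, hy, hv, hw, h1, h2]
  ring

end JoinHerm

/-! ### Induced metric and adapted orthonormal basis of the join -/

section JoinLegendrian

variable {E₁ E₂ : Type*} [NormedAddCommGroup E₁] [NormedSpace ℝ E₁]
  [NormedAddCommGroup E₂] [NormedSpace ℝ E₂]
  {H₁ H₂ : Type*} [TopologicalSpace H₁] [TopologicalSpace H₂]
  {I₁ : ModelWithCorners ℝ E₁ H₁} [I₁.Boundaryless] {I₂ : ModelWithCorners ℝ E₂ H₂}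
  [I₂.Boundaryless]
  {N₁ N₂ : Type*} [TopologicalSpace N₁] [ChartedSpace H₁ N₁] [TopologicalSpace N₂]
  [ChartedSpace H₂ N₂] [IsManifold I₁ ∞ N₁] [IsManifold I₂ ∞ N₂]
  {S : TopologicalSpace.Opens ℝ} {α : ℝ → Fin 2 → ℂ}
  {n₁ n₂ : ℕ} {ψ₁ : N₁ → Fin (n₁ + 1) → ℂ} {ψ₂ : N₂ → Fin (n₂ + 1) → ℂ}

lemma join_eq_joinOf : join S α ψ₁ ψ₂ =
    joinOf (fun s : S => (fun t => α t 0) s) (fun s : S => (fun t => α t 1) s) ψ₁ ψ₂ := rfl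

lemma IsLegendrianImmersion.herm_self {E H M ι : Type*} [NormedAddCommGroup E] [NormedSpace ℝ E]
    [TopologicalSpace H] {I : ModelWithCorners ℝ E H} [TopologicalSpace M] [ChartedSpace H M]
    [Fintype ι] {ε : ι → ℝ} {c : ℝ} {φ : M → ι → ℂ} (hφ : IsLegendrianImmersion I ε c φ) (x : M) :
    herm ε (φ x) (φ x) = c := hφ.mem x

lemma IsLegendrianImmersion.sphere_pos (hψ₁ : IsLegendrianImmersion I₁ (sphereSign n₁) 1 ψ₁)
    (x : N₁) (u : E₁) (hu : u ≠ 0) :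
    0 < metric (sphereSign n₁) (diff I₁ ψ₁ x u) (diff I₁ ψ₁ x u) :=
  herm_sphereSign_pos ((map_ne_zero_iff _ (hψ₁.immersion x)).2 hu)

lemma IsLegendrianImmersion.ads_pos (hψ₂ : IsLegendrianImmersion I₂ (adsSign n₂) (-1) ψ₂)
    (x : N₂) (u : E₂) (hu : u ≠ 0) :
    0 < metric (adsSign n₂) (diff I₂ ψ₂ x u) (diff I₂ ψ₂ x u) :=
  metric_adsSign_pos (by simpa using hψ₂.herm_self x) (hψ₂.herm_diff x u)
    ((map_ne_zero_iff _ (hψ₂.immersion x)).2 hu)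

lemma diff_join (hα : IsLegendreCurve S α) (hψ₁ : IsLegendrianImmersion I₁ (sphereSign n₁) 1 ψ₁)
    (hψ₂ : IsLegendrianImmersion I₂ (adsSign n₂) (-1) ψ₂) (x : S × N₁ × N₂) (w : ℝ × E₁ × E₂) :
    diff (𝓘(ℝ, ℝ).prod (I₁.prod I₂)) (join S α ψ₁ ψ₂) x w =
      Sum.elim ((w.1 * (slope α x.1 * conj (α x.1 1)) : ℂ) • ψ₁ x.2.1 +
          α x.1 0 • diff I₁ ψ₁ x.2.1 w.2.1)
        ((w.1 * (slope α x.1 * conj (α x.1 0)) : ℂ) • ψ₂ x.2.2 +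
          α x.1 1 • diff I₂ ψ₂ x.2.2 w.2.2) := by
  rw [join_eq_joinOf, (hasDiff_joinOf (I₁ := I₁) (I₂ := I₂) (hα.hasDerivAt_fst x.1.2)
    (hα.hasDerivAt_snd x.1.2) (hψ₁.mdifferentiableAt x.2.1) (hψ₂.mdifferentiableAt x.2.2)).2,
    joinDiff_apply]

lemma contMDiff_join (hα : IsLegendreCurve S α)
    (hψ₁ : IsLegendrianImmersion I₁ (sphereSign n₁) 1 ψ₁)
    (hψ₂ : IsLegendrianImmersion I₂ (adsSign n₂) (-1) ψ₂) :
    ContMDiff (𝓘(ℝ, ℝ).prod (I₁.prod I₂)) 𝓘(ℝ, Fin (n₁ + 1) ⊕ Fin (n₂ + 1) → ℂ) ∞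
      (join S α ψ₁ ψ₂) := by
  have h0 : ∀ j, ContMDiff 𝓘(ℝ, ℝ) 𝓘(ℝ, ℂ) ∞ (fun s : S => α s j) := fun j s =>
    ((hα.contDiffOn_apply j).contDiffAt (S.isOpen.mem_nhds s.2)).contMDiffAt.comp s
      contMDiff_subtype_val.contMDiffAt
  have h1 : ∀ j, ContMDiff (𝓘(ℝ, ℝ).prod (I₁.prod I₂)) 𝓘(ℝ, ℂ) ∞
      (fun x : S × N₁ × N₂ => α x.1 j) := fun j => (h0 j).comp contMDiff_fst
  have h2 : ContMDiff (𝓘(ℝ, ℝ).prod (I₁.prod I₂)) 𝓘(ℝ, Fin (n₁ + 1) → ℂ) ∞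
      (fun x : S × N₁ × N₂ => ψ₁ x.2.1) :=
    hψ₁.smooth.comp (contMDiff_fst.comp contMDiff_snd)
  have h3 : ContMDiff (𝓘(ℝ, ℝ).prod (I₁.prod I₂)) 𝓘(ℝ, Fin (n₂ + 1) → ℂ) ∞
      (fun x : S × N₁ × N₂ => ψ₂ x.2.2) :=
    hψ₂.smooth.comp (contMDiff_snd.comp contMDiff_snd)
  have hmul : ContDiff ℝ ∞ (fun z : ℂ × ℂ => z.1 * z.2) := contDiff_fst.mul contDiff_snd
  rw [contMDiff_pi_space] at h2 h3 ⊢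
  rintro (i | i)
  · exact hmul.contMDiff.comp ((h1 0).prodMk_space (h2 i))
  · exact hmul.contMDiff.comp ((h1 1).prodMk_space (h3 i))

lemma diff₂_join (hα : IsLegendreCurve S α) (hψ₁ : IsLegendrianImmersion I₁ (sphereSign n₁) 1 ψ₁)
    (hψ₂ : IsLegendrianImmersion I₂ (adsSign n₂) (-1) ψ₂) (x : S × N₁ × N₂) (w : ℝ × E₁ × E₂) :
    diff₂ (𝓘(ℝ, ℝ).prod (I₁.prod I₂)) (join S α ψ₁ ψ₂) x w w =
      Sum.elim ((w.1 ^ 2 * deriv (deriv fun t => α t 0) x.1 : ℂ) • ψ₁ x.2.1 +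
          (2 * w.1 * deriv (fun t => α t 0) x.1 : ℂ) • diff I₁ ψ₁ x.2.1 w.2.1 +
          α x.1 0 • diff₂ I₁ ψ₁ x.2.1 w.2.1 w.2.1)
        ((w.1 ^ 2 * deriv (deriv fun t => α t 1) x.1 : ℂ) • ψ₂ x.2.2 +
          (2 * w.1 * deriv (fun t => α t 1) x.1 : ℂ) • diff I₂ ψ₂ x.2.2 w.2.2 +
          α x.1 1 • diff₂ I₂ ψ₂ x.2.2 w.2.2 w.2.2) := by
  have hev := localRep_joinOf (I₁ := I₁) (I₂ := I₂) (fun t => α t 0) (fun t => α t 1) ψ₁ ψ₂ x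
  have hJ := (contDiffAt_localRep (I := 𝓘(ℝ, ℝ).prod (I₁.prod I₂)) (contMDiff_join hα hψ₁ hψ₂) x (mem_extChartAt_target x))
  have hs := S.isOpen.mem_nhds x.1.2
  have h := fderiv_fderiv_joinOf (z := extChartAt (𝓘(ℝ, ℝ).prod (I₁.prod I₂)) x x)
    ((hα.contDiffOn_apply 0).contDiffAt hs) ((hα.contDiffOn_apply 1).contDiffAt hs)
    (contDiffAt_localRep hψ₁.smooth x.2.1 (mem_extChartAt_target x.2.1))
    (contDiffAt_localRep hψ₂.smooth x.2.2 (mem_extChartAt_target x.2.2))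
    (hJ.congr_of_eventuallyEq hev.symm) w
  rw [← hev.fderiv.fderiv_eq, extChartAt_join] at h
  simp only [localRep_apply_self, ← diff_eq_fderiv (hψ₁.mdifferentiableAt x.2.1),
    ← diff_eq_fderiv (hψ₂.mdifferentiableAt x.2.2), ← diff₂_eq_fderiv] at h
  rw [← h]
  exact congrArg (fun D : ℝ × E₁ × E₂ →L[ℝ] ℝ × E₁ × E₂ →L[ℝ] Fin (n₁ + 1) ⊕ Fin (n₂ + 1) → ℂ => D w w)
    (diff₂_eq_fderiv (I := 𝓘(ℝ, ℝ).prod (I₁.prod I₂)) (join S α ψ₁ ψ₂) x)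

lemma herm_diff_join (hα : IsLegendreCurve S α)
    (hψ₁ : IsLegendrianImmersion I₁ (sphereSign n₁) 1 ψ₁)
    (hψ₂ : IsLegendrianImmersion I₂ (adsSign n₂) (-1) ψ₂) (x : S × N₁ × N₂) (w : ℝ × E₁ × E₂)
    (a b : ℂ) {v : Fin (n₁ + 1) → ℂ} {v' : Fin (n₂ + 1) → ℂ}
    (hv : herm (sphereSign n₁) v (ψ₁ x.2.1) = 0) (hv' : herm (adsSign n₂) v' (ψ₂ x.2.2) = 0) :
    herm (prodSign n₁ n₂) (Sum.elim (a • ψ₁ x.2.1 + v) (b • ψ₂ x.2.2 + v'))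
      (diff (𝓘(ℝ, ℝ).prod (I₁.prod I₂)) (join S α ψ₁ ψ₂) x w) =
      w.1 * conj (slope α x.1) * (a * α x.1 1 - b * α x.1 0) +
        conj (α x.1 0) * herm (sphereSign n₁) v (diff I₁ ψ₁ x.2.1 w.2.1) +
        conj (α x.1 1) * herm (adsSign n₂) v' (diff I₂ ψ₂ x.2.2 w.2.2) := by
  rw [diff_join hα hψ₁ hψ₂, herm_prodSign_split (by simpa using hψ₁.herm_self x.2.1)
    (by simpa using hψ₂.herm_self x.2.2) hv
    (by rw [herm_smul_left, hψ₁.herm_diff, mul_zero]) hv'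
    (by rw [herm_smul_left, hψ₂.herm_diff, mul_zero])]
  simp only [herm_smul_right, map_mul, Complex.conj_conj, Complex.conj_ofReal]
  ring

/-- The metric induced by the join. -/
lemma metric_diff_join (hα : IsLegendreCurve S α)
    (hψ₁ : IsLegendrianImmersion I₁ (sphereSign n₁) 1 ψ₁)
    (hψ₂ : IsLegendrianImmersion I₂ (adsSign n₂) (-1) ψ₂) (x : S × N₁ × N₂) (w w' : ℝ × E₁ × E₂) :
    metric (prodSign n₁ n₂) (diff (𝓘(ℝ, ℝ).prod (I₁.prod I₂)) (join S α ψ₁ ψ₂) x w)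
      (diff (𝓘(ℝ, ℝ).prod (I₁.prod I₂)) (join S α ψ₁ ψ₂) x w') =
      ‖slope α x.1‖ ^ 2 * (w.1 * w'.1) +
        ‖α x.1 0‖ ^ 2 * metric (sphereSign n₁) (diff I₁ ψ₁ x.2.1 w.2.1) (diff I₁ ψ₁ x.2.1 w'.2.1) +
        ‖α x.1 1‖ ^ 2 * metric (adsSign n₂) (diff I₂ ψ₂ x.2.2 w.2.2) (diff I₂ ψ₂ x.2.2 w'.2.2) := by
  rw [metric, diff_join hα hψ₁ hψ₂ x w, herm_diff_join hα hψ₁ hψ₂ x w' _ _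
    (by rw [herm_smul_left, hψ₁.herm_diff, mul_zero])
    (by rw [herm_smul_left, hψ₂.herm_diff, mul_zero]), herm_smul_left, herm_smul_left]
  have hc := hα.mul_conj_sub x.1.2
  have h1 : (w'.1 : ℂ) * conj (slope α x.1) *
      (w.1 * (slope α x.1 * conj (α x.1 1)) * α x.1 1 -
        w.1 * (slope α x.1 * conj (α x.1 0)) * α x.1 0) = ((‖slope α x.1‖ ^ 2 * (w.1 * w'.1) : ℝ) : ℂ) := by
    push_cast
    rw [← Complex.conj_mul']
    linear_combination (-(w'.1 : ℂ) * conj (slope α x.1) * w.1 * slope α x.1) * hc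
  have h2 : ∀ a z : ℂ, conj a * (a * z) = (‖a‖ ^ 2 : ℝ) * z := fun a z => by
    rw [← mul_assoc, Complex.conj_mul', Complex.ofReal_pow]
  rw [h1, h2, h2]
  simp only [Complex.add_re, Complex.re_ofReal_mul, Complex.ofReal_re]
  rfl

variable [FiniteDimensional ℝ E₁] [FiniteDimensional ℝ E₂]

/-- An orthonormal basis adapted to the join. -/
lemma exists_join_basis (hα : IsLegendreCurve S α) (hreg : n₁ ≠ 0 → ∀ s ∈ S, α s 0 ≠ 0)
    (hψ₁ : IsLegendrianImmersion I₁ (sphereSign n₁) 1 ψ₁)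
    (hψ₂ : IsLegendrianImmersion I₂ (adsSign n₂) (-1) ψ₂) (x : S × N₁ × N₂) :
    ∃ (e₁ : Module.Basis (Fin n₁) ℝ E₁) (e₂ : Module.Basis (Fin n₂) ℝ E₂) (r₀ r₁ r₂ : ℝ)
      (e : Module.Basis (Unit ⊕ Fin n₁ ⊕ Fin n₂) ℝ (ℝ × E₁ × E₂)),
      IsOrtho (sphereSign n₁) (diff I₁ ψ₁ x.2.1) e₁ ∧ IsOrtho (adsSign n₂) (diff I₂ ψ₂ x.2.2) e₂ ∧
      IsOrtho (prodSign n₁ n₂) (diff (𝓘(ℝ, ℝ).prod (I₁.prod I₂)) (join S α ψ₁ ψ₂) x) e ∧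
      r₀ ^ 2 * ‖slope α x.1‖ ^ 2 = 1 ∧ (n₁ ≠ 0 → r₁ ^ 2 * ‖α x.1 0‖ ^ 2 = 1) ∧
      r₂ ^ 2 * ‖α x.1 1‖ ^ 2 = 1 ∧
      (∀ i, e (Sum.inl i) = (r₀, 0, 0)) ∧ (∀ i, e (Sum.inr (Sum.inl i)) = (0, r₁ • e₁ i, 0)) ∧
        ∀ i, e (Sum.inr (Sum.inr i)) = (0, 0, r₂ • e₂ i) := by
  obtain ⟨e₁', he₁'⟩ := exists_isOrtho (hψ₁.sphere_pos x.2.1)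
  obtain ⟨e₂', he₂'⟩ := exists_isOrtho (hψ₂.ads_pos x.2.2)
  have hd₁ : Module.finrank ℝ E₁ = n₁ := by simpa using hψ₁.dim
  have hd₂ : Module.finrank ℝ E₂ = n₂ := by simpa using hψ₂.dim
  obtain ⟨e₁, he₁⟩ : ∃ e₁ : Module.Basis (Fin n₁) ℝ E₁,
      IsOrtho (sphereSign n₁) (diff I₁ ψ₁ x.2.1) e₁ :=
    ⟨e₁'.reindex (finCongr hd₁), fun i j => by
      simpa using he₁' (Fin.cast hd₁.symm i) (Fin.cast hd₁.symm j)⟩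
  obtain ⟨e₂, he₂⟩ : ∃ e₂ : Module.Basis (Fin n₂) ℝ E₂,
      IsOrtho (adsSign n₂) (diff I₂ ψ₂ x.2.2) e₂ :=
    ⟨e₂'.reindex (finCongr hd₂), fun i j => by
      simpa using he₂' (Fin.cast hd₂.symm i) (Fin.cast hd₂.symm j)⟩
  have hscale : ∀ z : ℂ, z ≠ 0 → ‖z‖⁻¹ ≠ 0 ∧ ‖z‖⁻¹ ^ 2 * ‖z‖ ^ 2 = 1 := fun z hz => by
    have := norm_ne_zero_iff.2 hz
    exact ⟨inv_ne_zero this, by field_simp⟩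
  obtain ⟨h0, h0'⟩ := hscale _ (hα.slope_ne_zero x.1.2)
  obtain ⟨h2, h2'⟩ := hscale _ (hα.snd_ne_zero x.1.2)
  -- If n₁ = 0 there is no vector to rescale and α₁ may vanish, so any nonzero r₁ serves.
  obtain ⟨r₁, h1, h1'⟩ : ∃ r₁ : ℝ, r₁ ≠ 0 ∧ (n₁ ≠ 0 → r₁ ^ 2 * ‖α x.1 0‖ ^ 2 = 1) := by
    rcases eq_or_ne n₁ 0 with h | h
    · exact ⟨1, one_ne_zero, fun h' => absurd h h'⟩
    · obtain ⟨a, b⟩ := hscale _ (hreg h _ x.1.2)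
      exact ⟨_, a, fun _ => b⟩
  obtain ⟨e, ea, eb, ec⟩ := exists_scaled_prod_basis e₁ e₂ h0 h1 h2
  refine ⟨e₁, e₂, _, r₁, _, e, he₁, he₂, ?_, h0', h1', h2', ea, eb, ec⟩
  have h1'' : ∀ i : Fin n₁, r₁ ^ 2 * ‖α x.1 0‖ ^ 2 = 1 := fun i => h1' (by rintro rfl; exact i.elim0)
  rintro (i | i | i) (j | j | j) <;> rw [metric_diff_join hα hψ₁ hψ₂] <;>
    simp only [ea, eb, ec, map_smul, map_zero, metric_smul_left, metric_smul_right, he₁ _ _, he₂ _ _,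
      metric_zero_left, metric_zero_right, mul_zero, add_zero, zero_add, zero_mul,
      reduceCtorEq, if_false, Sum.inl.injEq, Sum.inr.injEq]
  · simp only [if_true]
    linear_combination h0'
  · rcases eq_or_ne i j with rfl | hij
    · simp only [if_true]
      linear_combination h1'' i
    · simp [hij]
  · rcases eq_or_ne i j with rfl | hij
    · simp only [if_true]
      linear_combination h2'
    · simp [hij]

end JoinLegendrian

/-! ### The trace of the second fundamental form of the join -/

section JoinCurvature

lemma sum_sumElim_zero_right {ι₁ ι₂ κ : Type*} [Fintype κ] (f : κ → ι₁ → ℂ) :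
    ∑ i, Sum.elim (f i) (0 : ι₂ → ℂ) = Sum.elim (∑ i, f i) 0 := by
  ext j; cases j <;> simp

lemma sum_sumElim_zero_left {ι₁ ι₂ κ : Type*} [Fintype κ] (f : κ → ι₂ → ℂ) :
    ∑ i, Sum.elim (0 : ι₁ → ℂ) (f i) = Sum.elim (0 : ι₁ → ℂ) (∑ i, f i) := by
  ext j; cases j <;> simp

variable {E₁ E₂ : Type*} [NormedAddCommGroup E₁] [NormedSpace ℝ E₁]
  [NormedAddCommGroup E₂] [NormedSpace ℝ E₂]
  {H₁ H₂ : Type*} [TopologicalSpace H₁] [TopologicalSpace H₂]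
  {I₁ : ModelWithCorners ℝ E₁ H₁} [I₁.Boundaryless] {I₂ : ModelWithCorners ℝ E₂ H₂}
  [I₂.Boundaryless]
  {N₁ N₂ : Type*} [TopologicalSpace N₁] [ChartedSpace H₁ N₁] [TopologicalSpace N₂]
  [ChartedSpace H₂ N₂] [IsManifold I₁ ∞ N₁] [IsManifold I₂ ∞ N₂]
  {S : TopologicalSpace.Opens ℝ} {α : ℝ → Fin 2 → ℂ}
  {n₁ n₂ : ℕ} {ψ₁ : N₁ → Fin (n₁ + 1) → ℂ} {ψ₂ : N₂ → Fin (n₂ + 1) → ℂ}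
  [FiniteDimensional ℝ E₁] [FiniteDimensional ℝ E₂]

/-- The join is a Legendrian immersion. -/
lemma isLegendrianImmersion_join (hα : IsLegendreCurve S α)
    (hreg : n₁ ≠ 0 → ∀ s ∈ S, α s 0 ≠ 0)
    (hψ₁ : IsLegendrianImmersion I₁ (sphereSign n₁) 1 ψ₁)
    (hψ₂ : IsLegendrianImmersion I₂ (adsSign n₂) (-1) ψ₂) :
    IsLegendrianImmersion (𝓘(ℝ, ℝ).prod (I₁.prod I₂)) (prodSign n₁ n₂) (-1)
      (join S α ψ₁ ψ₂) where
  dim := by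
    have h1 := hψ₁.dim
    have h2 := hψ₂.dim
    simp only [Fintype.card_fin, Fintype.card_sum, Module.finrank_prod, Module.finrank_self] at *
    omega
  smooth := contMDiff_join hα hψ₁ hψ₂
  mem x := by
    rw [quadric, Set.mem_ofPred_eq]
    change herm _ (Sum.elim (α x.1 0 • ψ₁ x.2.1) (α x.1 1 • ψ₂ x.2.2))
      (Sum.elim (α x.1 0 • ψ₁ x.2.1) (α x.1 1 • ψ₂ x.2.2)) = _
    have hc := hα.mul_conj_sub x.1.2
    rw [herm_prodSign]
    simp only [herm_smul_left, herm_smul_right, hψ₁.herm_self, hψ₂.herm_self]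
    push_cast
    linear_combination hc
  immersion x := by
    obtain ⟨e₁, e₂, r₀, r₁, r₂, e, -, -, he, -⟩ := exists_join_basis hα hreg hψ₁ hψ₂ x
    exact he.injective
  legendrian x w := by
    have h := herm_diff_join hα hψ₁ hψ₂ x w (α x.1 0) (α x.1 1) (v := 0) (v' := 0) (by simp) (by simp)
    rw [add_zero, add_zero] at h
    have h' : herm (prodSign n₁ n₂) (join S α ψ₁ ψ₂ x)
        (diff (𝓘(ℝ, ℝ).prod (I₁.prod I₂)) (join S α ψ₁ ψ₂) x w) = 0 := by
      refine h.trans ?_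
      simp only [herm_zero_left]
      ring
    rw [metric_I_smul_right, ← conj_herm, h']
    simp

/-- The factor relating the mean curvature of the join and the position vectors. -/
noncomputable def twist (n₁ n₂ : ℕ) (α : ℝ → Fin 2 → ℂ) (s : ℝ) : ℂ :=
  -phaseRate n₁ n₂ α s / conj (slope α s)

/-- The curve direction contributes α''/|h|², and the factors contribute their own traces divided by
ᾱᵢ, including the radial terms −n₁ψ₁/ᾱ₁ and n₂ψ₂/ᾱ₂. `exists_acceleration_eq` regroups these as the
claimed vector plus a tangent vector plus a multiple of φ; the claimed vector is orthogonal to both,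
so it is the normal part. -/
lemma curvatureTrace_join (hα : IsLegendreCurve S α)
    (hreg : n₁ ≠ 0 → ∀ s ∈ S, α s 0 ≠ 0)
    (hψ₁ : IsLegendrianImmersion I₁ (sphereSign n₁) 1 ψ₁)
    (hψ₂ : IsLegendrianImmersion I₂ (adsSign n₂) (-1) ψ₂) (x : S × N₁ × N₂) :
    curvatureTrace (prodSign n₁ n₂) (-1)
      (diff (𝓘(ℝ, ℝ).prod (I₁.prod I₂)) (join S α ψ₁ ψ₂) x)
      (diff₂ (𝓘(ℝ, ℝ).prod (I₁.prod I₂)) (join S α ψ₁ ψ₂) x) (join S α ψ₁ ψ₂ x) =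
    Sum.elim ((-Complex.I * twist n₁ n₂ α x.1 * conj (α x.1 1)) • ψ₁ x.2.1 +
        (conj (α x.1 0))⁻¹ •
          curvatureTrace (sphereSign n₁) 1 (diff I₁ ψ₁ x.2.1) (diff₂ I₁ ψ₁ x.2.1) (ψ₁ x.2.1))
      ((-Complex.I * twist n₁ n₂ α x.1 * conj (α x.1 0)) • ψ₂ x.2.2 +
        (conj (α x.1 1))⁻¹ •
          curvatureTrace (adsSign n₂) (-1) (diff I₂ ψ₂ x.2.2) (diff₂ I₂ ψ₂ x.2.2) (ψ₂ x.2.2)) := by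
  obtain ⟨e₁, e₂, r₀, r₁, r₂, e, he₁, he₂, he, h0, h1, h2, ea, eb, ec⟩ :=
    exists_join_basis hα hreg hψ₁ hψ₂ x
  have hφ := isLegendrianImmersion_join hα hreg hψ₁ hψ₂
  set s : ℝ := (x.1 : ℝ) with hs_def
  have hs : s ∈ S := x.1.2
  have hh := hα.slope_ne_zero hs
  have hh' : conj (slope α s) ≠ 0 := (map_ne_zero _).2 hh
  set C₁ := curvatureTrace (sphereSign n₁) 1 (diff I₁ ψ₁ x.2.1) (diff₂ I₁ ψ₁ x.2.1) (ψ₁ x.2.1) with hC₁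
  set C₂ := curvatureTrace (adsSign n₂) (-1) (diff I₂ ψ₂ x.2.2) (diff₂ I₂ ψ₂ x.2.2) (ψ₂ x.2.2) with hC₂
  have hC₁z : herm (sphereSign n₁) C₁ (ψ₁ x.2.1) = 0 := hψ₁.herm_curvatureTrace one_ne_zero he₁
  have hC₂z : herm (adsSign n₂) C₂ (ψ₂ x.2.2) = 0 := hψ₂.herm_curvatureTrace (by norm_num) he₂
  have hd₁ : Module.finrank ℝ E₁ = n₁ := by simpa using hψ₁.dim
  have hd₂ : Module.finrank ℝ E₂ = n₂ := by simpa using hψ₂.dim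
  obtain ⟨ξ₁, hT₁⟩ := hψ₁.exists_sum_diff₂_eq he₁
  obtain ⟨ξ₂, hT₂⟩ := hψ₂.exists_sum_diff₂_eq he₂
  obtain ⟨ρ, hρ₁, hρ₂⟩ := hα.exists_acceleration_eq (n₁ := n₁) (n₂ := n₂) hreg hs
  have hν : Complex.I * phaseRate n₁ n₂ α s / conj (slope α s) = -Complex.I * twist n₁ n₂ α s := by
    rw [twist]; ring
  rw [hν] at hρ₁ hρ₂
  have hr₀ : (r₀ : ℂ) ^ 2 = (slope α s * conj (slope α s))⁻¹ := by
    rw [Complex.mul_conj, Complex.normSq_eq_norm_sq, ← Complex.ofReal_pow, ← Complex.ofReal_inv]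
    congr 1
    exact eq_inv_of_mul_eq_one_left h0
  have hscale : ∀ (r : ℝ) (z : ℂ), r ^ 2 * ‖z‖ ^ 2 = 1 → (r : ℂ) ^ 2 * z = (conj z)⁻¹ := fun r z h => by
    apply eq_inv_of_mul_eq_one_left
    rw [mul_assoc, Complex.mul_conj, Complex.normSq_eq_norm_sq]
    exact_mod_cast h
  -- The convention 0⁻¹ = 0 keeps this true at z = 0, which can occur for α₁ when n₁ = 0.
  have hinv : ∀ z : ℂ, (conj z)⁻¹ = z * ((‖z‖ ^ 2)⁻¹ : ℝ) := fun z => by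
    rcases eq_or_ne z 0 with rfl | hz
    · simp
    · rw [Complex.ofReal_inv, Complex.ofReal_pow, ← Complex.conj_mul']
      have := (map_ne_zero (starRingEnd ℂ)).2 hz
      field_simp
  have hS₁ : ((r₁ : ℂ) ^ 2 * α s 0) • ∑ i, diff₂ I₁ ψ₁ x.2.1 (e₁ i) (e₁ i) =
      (conj (α s 0))⁻¹ • ∑ i, diff₂ I₁ ψ₁ x.2.1 (e₁ i) (e₁ i) := by
    rcases eq_or_ne n₁ 0 with h | h
    · subst h; simp
    · rw [hscale _ _ (h1 h)]
  have hS₂ : ((r₂ : ℂ) ^ 2 * α s 1) • ∑ i, diff₂ I₂ ψ₂ x.2.2 (e₂ i) (e₂ i) =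
      (conj (α s 1))⁻¹ • ∑ i, diff₂ I₂ ψ₂ x.2.2 (e₂ i) (e₂ i) := by
    rw [hscale _ _ h2]
  have hR : ∀ w, herm (prodSign n₁ n₂)
      (Sum.elim ((-Complex.I * twist n₁ n₂ α s * conj (α s 1)) • ψ₁ x.2.1 + (conj (α s 0))⁻¹ • C₁)
        ((-Complex.I * twist n₁ n₂ α s * conj (α s 0)) • ψ₂ x.2.2 + (conj (α s 1))⁻¹ • C₂))
      (diff (𝓘(ℝ, ℝ).prod (I₁.prod I₂)) (join S α ψ₁ ψ₂) x w) = _ := fun w =>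
    herm_diff_join hα hψ₁ hψ₂ x w _ _ (by rw [herm_smul_left, hC₁z, mul_zero])
      (by rw [herm_smul_left, hC₂z, mul_zero])
  have hc := hα.mul_conj_sub hs
  -- ρ is the tangential acceleration of the curve, the ξᵢ are the tangential parts in the factors,
  -- and r is −dim/c with c = −1.
  refine he.curvatureTrace_eq_of_decomposition (by norm_num) (hφ.metric_diff x) (hφ.metric_self x)
    (ξ := (ρ, (‖α s 0‖ ^ 2)⁻¹ • ξ₁, (‖α s 1‖ ^ 2)⁻¹ • ξ₂)) (r := n₁ + n₂ + 1)
    (fun w => ?_) ?_ ?_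
  · rw [metric, hR w, herm_smul_left, herm_smul_left]
    have h3 : (w.1 : ℂ) * conj (slope α s) * (-Complex.I * twist n₁ n₂ α s * conj (α s 1) * α s 1 -
        -Complex.I * twist n₁ n₂ α s * conj (α s 0) * α s 0) =
        Complex.I * ((w.1 * phaseRate n₁ n₂ α s : ℝ) : ℂ) := by
      rw [← hν]
      push_cast
      field_simp
      linear_combination (-(w.1 : ℂ) * phaseRate n₁ n₂ α s) * hc
    have h4 : ∀ z v : ℂ, v.re = 0 → (conj z * ((conj z)⁻¹ * v)).re = 0 := fun z v hv => by
      rcases eq_or_ne z 0 with rfl | hz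
      · simp
      · rw [mul_inv_cancel_left₀ ((map_ne_zero _).2 hz), hv]
    rw [h3, Complex.add_re, Complex.add_re, h4 _ _ (hψ₁.metric_curvatureTrace_diff he₁ _),
      h4 _ _ (hψ₂.metric_curvatureTrace_diff he₂ _), Complex.I_mul_re, Complex.ofReal_im]
    simp
  · have h5 : join S α ψ₁ ψ₂ x = Sum.elim (α s 0 • ψ₁ x.2.1 + 0) (α s 1 • ψ₂ x.2.2 + 0) := by
      rw [add_zero, add_zero]; rfl
    rw [metric, h5, herm_prodSign_split (by simpa using hψ₁.herm_self x.2.1)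
      (by simpa using hψ₂.herm_self x.2.2) (by rw [herm_smul_left, hC₁z, mul_zero]) (by simp)
      (by rw [herm_smul_left, hC₂z, mul_zero]) (by simp), herm_zero_right, herm_zero_right]
    ring_nf
    simp
  · have ta : ∀ i, diff₂ (𝓘(ℝ, ℝ).prod (I₁.prod I₂)) (join S α ψ₁ ψ₂) x (e (Sum.inl i))
        (e (Sum.inl i)) = Sum.elim ((r₀ ^ 2 * deriv (deriv fun t => α t 0) s : ℂ) • ψ₁ x.2.1)
          ((r₀ ^ 2 * deriv (deriv fun t => α t 1) s : ℂ) • ψ₂ x.2.2) := fun i => by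
      rw [diff₂_join hα hψ₁ hψ₂, ea]
      simp [← hs_def]
    have tb : ∀ i, diff₂ (𝓘(ℝ, ℝ).prod (I₁.prod I₂)) (join S α ψ₁ ψ₂) x (e (Sum.inr (Sum.inl i)))
        (e (Sum.inr (Sum.inl i))) =
        Sum.elim ((r₁ ^ 2 * α s 0 : ℂ) • diff₂ I₁ ψ₁ x.2.1 (e₁ i) (e₁ i)) 0 := fun i => by
      rw [diff₂_join hα hψ₁ hψ₂, eb]
      simp only [map_smul, map_zero, smul_apply, ← Complex.coe_smul, smul_smul, ← hs_def]
      simp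
      congr 1
      module
    have tc : ∀ i, diff₂ (𝓘(ℝ, ℝ).prod (I₁.prod I₂)) (join S α ψ₁ ψ₂) x (e (Sum.inr (Sum.inr i)))
        (e (Sum.inr (Sum.inr i))) =
        Sum.elim (0 : Fin (n₁ + 1) → ℂ) ((r₂ ^ 2 * α s 1 : ℂ) • diff₂ I₂ ψ₂ x.2.2 (e₂ i) (e₂ i)) := fun i => by
      rw [diff₂_join hα hψ₁ hψ₂, ec]
      simp only [map_smul, map_zero, smul_apply, ← Complex.coe_smul, smul_smul, ← hs_def]
      simp
      congr 1
      module
    rw [Fintype.sum_sum_type, Fintype.sum_sum_type]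
    simp only [ta, tb, tc, sum_sumElim_zero_left, sum_sumElim_zero_right, ← Finset.smul_sum]
    rw [hS₁, hS₂, hT₁, hT₂, diff_join hα hψ₁ hψ₂, hd₁, hd₂]
    change _ = _ + ((n₁ + n₂ + 1 : ℝ)) • Sum.elim (α s 0 • ψ₁ x.2.1) (α s 1 • ψ₂ x.2.2)
    rw [← sumElim_smul, Finset.univ_unique, Finset.sum_singleton, ← sumElim_add, ← sumElim_add,
      ← sumElim_add, ← sumElim_add]
    rw [div_eq_mul_inv, mul_comm, ← hr₀] at hρ₁ hρ₂
    rw [sub_eq_iff_eq_add] at hρ₁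
    rw [← eq_sub_iff_add_eq] at hρ₂
    simp only [hρ₁, hρ₂, map_smul, ← Complex.coe_smul, hinv, smul_add, smul_smul]
    push_cast
    congr 1
    · rw [div_eq_mul_inv, hinv]
      push_cast
      module
    · rw [div_eq_mul_inv, hinv]
      push_cast
      module

end JoinCurvature

/-! ### Mean curvature as a differentiable field -/

section MeanCurvature

variable {E : Type*} [NormedAddCommGroup E] [NormedSpace ℝ E] [FiniteDimensional ℝ E]
  {H : Type*} [TopologicalSpace H] {I : ModelWithCorners ℝ E H} [I.Boundaryless]
  {M : Type*} [TopologicalSpace M] [ChartedSpace H M] {ι : Type*} [Fintype ι]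
  {ε : ι → ℝ} {c : ℝ} {φ : M → ι → ℂ}

lemma meanCurvature_eq_smul (x : M) : meanCurvature I ε c φ x = (Module.finrank ℝ E : ℝ)⁻¹ •
    curvatureTrace ε c (diff I φ x) (diff₂ I φ x) (φ x) := rfl

lemma mdifferentiableAt_of_localRep {f : M → ι → ℂ} {x : M}
    (hf : DifferentiableAt ℝ (localRep I f x) (extChartAt I x x)) :
    MDifferentiableAt I 𝓘(ℝ, ι → ℂ) f x := by
  refine (mdifferentiableAt_iff_localRep ?_).2 hf
  have h : ContinuousAt (localRep I f x ∘ extChartAt I x) x :=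
    ContinuousAt.comp hf.continuousAt (continuousAt_extChartAt x)
  refine h.congr ?_
  filter_upwards [extChartAt_source_mem_nhds (I := I) x] with y hy
  exact congrArg f ((extChartAt I x).left_inv hy)

lemma diff_smul_add {f g : M → ι → ℂ} {x : M} (r : ℝ) (hf : MDifferentiableAt I 𝓘(ℝ, ι → ℂ) f x)
    (hg : MDifferentiableAt I 𝓘(ℝ, ι → ℂ) g x) :
    diff I (r • (f + g)) x = r • (diff I f x + diff I g x) :=
  ((hf.hasMFDerivAt.add hg.hasMFDerivAt).const_smul r).mfderiv

variable [IsManifold I ∞ M]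

/-- In dimension 0 the normalization 0⁻¹ is 0 and the trace is an empty sum, so the identity
persists. -/
lemma curvatureTrace_eq_smul
    {n : ℕ} {x : M} {e : Module.Basis (Fin n) ℝ E} (he : IsOrtho ε (diff I φ x) e) :
    curvatureTrace ε c (diff I φ x) (diff₂ I φ x) (φ x) = (n : ℂ) • meanCurvature I ε c φ x := by
  have hd : Module.finrank ℝ E = n := by simp [Module.finrank_eq_card_basis e]
  rw [meanCurvature_eq_smul, hd, ← Complex.coe_smul, smul_smul]
  rcases eq_or_ne n 0 with rfl | hn
  · rw [he.curvatureTrace_eq, Finset.univ_eq_empty, Finset.sum_empty]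
    exact (map_zero (he.projNormalL c (φ x))).trans (by simp)
  · push_cast
    rw [mul_inv_cancel₀ (by exact_mod_cast hn), one_smul]

/-- The mean curvature vector is differentiable. -/
lemma IsLegendrianImmersion.mdifferentiableAt_meanCurvature (hφ : IsLegendrianImmersion I ε c φ)
    (hpos : ∀ x u, u ≠ 0 → 0 < metric ε (diff I φ x u) (diff I φ x u)) (x : M) :
    MDifferentiableAt I 𝓘(ℝ, ι → ℂ) (fun y => Complex.I • meanCurvature I ε c φ y) x :=
  mdifferentiableAt_of_localRep <|
    ((hφ.differentiableAt_localRep_curvatureTrace hpos x).const_smul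
      (Module.finrank ℝ E : ℝ)⁻¹).const_smul Complex.I

lemma IsLegendrianImmersion.herm_meanCurvature (hφ : IsLegendrianImmersion I ε c φ) (hc : c ≠ 0)
    {n : ℕ} {x : M} {e : Module.Basis (Fin n) ℝ E} (he : IsOrtho ε (diff I φ x) e) :
    herm ε (meanCurvature I ε c φ x) (φ x) = 0 := by
  rw [meanCurvature_eq_smul, herm_real_smul_left, hφ.herm_curvatureTrace hc he, mul_zero]

lemma IsOrtho.divergence {κ : Type*} [Fintype κ] [DecidableEq κ] {x : M} {e : Module.Basis κ ℝ E}
    (he : IsOrtho ε (diff I φ x) e) (X : M → ι → ℂ) :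
    divergence I ε φ X x = ∑ i, metric ε (diff I X x (e i)) (diff I φ x (e i)) :=
  he.gTrace (LinearMap.mk₂ ℝ (fun u v => metric ε (diff I X x u) (diff I φ x v))
    (by intros; rw [map_add, metric_add_left]) (by intros; rw [map_smul, metric_smul_left]; rfl)
    (by intros; rw [map_add, metric_add_right]) (by intros; rw [map_smul, metric_smul_right]; rfl))
    fun _ _ => rfl

end MeanCurvature

/-! ### Derivatives of the twist and of the normalized phase rate -/

section Twist

variable {S : TopologicalSpace.Opens ℝ} {α : ℝ → Fin 2 → ℂ} {s : ℝ} {n₁ n₂ : ℕ}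

namespace IsLegendreCurve

lemma differentiableAt_phaseRate (hα : IsLegendreCurve S α)
    (hreg : n₁ ≠ 0 → ∀ s ∈ S, α s 0 ≠ 0) (hs : s ∈ S) :
    DifferentiableAt ℝ (phaseRate n₁ n₂ α) s := by
  have hd : ∀ {f : ℝ → ℂ}, ContDiffOn ℝ ∞ f S → DifferentiableAt ℝ (deriv f) s := fun hf =>
    (((hf.deriv_of_isOpen (m := ∞) S.isOpen (by simp)).contDiffAt
      (S.isOpen.mem_nhds hs)).differentiableAt (by simp))
  have h1 := hd hα.contDiffOn_slope
  have h2 := hd (hα.contDiffOn_weight n₁ n₂)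
  have h3 : DifferentiableAt ℝ (fun s => deriv (slope α) s / slope α s +
      deriv (weight n₁ n₂ α) s / weight n₁ n₂ α s) s := by
    simp only [div_eq_mul_inv]
    exact (h1.mul ((hα.hasDerivAt_slope hs).differentiableAt.inv (hα.slope_ne_zero hs))).add
      (h2.mul ((hα.hasDerivAt_weight hs).differentiableAt.inv (hα.weight_ne_zero hreg hs)))
  exact Complex.imCLM.differentiableAt.comp s h3

/-- Differentiating −κ/h̄ and multiplying by h̄ gives −κ' + κ times the conjugate of h'/h. Its real
part is the contribution of the curve direction to the divergence, up to a positive factor. -/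
lemma exists_hasDerivAt_twist (hα : IsLegendreCurve S α)
    (hreg : n₁ ≠ 0 → ∀ s ∈ S, α s 0 ≠ 0) (hs : s ∈ S) :
    ∃ l, HasDerivAt (twist n₁ n₂ α) l s ∧ (l * conj (slope α s)).re =
      -deriv (phaseRate n₁ n₂ α) s +
        phaseRate n₁ n₂ α s * (deriv (slope α) s / slope α s).re := by
  have h1 : HasDerivAt (fun t => -((phaseRate n₁ n₂ α t : ℝ) : ℂ)) _ s :=
    (hα.differentiableAt_phaseRate (n₂ := n₂) hreg hs).hasDerivAt.ofReal_comp.neg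
  have h2 : HasDerivAt (fun t => conj (slope α t)) (conj (deriv (slope α) s)) s :=
    (hα.hasDerivAt_slope hs).star
  have hh : conj (slope α s) ≠ 0 := (map_ne_zero _).2 (hα.slope_ne_zero hs)
  refine ⟨_, h1.fun_div h2 hh, ?_⟩
  have h3 : (-((deriv (phaseRate n₁ n₂ α) s : ℝ) : ℂ) * conj (slope α s) -
      -((phaseRate n₁ n₂ α s : ℝ) : ℂ) * conj (deriv (slope α) s)) / conj (slope α s) ^ 2 *
      conj (slope α s) = -((deriv (phaseRate n₁ n₂ α) s : ℝ) : ℂ) +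
        (phaseRate n₁ n₂ α s : ℝ) * conj (deriv (slope α) s / slope α s) := by
    rw [map_div₀]
    field_simp
    ring
  rw [h3, Complex.add_re, Complex.re_ofReal_mul, Complex.conj_re, Complex.neg_re, Complex.ofReal_re]

/-- The normalized phase rate is constant when its logarithmic derivative vanishes. -/
lemma exists_phaseRate_eq_iff (hα : IsLegendreCurve S α) (hS : (S : Set ℝ).OrdConnected)
    (hS' : (S : Set ℝ).Nonempty) (hreg : n₁ ≠ 0 → ∀ s ∈ S, α s 0 ≠ 0) :
    (∃ μ : ℝ, ∀ s ∈ S, phaseRate n₁ n₂ α s * (‖weight n₁ n₂ α s‖ / ‖slope α s‖) = μ) ↔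
      ∀ s ∈ S, -deriv (phaseRate n₁ n₂ α) s + phaseRate n₁ n₂ α s *
        ((deriv (slope α) s / slope α s).re -
          (deriv (weight n₁ n₂ α) s / weight n₁ n₂ α s).re) = 0 := by
  have hd : ∀ s ∈ S, HasDerivAt
      (fun s => phaseRate n₁ n₂ α s * (‖weight n₁ n₂ α s‖ / ‖slope α s‖))
      (-(‖weight n₁ n₂ α s‖ / ‖slope α s‖) * (-deriv (phaseRate n₁ n₂ α) s + phaseRate n₁ n₂ α s *
        ((deriv (slope α) s / slope α s).re -
          (deriv (weight n₁ n₂ α) s / weight n₁ n₂ α s).re))) s := fun s hs => by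
    have h1 := (hα.differentiableAt_phaseRate (n₂ := n₂) hreg hs).hasDerivAt
    have h2 := hasDerivAt_norm (hα.hasDerivAt_slope hs) (hα.slope_ne_zero hs)
    have h3 := hasDerivAt_norm (hα.hasDerivAt_weight hs) (hα.weight_ne_zero (n₂ := n₂) hreg hs)
    have hn : ‖slope α s‖ ≠ 0 := norm_ne_zero_iff.2 (hα.slope_ne_zero hs)
    refine (h1.fun_mul (h3.fun_div h2 hn)).congr_deriv ?_
    field_simp
    ring
  constructor
  · rintro ⟨μ, hμ⟩ s hs
    have h0 : HasDerivAt (fun _ : ℝ => μ) _ s := (hd s hs).congr_of_eventuallyEq <| by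
      filter_upwards [S.isOpen.mem_nhds hs] with t ht using (hμ t ht).symm
    have := h0.unique (hasDerivAt_const s μ)
    refine (mul_eq_zero.1 this).resolve_left (neg_ne_zero.2 (div_ne_zero ?_ ?_))
    · exact norm_ne_zero_iff.2 (hα.weight_ne_zero hreg hs)
    · exact norm_ne_zero_iff.2 (hα.slope_ne_zero hs)
  · intro h
    obtain ⟨s₀, hs₀⟩ := hS'
    refine ⟨_, fun s hs => S.isOpen.is_const_of_deriv_eq_zero hS.convex.isPreconnected
        (fun x hx => (hd x hx).differentiableAt.differentiableWithinAt)
        (fun x hx => ?_) hs hs₀⟩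
    rw [(hd x hx).deriv, h x hx, mul_zero]
    rfl

/-- With 1/z = r² z̄ both terms of w'/w become multiples of h ᾱ₁ ᾱ₂. This is the form in which the
fibre directions enter the divergence. -/
lemma weight_deriv_div_re (hα : IsLegendreCurve S α) (hreg : n₁ ≠ 0 → ∀ s ∈ S, α s 0 ≠ 0)
    (hs : s ∈ S) {r₁ r₂ : ℝ} (h₁ : n₁ ≠ 0 → r₁ ^ 2 * ‖α s 0‖ ^ 2 = 1)
    (h₂ : r₂ ^ 2 * ‖α s 1‖ ^ 2 = 1) :
    (deriv (weight n₁ n₂ α) s / weight n₁ n₂ α s).re =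
      (n₁ * r₁ ^ 2 + n₂ * r₂ ^ 2) * (slope α s * conj (α s 0) * conj (α s 1)).re := by
  have key : ∀ (r : ℝ) (z : ℂ), z ≠ 0 → r ^ 2 * ‖z‖ ^ 2 = 1 → z⁻¹ = (r ^ 2 : ℝ) * conj z :=
    fun r z hz h => by
      apply inv_eq_of_mul_eq_one_left
      rw [mul_assoc, Complex.conj_mul']
      exact_mod_cast h
  rw [hα.weight_deriv_div hreg hs, ← Complex.re_ofReal_mul]
  congr 1
  rw [div_eq_mul_inv _ (α s 1), key r₂ _ (hα.snd_ne_zero hs) h₂]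
  rcases eq_or_ne n₁ 0 with rfl | hn
  · push_cast
    ring
  · rw [div_eq_mul_inv _ (α s 0), key r₁ _ (hreg hn s hs) (h₁ hn)]
    push_cast
    ring

end IsLegendreCurve

end Twist

/-! ### Mean curvature of the join and the divergence of its rotation by J -/

section JoinMean

lemma herm_self_eq {ι : Type*} [Fintype ι] (ε : ι → ℝ) (z : ι → ℂ) :
    herm ε z z = (metric ε z z : ℂ) :=
  (Complex.conj_eq_iff_re.1 (conj_herm ε z z)).symm

variable {E₁ E₂ : Type*} [NormedAddCommGroup E₁] [NormedSpace ℝ E₁]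
  [NormedAddCommGroup E₂] [NormedSpace ℝ E₂]
  {H₁ H₂ : Type*} [TopologicalSpace H₁] [TopologicalSpace H₂]
  {I₁ : ModelWithCorners ℝ E₁ H₁} [I₁.Boundaryless] {I₂ : ModelWithCorners ℝ E₂ H₂}
  [I₂.Boundaryless]
  {N₁ N₂ : Type*} [TopologicalSpace N₁] [ChartedSpace H₁ N₁] [TopologicalSpace N₂]
  [ChartedSpace H₂ N₂] [IsManifold I₁ ∞ N₁] [IsManifold I₂ ∞ N₂]
  {S : TopologicalSpace.Opens ℝ} {α : ℝ → Fin 2 → ℂ}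
  {n₁ n₂ : ℕ} {ψ₁ : N₁ → Fin (n₁ + 1) → ℂ} {ψ₂ : N₂ → Fin (n₂ + 1) → ℂ}
  [FiniteDimensional ℝ E₁] [FiniteDimensional ℝ E₂]

/-- The mean curvature vector of the join. -/
lemma meanCurvature_join (hα : IsLegendreCurve S α)
    (hreg : n₁ ≠ 0 → ∀ s ∈ S, α s 0 ≠ 0)
    (hψ₁ : IsLegendrianImmersion I₁ (sphereSign n₁) 1 ψ₁)
    (hψ₂ : IsLegendrianImmersion I₂ (adsSign n₂) (-1) ψ₂) (x : S × N₁ × N₂) :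
    meanCurvature (𝓘(ℝ, ℝ).prod (I₁.prod I₂)) (prodSign n₁ n₂) (-1) (join S α ψ₁ ψ₂) x =
    (n₁ + n₂ + 1 : ℝ)⁻¹ • Sum.elim ((-Complex.I * twist n₁ n₂ α x.1 * conj (α x.1 1)) • ψ₁ x.2.1 +
        (n₁ * (conj (α x.1 0))⁻¹) • meanCurvature I₁ (sphereSign n₁) 1 ψ₁ x.2.1)
      ((-Complex.I * twist n₁ n₂ α x.1 * conj (α x.1 0)) • ψ₂ x.2.2 +
        (n₂ * (conj (α x.1 1))⁻¹) • meanCurvature I₂ (adsSign n₂) (-1) ψ₂ x.2.2) := by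
  obtain ⟨e₁, e₂, r₀, r₁, r₂, e, he₁, he₂, he, -⟩ := exists_join_basis hα hreg hψ₁ hψ₂ x
  have hd : Module.finrank ℝ (ℝ × E₁ × E₂) = n₁ + n₂ + 1 := by
    rw [Module.finrank_eq_card_basis e]
    simp only [Fintype.card_sum, Fintype.card_unit, Fintype.card_fin]
    omega
  rw [meanCurvature_eq_smul,
    curvatureTrace_join hα hreg hψ₁ hψ₂, curvatureTrace_eq_smul he₁,
    curvatureTrace_eq_smul he₂, hd, smul_smul, smul_smul, mul_comm _ (n₁ : ℂ),
    mul_comm _ (n₂ : ℂ)]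
  push_cast
  rfl

lemma twist_eq_zero_iff (hα : IsLegendreCurve S α) {s : ℝ} (hs : s ∈ S) :
    twist n₁ n₂ α s = 0 ↔ phaseRate n₁ n₂ α s = 0 := by
  simp [twist, hα.slope_ne_zero hs]

/-- Pairing the first component with ψ₁ removes H₁ and isolates the twist, since ᾱ₂ ≠ 0; then each
Hᵢ is left with a nonzero coefficient. A factor of dimension 0 has Hᵢ = 0 by the convention 0⁻¹ = 0.
-/
lemma meanCurvature_join_eq_zero_iff (hα : IsLegendreCurve S α)
    (hreg : n₁ ≠ 0 → ∀ s ∈ S, α s 0 ≠ 0)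
    (hψ₁ : IsLegendrianImmersion I₁ (sphereSign n₁) 1 ψ₁)
    (hψ₂ : IsLegendrianImmersion I₂ (adsSign n₂) (-1) ψ₂) (x : S × N₁ × N₂) :
    meanCurvature (𝓘(ℝ, ℝ).prod (I₁.prod I₂)) (prodSign n₁ n₂) (-1) (join S α ψ₁ ψ₂) x = 0 ↔
      meanCurvature I₁ (sphereSign n₁) 1 ψ₁ x.2.1 = 0 ∧
      meanCurvature I₂ (adsSign n₂) (-1) ψ₂ x.2.2 = 0 ∧ phaseRate n₁ n₂ α x.1 = 0 := by
  obtain ⟨e₁, e₂, r₀, r₁, r₂, e, he₁, he₂, -⟩ := exists_join_basis hα hreg hψ₁ hψ₂ x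
  have hd₁ : Module.finrank ℝ E₁ = n₁ := by simpa using hψ₁.dim
  have hd₂ : Module.finrank ℝ E₂ = n₂ := by simpa using hψ₂.dim
  have hy := hα.snd_ne_zero x.1.2
  have hy' : conj (α x.1 1) ≠ 0 := (map_ne_zero _).2 hy
  have hn : (n₁ + n₂ + 1 : ℝ)⁻¹ ≠ 0 := by positivity
  have hzero : (0 : Fin (n₁ + 1) ⊕ Fin (n₂ + 1) → ℂ) =
      Sum.elim (0 : Fin (n₁ + 1) → ℂ) (0 : Fin (n₂ + 1) → ℂ) := by
    ext i; cases i <;> rfl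
  rw [meanCurvature_join hα hreg hψ₁ hψ₂, smul_eq_zero_iff_right hn, hzero, Sum.elim_eq_iff,
    ← twist_eq_zero_iff hα x.1.2]
  constructor
  · rintro ⟨h1, h2⟩
    have h3 := congrArg (fun v => herm (sphereSign n₁) v (ψ₁ x.2.1)) h1
    simp only [herm_add_left, herm_smul_left, hψ₁.herm_self, herm_zero_left,
      hψ₁.herm_meanCurvature one_ne_zero he₁] at h3
    have ht : twist n₁ n₂ α x.1 = 0 := by simpa [hy] using h3
    rw [ht, mul_zero, zero_mul, zero_smul, zero_add] at h1 h2
    refine ⟨?_, ?_, ht⟩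
    · rcases eq_or_ne n₁ 0 with h | h
      · have h0 : (n₁ : ℝ)⁻¹ = 0 := by simp [h]
        rw [meanCurvature_eq_smul, hd₁, h0, zero_smul]
      · exact (smul_eq_zero.1 h1).resolve_left (mul_ne_zero (Nat.cast_ne_zero.2 h)
          (inv_ne_zero ((map_ne_zero _).2 (hreg h _ x.1.2))))
    · rcases eq_or_ne n₂ 0 with h | h
      · have h0 : (n₂ : ℝ)⁻¹ = 0 := by simp [h]
        rw [meanCurvature_eq_smul, hd₂, h0, zero_smul]
      · exact (smul_eq_zero.1 h2).resolve_left (mul_ne_zero (Nat.cast_ne_zero.2 h)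
          (inv_ne_zero hy'))
  · rintro ⟨h1, h2, h3⟩
    rw [h1, h2, h3]
    simp

/-- The divergence of `J H` for the join of two contact minimal immersions. -/
lemma divergence_join (hα : IsLegendreCurve S α)
    (hreg : n₁ ≠ 0 → ∀ s ∈ S, α s 0 ≠ 0)
    (hψ₁ : IsCMinimalLegendrian I₁ (sphereSign n₁) 1 ψ₁)
    (hψ₂ : IsCMinimalLegendrian I₂ (adsSign n₂) (-1) ψ₂) (x : S × N₁ × N₂) :
    divergence (𝓘(ℝ, ℝ).prod (I₁.prod I₂)) (prodSign n₁ n₂) (join S α ψ₁ ψ₂)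
      (fun y => Complex.I • meanCurvature (𝓘(ℝ, ℝ).prod (I₁.prod I₂)) (prodSign n₁ n₂) (-1)
        (join S α ψ₁ ψ₂) y) x = 0 ↔
      -deriv (phaseRate n₁ n₂ α) x.1 + phaseRate n₁ n₂ α x.1 *
        ((deriv (slope α) x.1 / slope α x.1).re -
          (deriv (weight n₁ n₂ α) x.1 / weight n₁ n₂ α x.1).re) = 0 := by
  obtain ⟨hψ₁, hdiv₁⟩ := hψ₁
  obtain ⟨hψ₂, hdiv₂⟩ := hψ₂
  obtain ⟨e₁, e₂, r₀, r₁, r₂, e, he₁, he₂, he, h0, h1, h2, ea, eb, ec⟩ :=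
    exists_join_basis hα hreg hψ₁ hψ₂ x
  have hs : (x.1 : ℝ) ∈ S := x.1.2
  set X₁ : N₁ → Fin (n₁ + 1) → ℂ := fun y => Complex.I • meanCurvature I₁ (sphereSign n₁) 1 ψ₁ y
    with hX₁
  set X₂ : N₂ → Fin (n₂ + 1) → ℂ := fun y => Complex.I • meanCurvature I₂ (adsSign n₂) (-1) ψ₂ y
    with hX₂
  have hX₁d : MDifferentiableAt I₁ 𝓘(ℝ, Fin (n₁ + 1) → ℂ) X₁ x.2.1 :=
    hψ₁.mdifferentiableAt_meanCurvature hψ₁.sphere_pos x.2.1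
  have hX₂d : MDifferentiableAt I₂ 𝓘(ℝ, Fin (n₂ + 1) → ℂ) X₂ x.2.2 :=
    hψ₂.mdifferentiableAt_meanCurvature hψ₂.ads_pos x.2.2
  have hX₁z : herm (sphereSign n₁) (X₁ x.2.1) (ψ₁ x.2.1) = 0 := by
    rw [hX₁, herm_smul_left, hψ₁.herm_meanCurvature one_ne_zero he₁, mul_zero]
  have hX₂z : herm (adsSign n₂) (X₂ x.2.2) (ψ₂ x.2.2) = 0 := by
    rw [hX₂, herm_smul_left, hψ₂.herm_meanCurvature (by norm_num) he₂, mul_zero]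
  obtain ⟨l, hl, hlre⟩ := hα.exists_hasDerivAt_twist (n₁ := n₁) (n₂ := n₂) hreg hs
  obtain ⟨hc0, hc1⟩ := hα.hasDerivAt_conj_apply hs
  have hβ₁ : DifferentiableAt ℝ (fun s => (n₁ : ℂ) * (conj (α s 0))⁻¹) x.1 := by
    rcases eq_or_ne n₁ 0 with h | h
    · simp [h]
    · exact (hc0.differentiableAt.inv ((map_ne_zero _).2 (hreg h _ hs))).const_mul _
  have hβ₂ : DifferentiableAt ℝ (fun s => (n₂ : ℂ) * (conj (α s 1))⁻¹) x.1 :=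
    (hc1.differentiableAt.inv ((map_ne_zero _).2 (hα.snd_ne_zero hs))).const_mul _
  obtain ⟨hm₁, hD₁⟩ := hasDiff_joinOf (I₁ := I₁) (I₂ := I₂) (hl.mul hc1) (hl.mul hc0)
    (hψ₁.mdifferentiableAt x.2.1) (hψ₂.mdifferentiableAt x.2.2)
  obtain ⟨hm₂, hD₂⟩ := hasDiff_joinOf (I₁ := I₁) (I₂ := I₂) hβ₁.hasDerivAt hβ₂.hasDerivAt hX₁d hX₂d
  -- J H is a multiple of a sum of two maps of join shape, one built from the position vectors and
  -- one from the J Hᵢ, so the differential of a join applies to each.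
  have hfield : (fun y => Complex.I • meanCurvature (𝓘(ℝ, ℝ).prod (I₁.prod I₂)) (prodSign n₁ n₂)
      (-1) (join S α ψ₁ ψ₂) y) = (n₁ + n₂ + 1 : ℝ)⁻¹ •
        (joinOf (fun s : S => (twist n₁ n₂ α * fun t => conj (α t 1)) s)
          (fun s : S => (twist n₁ n₂ α * fun t => conj (α t 0)) s) ψ₁ ψ₂ +
        joinOf (fun s : S => (fun s => (n₁ : ℂ) * (conj (α s 0))⁻¹) s)
          (fun s : S => (fun s => (n₂ : ℂ) * (conj (α s 1))⁻¹) s) X₁ X₂) := by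
    funext y
    have hI : Complex.I * Complex.I = -1 := Complex.I_mul_I
    have hIt : ∀ t z : ℂ, Complex.I * (-Complex.I * t * z) = t * z := fun t z => by
      linear_combination (-t * z) * hI
    rw [meanCurvature_join hα hreg hψ₁ hψ₂, smul_comm, ← sumElim_smul]
    simp only [Pi.smul_apply, Pi.add_apply, Pi.mul_apply, joinOf, ← sumElim_add, smul_add, smul_smul,
      hIt, hX₁, hX₂, mul_comm Complex.I ((_ : ℂ) * _⁻¹)]
  set Φ := join S α ψ₁ ψ₂ with hΦ
  set lam := twist n₁ n₂ α x.1 with hlam_def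
  -- The vector on the right is left to unification with the outcome of the rewriting.
  have hDX : ∀ w : ℝ × E₁ × E₂, diff (𝓘(ℝ, ℝ).prod (I₁.prod I₂))
      (fun y => Complex.I • meanCurvature (𝓘(ℝ, ℝ).prod (I₁.prod I₂)) (prodSign n₁ n₂)
      (-1) Φ y) x w = (n₁ + n₂ + 1 : ℝ)⁻¹ • (_ : Fin (n₁ + 1) ⊕ Fin (n₂ + 1) → ℂ) := fun w => by
    rw [hfield, diff_smul_add _ hm₁ hm₂, hD₁, hD₂]
    simp only [smul_apply, add_apply, joinDiff_apply]
    rw [← sumElim_add]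
  have hc := hα.mul_conj_sub hs
  have hn : (n₁ + n₂ + 1 : ℝ)⁻¹ ≠ 0 := by positivity
  -- Only derivatives of the twist survive: those of ᾱ₂ and ᾱ₁ give h̄ (α₁α₂ − α₂α₁) = 0, and the J
  -- Hᵢ terms are orthogonal to the positions.
  have ta : ∀ i, metric (prodSign n₁ n₂) (diff (𝓘(ℝ, ℝ).prod (I₁.prod I₂))
      (fun y => Complex.I • meanCurvature (𝓘(ℝ, ℝ).prod (I₁.prod I₂)) (prodSign n₁ n₂)
      (-1) Φ y) x (e (Sum.inl i))) (diff (𝓘(ℝ, ℝ).prod (I₁.prod I₂)) Φ x (e (Sum.inl i))) =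
      (n₁ + n₂ + 1 : ℝ)⁻¹ * (r₀ ^ 2 * (l * conj (slope α x.1)).re) := fun i => by
    rw [hDX, metric_smul_left, ea]
    simp only [map_zero, smul_zero, add_zero]
    rw [metric, herm_diff_join hα hψ₁ hψ₂ _ _ _ _ (by rw [herm_smul_left, hX₁z, mul_zero])
      (by rw [herm_smul_left, hX₂z, mul_zero])]
    simp only [map_zero, herm_zero_right, mul_zero, add_zero]
    refine congrArg (HMul.hMul _) ?_
    rw [← Complex.re_ofReal_mul]
    refine congrArg Complex.re ?_
    push_cast
    linear_combination (-(r₀ : ℂ) ^ 2 * l * conj (slope α x.1)) * hc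
  have hβ : ∀ (k : ℕ) (z v : ℂ), (k = 0 ∨ z ≠ 0) → conj z * (k * (conj z)⁻¹ * v) = k * v := by
    rintro k z v (rfl | hz)
    · simp
    · have := (map_ne_zero (starRingEnd ℂ)).2 hz
      field_simp
  have tb : ∀ i, metric (prodSign n₁ n₂) (diff (𝓘(ℝ, ℝ).prod (I₁.prod I₂))
      (fun y => Complex.I • meanCurvature (𝓘(ℝ, ℝ).prod (I₁.prod I₂)) (prodSign n₁ n₂)
      (-1) Φ y) x (e (Sum.inr (Sum.inl i))))
      (diff (𝓘(ℝ, ℝ).prod (I₁.prod I₂)) Φ x (e (Sum.inr (Sum.inl i)))) =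
      (n₁ + n₂ + 1 : ℝ)⁻¹ * (r₁ ^ 2 * ((lam * conj (α x.1 0) * conj (α x.1 1)).re +
        n₁ * metric (sphereSign n₁) (diff I₁ X₁ x.2.1 (e₁ i)) (diff I₁ ψ₁ x.2.1 (e₁ i)))) :=
      fun i => by
    have hii : metric (sphereSign n₁) (diff I₁ ψ₁ x.2.1 (e₁ i)) (diff I₁ ψ₁ x.2.1 (e₁ i)) = 1 := by
      simpa using he₁ i i
    have h3 := hβ n₁ (α x.1 0) (herm (sphereSign n₁) (diff I₁ X₁ x.2.1 (e₁ i))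
      (diff I₁ ψ₁ x.2.1 (e₁ i))) (by
        by_cases h : n₁ = 0
        · exact Or.inl h
        · exact Or.inr (hreg h _ hs))
    rw [hDX, metric_smul_left, eb, hΦ, diff_join hα hψ₁ hψ₂]
    simp only [map_zero, smul_zero, Complex.ofReal_zero, zero_mul, zero_smul, zero_add, add_zero,
      map_smul]
    rw [metric, herm_prodSign, herm_zero_left, add_zero]
    simp only [herm_add_left, herm_smul_left, herm_smul_right, herm_real_smul_left,
      herm_real_smul_right, herm_self_eq, hii]
    rw [metric, ← Complex.re_ofReal_mul n₁, ← Complex.add_re]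
    refine congrArg (HMul.hMul _) ?_
    rw [← Complex.re_ofReal_mul]
    refine congrArg Complex.re ?_
    simp only [Pi.mul_apply]
    push_cast
    linear_combination (r₁ : ℂ) ^ 2 * h3
  have tc : ∀ i, metric (prodSign n₁ n₂) (diff (𝓘(ℝ, ℝ).prod (I₁.prod I₂))
      (fun y => Complex.I • meanCurvature (𝓘(ℝ, ℝ).prod (I₁.prod I₂)) (prodSign n₁ n₂)
      (-1) Φ y) x (e (Sum.inr (Sum.inr i))))
      (diff (𝓘(ℝ, ℝ).prod (I₁.prod I₂)) Φ x (e (Sum.inr (Sum.inr i)))) =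
      (n₁ + n₂ + 1 : ℝ)⁻¹ * (r₂ ^ 2 * ((lam * conj (α x.1 0) * conj (α x.1 1)).re +
        n₂ * metric (adsSign n₂) (diff I₂ X₂ x.2.2 (e₂ i)) (diff I₂ ψ₂ x.2.2 (e₂ i)))) :=
      fun i => by
    have hii : metric (adsSign n₂) (diff I₂ ψ₂ x.2.2 (e₂ i)) (diff I₂ ψ₂ x.2.2 (e₂ i)) = 1 := by
      simpa using he₂ i i
    have h3 := hβ n₂ (α x.1 1) (herm (adsSign n₂) (diff I₂ X₂ x.2.2 (e₂ i))
      (diff I₂ ψ₂ x.2.2 (e₂ i))) (Or.inr (hα.snd_ne_zero hs))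
    rw [hDX, metric_smul_left, ec, hΦ, diff_join hα hψ₁ hψ₂]
    simp only [map_zero, smul_zero, Complex.ofReal_zero, zero_mul, zero_smul, zero_add, add_zero,
      map_smul]
    rw [metric, herm_prodSign, herm_zero_left, zero_add]
    simp only [herm_add_left, herm_smul_left, herm_smul_right, herm_real_smul_left,
      herm_real_smul_right, herm_self_eq, hii]
    rw [metric, ← Complex.re_ofReal_mul n₂, ← Complex.add_re]
    refine congrArg (HMul.hMul _) ?_
    rw [← Complex.re_ofReal_mul]
    refine congrArg Complex.re ?_
    simp only [Pi.mul_apply]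
    push_cast
    linear_combination (r₂ : ℂ) ^ 2 * h3
  have hd₁ := hdiv₁ x.2.1
  have hd₂ := hdiv₂ x.2.2
  rw [he₁.divergence] at hd₁
  rw [he₂.divergence] at hd₂
  -- Here f runs over the summands of div J Hᵢ, so contact minimality of the factors removes it.
  have hsum : ∀ (n : ℕ) (a r b k : ℝ) (f : Fin n → ℝ), ∑ i, f i = 0 →
      ∑ i, a * (r * (b + k * f i)) = a * (r * (n * b)) := fun n a r b k f hf => by
    rw [← Finset.mul_sum, ← Finset.mul_sum, Finset.sum_add_distrib, ← Finset.mul_sum, hf]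
    simp
  have hr₀ : r₀ ≠ 0 := by rintro rfl; simp at h0
  -- Since r₀² = 1/|h|², the twist −κ/h̄ equals −κ r₀² h.
  have hlam : (lam * conj (α x.1 0) * conj (α x.1 1)).re =
      -(phaseRate n₁ n₂ α x.1 * r₀ ^ 2) *
        (slope α x.1 * conj (α x.1 0) * conj (α x.1 1)).re := by
    rw [← Complex.re_ofReal_mul]
    congr 1
    have h4 : (r₀ : ℂ) ^ 2 * (slope α x.1 * conj (slope α x.1)) = 1 := by
      rw [Complex.mul_conj, Complex.normSq_eq_norm_sq]
      exact_mod_cast h0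
    have h5 : conj (slope α x.1) ≠ 0 := (map_ne_zero _).2 (hα.slope_ne_zero hs)
    rw [hlam_def, twist]
    push_cast
    field_simp
    linear_combination (phaseRate n₁ n₂ α x.1 : ℂ) * conj (α x.1 0) * conj (α x.1 1) * h4
  rw [he.divergence, Fintype.sum_sum_type, Fintype.sum_sum_type]
  simp only [ta, tb, tc]
  rw [hsum _ _ _ _ _ _ hd₁, hsum _ _ _ _ _ _ hd₂, hlre, hα.weight_deriv_div_re hreg hs h1 h2,
    Finset.univ_unique, Finset.sum_singleton, hlam]
  have h6 : (n₁ + n₂ + 1 : ℝ)⁻¹ * r₀ ^ 2 ≠ 0 := mul_ne_zero hn (pow_ne_zero 2 hr₀)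
  conv_rhs => rw [← mul_eq_zero_iff_left h6]
  constructor <;> intro h7 <;> linear_combination h7

end JoinMean

end Legendrian

/-! ### Assembly of the equivalences -/

theorem corollary7 (n₁ n₂ : ℕ)
    {N₁ : Type*} [TopologicalSpace N₁] [ChartedSpace (EuclideanSpace ℝ (Fin n₁)) N₁]
    [IsManifold (𝓡 n₁) ∞ N₁] [Nonempty N₁]
    {N₂ : Type*} [TopologicalSpace N₂] [ChartedSpace (EuclideanSpace ℝ (Fin n₂)) N₂]
    [IsManifold (𝓡 n₂) ∞ N₂] [Nonempty N₂]
    (ψ₁ : N₁ → Fin (n₁ + 1) → ℂ)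
    (hψ₁ : Legendrian.IsCMinimalLegendrian (𝓡 n₁) (Legendrian.sphereSign n₁) 1 ψ₁)
    (ψ₂ : N₂ → Fin (n₂ + 1) → ℂ)
    (hψ₂ : Legendrian.IsCMinimalLegendrian (𝓡 n₂) (Legendrian.adsSign n₂) (-1) ψ₂)
    (S : TopologicalSpace.Opens ℝ) (hS : (S : Set ℝ).OrdConnected) (hS' : (S : Set ℝ).Nonempty)
    (α : ℝ → Fin 2 → ℂ) (hα : Legendrian.IsLegendreCurve S α)
    (hreg : n₁ ≠ 0 → ∀ s ∈ S, α s 0 ≠ 0) :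
    Legendrian.IsLegendrianImmersion (𝓘(ℝ, ℝ).prod ((𝓡 n₁).prod (𝓡 n₂)))
      (Legendrian.prodSign n₁ n₂) (-1) (Legendrian.join S α ψ₁ ψ₂) ∧
    (Legendrian.IsCMinimalLegendrian (𝓘(ℝ, ℝ).prod ((𝓡 n₁).prod (𝓡 n₂)))
        (Legendrian.prodSign n₁ n₂) (-1) (Legendrian.join S α ψ₁ ψ₂) ↔
      ∃ μ : ℝ, Legendrian.SolvesODEUpToCongruence n₁ n₂ μ S α) ∧
    (Legendrian.IsMinimalLegendrian (𝓘(ℝ, ℝ).prod ((𝓡 n₁).prod (𝓡 n₂)))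
        (Legendrian.prodSign n₁ n₂) (-1) (Legendrian.join S α ψ₁ ψ₂) ↔
      Legendrian.IsMinimalLegendrian (𝓡 n₁) (Legendrian.sphereSign n₁) 1 ψ₁ ∧
      Legendrian.IsMinimalLegendrian (𝓡 n₂) (Legendrian.adsSign n₂) (-1) ψ₂ ∧
      Legendrian.SolvesODEUpToCongruence n₁ n₂ 0 S α) := by
  have hjoin := Legendrian.isLegendrianImmersion_join hα hreg hψ₁.1 hψ₂.1
  obtain ⟨p⟩ := ‹Nonempty N₁›
  obtain ⟨q⟩ := ‹Nonempty N₂›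
  refine ⟨hjoin, ?_, ?_⟩
  · simp only [Legendrian.solvesODEUpToCongruence_iff hS hS' hα hreg]
    rw [hα.exists_phaseRate_eq_iff hS hS' hreg]
    constructor
    -- The condition involves only s, so a single point of N₁ × N₂ is enough to read it off.
    · intro h s hs
      exact (Legendrian.divergence_join hα hreg hψ₁ hψ₂ (⟨s, hs⟩, p, q)).1 (h.2 _)
    · intro h
      exact ⟨hjoin, fun x => (Legendrian.divergence_join hα hreg hψ₁ hψ₂ x).2 (h _ x.1.2)⟩
  · have hH := Legendrian.meanCurvature_join_eq_zero_iff hα hreg hψ₁.1 hψ₂.1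
    rw [Legendrian.solvesODEUpToCongruence_iff hS hS' hα hreg]
    have hrate : ∀ s ∈ S, Legendrian.phaseRate n₁ n₂ α s *
        (‖Legendrian.weight n₁ n₂ α s‖ / ‖Legendrian.slope α s‖) = 0 ↔
        Legendrian.phaseRate n₁ n₂ α s = 0 := fun s hs => by
      simp [hα.weight_ne_zero hreg hs, hα.slope_ne_zero hs]
    obtain ⟨s₀, hs₀⟩ := hS'
    constructor
    · intro h
      refine ⟨⟨hψ₁.1, fun p' => ((hH (⟨s₀, hs₀⟩, p', q)).1 (h.2 _)).1⟩,
        ⟨hψ₂.1, fun q' => ((hH (⟨s₀, hs₀⟩, p, q')).1 (h.2 _)).2.1⟩, fun s hs => ?_⟩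
      exact (hrate s hs).2 ((hH (⟨s, hs⟩, p, q)).1 (h.2 _)).2.2
    · rintro ⟨h₁, h₂, h₃⟩
      exact ⟨hjoin, fun x => (hH x).2 ⟨h₁.2 _, h₂.2 _, (hrate _ x.1.2).1 (h₃ _ x.1.2)⟩⟩
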